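/- Let $\mathcal X$ be a nonempty finite set and let $r(x,y)\ge 0$, $x,y\in\mathcal X$, with $r(x,x)=0$, be jump rates that are irreducible (any state can be reached from any other one through jumps of positive rate). Let $(X_t)_{t\ge0}$ be the Markov jump process with rates $r$, with generator $\mathcal L f(x)=\sum_y r(x,y)[f(y)-f(x)]$ and unique invariant distribution $\pi$; write $\langle f,h\rangle=\sum_x\pi(x)f(x)h(x)$ (for real $f,h$) and $r^*(x,y)=\pi(y)r(y,x)/\pi(x)$. Let $T>0$ and let $g:\mathbb R\times\mathcal X\times\mathcal X\to\mathbb R$ be bounded, measurable and $T$-periodic in time. For $\lambda\in\mathbb R$ let $(X^\lambda_t)_{t\ge0}$ be the time-inhomogeneous Markov jump process with rates $r^\lambda(s,x,y)=e^{\lambda g(s,x,y)}r(x,y)$: a process arriving in $x$ at time $s$ is still waiting there at time $u$ with probability $\exp\{-\int_s^u\sum_y r^\lambda(\tau,x,y)\,d\tau\}$, and when it jumps, at time $u$, it jumps to $y$ with probability proportional to $r^\lambda(u,x,y)$. Both here and below $\mathbb E_\nu$ refers to the process with initial distribution $\nu$ at time $0$. The discrete-time chain $(X^\lambda_{nT})_{n\ge0}$,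 which has transition matrix $\mathbb P_x(X^\lambda_T=y)$, has exactly one invariant distribution $\pi_\lambda$; the perturbed process started from $\pi_\lambda$ is the oscillatory steady state. Put $$\psi_t(x)=\sum_{y}\big(r^*(x,y)\,g(t,y,x)-r(x,y)\,g(t,x,y)\big),\qquad \beta_r(s,x)=\sum_y\beta(s,x,y)\,r(x,y)$$ for functions $\beta(s,x,y)$. Then, for every $t\ge0$, the following derivatives at $\lambda=0$ exist, all expectations and integrals below are well defined (integrable), and: 1. For every $v:\mathcal X\to\mathbb R$, $$\partial_{\lambda=0}\mathbb E_{\pi_\lambda}[v(X^\lambda_t)]=\int_0^\infty\langle e^{s\mathcal L}v,\psi_{t-s}\rangle\,ds=\int_0^\infty\mathbb E_\pi[v(X_s)\psi_{t-s}(X_0)]\,ds .$$ 2. For every measurable $v:[0,t]\times\mathcal X\to\mathbb R$ with $\int_0^t|v(s,x)|\,ds<\infty$ for all $x$, $$\partial_{\lambda=0}\mathbb E_{\pi_\lambda}\Big[\int_0^tv(s,X^\lambda_s)\,ds\Big]=\int_0^tdu\int_0^\infty ds\,\langle e^{s\mathcal L}v(u,\cdot),\psi_{u-s}\rangle=\int_0^tdu\int_0^\infty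 ds\,\mathbb E_\pi[v(u,X_s)\psi_{u-s}(X_0)] .$$ 3. For every measurable $\alpha:[0,t]\times\mathcal X\times\mathcal X\to\mathbb R$ which is $\mathbb P_\pi$-integrable, i.e. satisfies $\mathbb E_\pi\big[\sum_{s\in(0,t]:X_{s-}\ne X_s}|\alpha(s,X_{s-},X_s)|\big]<\infty$ or $\mathbb E_\pi\big[\int_0^t|\alpha|_r(s,X_s)\,ds\big]<\infty$ (the two bounds are equivalent), $$\partial_{\lambda=0}\mathbb E_{\pi_\lambda}\Big[\sum_{s\in(0,t]:X^\lambda_{s-}\ne X^\lambda_s}\alpha(s,X^\lambda_{s-},X^\lambda_s)\Big]=\int_0^t\mathbb E_\pi[(\alpha g)_r(s,X_s)]\,ds+\int_0^tds\int_0^\infty du\,\mathbb E_\pi[\alpha_r(s,X_u)\,\psi_{s-u}(X_0)] .$$ -/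

import Mathlib

open MeasureTheory ProbabilityTheory Filter Topology
open scoped ENNReal

noncomputable section

namespace MarkovJump

/-! ### Time-inhomogeneous Markov jump processes on a finite set

Jump rates are functions `q : ℝ → 𝒳 → 𝒳 → ℝ`; `q s x y` is the rate at time `s` of the jump from `x`
to `y`, with `q s x x = 0`.  The process is built from its successive pairs (jump time, new state).
-/

section Construction

variable {𝒳 : Type*} [Fintype 𝒳]

/-- The total jump rate (holding time parameter) `r̂_s(x) = ∑_y q(s,x,y)`. -/
def exitRate (q : ℝ → 𝒳 → 𝒳 → ℝ) (s : ℝ) (x : 𝒳) : ℝ := ∑ y, q s x y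

/-- Probability `exp (-∫_s^u r̂_τ(x) dτ)` that a process which has arrived at `x` at time `s`
is still waiting there at time `u`. -/
def survival (q : ℝ → 𝒳 → 𝒳 → ℝ) (s u : ℝ) (x : 𝒳) : ℝ :=
  Real.exp (-∫ τ in s..u, exitRate q τ x)

/-- Joint density, with respect to Lebesgue measure times counting measure, of the time `u` and
the target `y` of the next jump of a process which has arrived at `x` at time `s`: the holding time
density `r̂_u(x) exp (-∫_s^u r̂_τ(x) dτ)` times the jump probability `q(u,x,y) / r̂_u(x)`. -/
def nextJumpDensity (q : ℝ → 𝒳 → 𝒳 → ℝ) (a b : ℝ × 𝒳) : ℝ≥0∞ :=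
  if a.1 < b.1 then ENNReal.ofReal (survival q a.1 b.1 a.2 * q b.1 a.2 b.2) else 0

theorem intervalIntegrable_exitRate {q : ℝ → 𝒳 → 𝒳 → ℝ} {C : ℝ}
    (hm : ∀ x y, Measurable fun s => q s x y)
    (hC : ∀ s x, |exitRate q s x| ≤ C) (x : 𝒳) (s u : ℝ) :
    IntervalIntegrable (fun τ => exitRate q τ x) volume s u := by
  have h1 : Measurable fun τ => exitRate q τ x := by
    unfold exitRate
    exact Finset.measurable_sum _ fun y _ => hm x y
  refine (intervalIntegrable_const (c := C)).mono_fun h1.aestronglyMeasurable ?_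
  filter_upwards with τ
  rw [Real.norm_eq_abs, Real.norm_eq_abs]
  exact (hC τ x).trans (le_abs_self C)

variable [MeasurableSpace 𝒳]

/-- Law of (time, target) of the next jump, given (time, target) of the previous one. -/
def nextJump (q : ℝ → 𝒳 → 𝒳 → ℝ) : Kernel (ℝ × 𝒳) (ℝ × 𝒳) :=
  (Kernel.const (ℝ × 𝒳) ((volume : Measure ℝ).prod (Measure.count : Measure 𝒳))).withDensity
    (nextJumpDensity q)

/-- For measurable rates whose total rates are bounded, the density of the next jump is
jointly measurable. -/
theorem measurable_nextJumpDensity [MeasurableSingletonClass 𝒳] {q : ℝ → 𝒳 → 𝒳 → ℝ} {C : ℝ}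
    (hm : ∀ x y, Measurable fun s => q s x y)
    (hC : ∀ s x, |exitRate q s x| ≤ C) :
    Measurable (Function.uncurry (nextJumpDensity q)) := by
  have hR : ∀ x, Continuous fun u => ∫ τ in (0 : ℝ)..u, exitRate q τ x := fun x =>
    intervalIntegral.continuous_primitive
      (fun a b => intervalIntegrable_exitRate hm hC x a b) 0
  have hq : Measurable fun p : 𝒳 × 𝒳 × ℝ => q p.2.2 p.1 p.2.1 :=
    measurable_from_prod_countable_right fun x =>
      measurable_from_prod_countable_right fun y => hm x y
  have hS : Measurable fun p : 𝒳 × ℝ => ∫ τ in (0 : ℝ)..p.2, exitRate q τ p.1 :=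
    measurable_from_prod_countable_right fun x => (hR x).measurable
  have hS' : Measurable fun p : (ℝ × 𝒳) × (ℝ × 𝒳) =>
      survival q p.1.1 p.2.1 p.1.2 := by
    unfold survival
    have : ∀ p : (ℝ × 𝒳) × (ℝ × 𝒳), (∫ τ in p.1.1..p.2.1, exitRate q τ p.1.2)
        = (∫ τ in (0 : ℝ)..p.2.1, exitRate q τ p.1.2)
          - ∫ τ in (0 : ℝ)..p.1.1, exitRate q τ p.1.2 := fun p =>
      (intervalIntegral.integral_interval_sub_left
        (intervalIntegrable_exitRate hm hC p.1.2 0 p.2.1)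
        (intervalIntegrable_exitRate hm hC p.1.2 0 p.1.1)).symm
    simp_rw [this]
    refine Real.measurable_exp.comp (Measurable.neg (Measurable.sub ?_ ?_))
    · exact hS.comp (f := fun p : (ℝ × 𝒳) × (ℝ × 𝒳) => (p.1.2, p.2.1)) (by fun_prop)
    · exact hS.comp (f := fun p : (ℝ × 𝒳) × (ℝ × 𝒳) => (p.1.2, p.1.1)) (by fun_prop)
  have hq' : Measurable fun p : (ℝ × 𝒳) × (ℝ × 𝒳) => q p.2.1 p.1.2 p.2.2 :=
    hq.comp (f := fun p : (ℝ × 𝒳) × (ℝ × 𝒳) => (p.1.2, p.2.2, p.2.1)) (by fun_prop)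
  refine Measurable.ite (measurableSet_lt (by fun_prop) (by fun_prop)) ?_ measurable_const
  exact (hS'.mul hq').ennreal_ofReal

/-- For nonnegative bounded measurable rates with total rate at `x` bounded away from zero, a next
jump from `x` takes place at a finite time almost surely. -/
theorem nextJump_univ [MeasurableSingletonClass 𝒳] {q : ℝ → 𝒳 → 𝒳 → ℝ} {c C : ℝ}
    (hc : 0 < c)
    (hm : ∀ x y, Measurable fun s => q s x y) (h0 : ∀ s x y, 0 ≤ q s x y)
    (hC : ∀ s x, |exitRate q s x| ≤ C) (x : 𝒳) (hx : ∀ s, c ≤ exitRate q s x) (s : ℝ) :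
    nextJump q (s, x) Set.univ = 1 := by
  have hmd := measurable_nextJumpDensity hm hC
  have hii := intervalIntegrable_exitRate hm hC x
  have he : Measurable fun τ => exitRate q τ x := by
    unfold exitRate
    exact Finset.measurable_sum _ fun y _ => hm x y
  have hC0 : 0 ≤ C := (abs_nonneg _).trans (hC 0 x)
  -- the survival function is Lipschitz to the right of `s`
  have hmono : ∀ a b, s ≤ a → a ≤ b →
      |survival q s b x - survival q s a x| ≤ C * (b - a) := by
    intro a b hsa hab
    have h1 : (∫ τ in s..b, exitRate q τ x)
        = (∫ τ in s..a, exitRate q τ x) + ∫ τ in a..b, exitRate q τ x :=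
      (intervalIntegral.integral_add_adjacent_intervals (hii s a) (hii a b)).symm
    have h2 : 0 ≤ ∫ τ in a..b, exitRate q τ x :=
      intervalIntegral.integral_nonneg hab fun u _ => hc.le.trans (hx u)
    have h3 : 0 ≤ ∫ τ in s..a, exitRate q τ x :=
      intervalIntegral.integral_nonneg hsa fun u _ => hc.le.trans (hx u)
    have h4 : (∫ τ in a..b, exitRate q τ x) ≤ C * (b - a) := by
      have := intervalIntegral.norm_integral_le_of_norm_le_const (a := a) (b := b)
        (f := fun τ => exitRate q τ x) (C := C) fun τ _ => hC τ x
      rw [abs_of_nonneg (sub_nonneg.2 hab)] at this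
      exact (le_abs_self _).trans this
    unfold survival
    rw [h1, neg_add, Real.exp_add]
    have h5 : Real.exp (-∫ τ in s..a, exitRate q τ x) ≤ 1 := Real.exp_le_one_iff.2 (by linarith)
    have h6 := Real.exp_pos (-∫ τ in s..a, exitRate q τ x)
    have h7 : Real.exp (-∫ τ in a..b, exitRate q τ x) ≤ 1 := Real.exp_le_one_iff.2 (by linarith)
    have h8 := Real.add_one_le_exp (-∫ τ in a..b, exitRate q τ x)
    rw [abs_le]
    constructor <;> nlinarith
  have hlip : ∀ b, s ≤ b →
      AbsolutelyContinuousOnInterval (fun u => survival q s u x) s b := by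
    intro b hb
    refine LipschitzOnWith.absolutelyContinuousOnInterval (K := C.toNNReal) ?_
    refine LipschitzOnWith.of_dist_le_mul ?_
    intro u hu v hv
    rw [Set.uIcc_of_le hb] at hu hv
    rw [Real.dist_eq, Real.dist_eq, Real.coe_toNNReal _ hC0]
    rcases le_total u v with h | h
    · have := hmono u v hu.1 h
      rwa [abs_sub_comm, abs_sub_comm u v, abs_of_nonneg (sub_nonneg.2 h)]
    · have := hmono v u hv.1 h
      rwa [abs_of_nonneg (sub_nonneg.2 h)]
  have hS0 : survival q s s x = 1 := by simp [survival]
  have hint : ∀ b, s ≤ b →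
      ∫ u in s..b, survival q s u x * exitRate q u x = 1 - survival q s b x := by
    intro b hb
    have h1 := (hlip b hb).integral_deriv_eq_sub
    rw [hS0] at h1
    have h2 : ∫ u in s..b, survival q s u x * exitRate q u x
        = ∫ u in s..b, -deriv (fun u => survival q s u x) u := by
      refine intervalIntegral.integral_congr_ae ?_
      filter_upwards [(hii s b).ae_hasDerivAt_integral] with u hu hub
      have h3 := hu (Set.uIoc_subset_uIcc hub) s (by simp)
      have h4 : HasDerivAt (fun u => survival q s u x)
          (Real.exp (-∫ τ in s..u, exitRate q τ x) * -exitRate q u x) u := h3.neg.exp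
      rw [h4.deriv]
      unfold survival
      ring
    rw [h2, intervalIntegral.integral_neg, h1]
    ring
  have hlim : Tendsto (fun b => survival q s b x) atTop (𝓝 0) := by
    refine Real.tendsto_exp_neg_atTop_nhds_zero.comp ?_
    refine tendsto_atTop_mono' atTop (f₁ := fun b => c * (b - s)) ?_ ?_
    · filter_upwards [eventually_ge_atTop s] with b hb
      have := intervalIntegral.integral_mono_on hb (intervalIntegrable_const (c := c)) (hii s b)
        fun u _ => hx u
      simp only [intervalIntegral.integral_const, smul_eq_mul] at this
      linarith
    · exact (tendsto_atTop_add_const_right _ (-s) tendsto_id).const_mul_atTop hc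
  have hSm : Measurable fun u => survival q s u x := by
    unfold survival
    exact Real.measurable_exp.comp
      (intervalIntegral.continuous_primitive hii s).measurable.neg
  have hnn : ∀ u, 0 ≤ survival q s u x * exitRate q u x := fun u =>
    mul_nonneg (Real.exp_pos _).le (hc.le.trans (hx u))
  have hlim' : Tendsto (fun b => ∫ u in s..b, ‖survival q s u x * exitRate q u x‖) atTop
      (𝓝 1) := by
    have : Tendsto (fun b => 1 - survival q s b x) atTop (𝓝 1) := by
      simpa using hlim.const_sub 1
    refine this.congr' ?_
    filter_upwards [eventually_ge_atTop s] with b hb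
    rw [← hint b hb]
    simp_rw [Real.norm_of_nonneg (hnn _)]
  have hIoi : IntegrableOn (fun u => survival q s u x * exitRate q u x) (Set.Ioi s) := by
    refine integrableOn_Ioi_of_intervalIntegral_norm_tendsto 1 s (fun b => ?_) tendsto_id hlim'
    have hb : IntervalIntegrable (fun u => survival q s u x * exitRate q u x) volume s b :=
      (hii s b).continuousOn_mul (Real.continuous_exp.comp
        (intervalIntegral.continuous_primitive hii s).neg).continuousOn
    exact hb.1
  have hval : ∫ u in Set.Ioi s, survival q s u x * exitRate q u x = 1 := by
    refine tendsto_nhds_unique (intervalIntegral_tendsto_integral_Ioi s hIoi tendsto_id) ?_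
    simpa [Real.norm_of_nonneg (hnn _)] using hlim'
  unfold nextJump
  rw [Kernel.withDensity_apply' _ hmd, Kernel.const_apply, Measure.restrict_univ,
    lintegral_prod (nextJumpDensity q (s, x)) (hmd.comp measurable_prodMk_left).aemeasurable]
  have h9 : ∀ u, ∫⁻ y, nextJumpDensity q (s, x) (u, y) ∂Measure.count
      = (Set.Ioi s).indicator
        (fun u => ENNReal.ofReal (survival q s u x * exitRate q u x)) u := by
    intro u
    rw [lintegral_count, tsum_fintype]
    by_cases h : s < u
    · simp only [nextJumpDensity, h, if_true, Set.mem_Ioi, Set.indicator_of_mem]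
      rw [← ENNReal.ofReal_sum_of_nonneg fun y _ => 
          mul_nonneg (show 0 ≤ survival q s u x from (Real.exp_pos _).le) (h0 u x y),
        exitRate, Finset.mul_sum]
    · simp [nextJumpDensity, h]
  simp_rw [h9]
  rw [lintegral_indicator measurableSet_Ioi,
    ← ofReal_integral_eq_lintegral_ofReal hIoi (Eventually.of_forall hnn), hval,
    ENNReal.ofReal_one]

/-- The points from which a next jump takes place almost surely in finite time. -/
def properPoints (q : ℝ → 𝒳 → 𝒳 → ℝ) : Set (ℝ × 𝒳) := {a | nextJump q a Set.univ = 1}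

theorem measurableSet_properPoints (q : ℝ → 𝒳 → 𝒳 → ℝ) : MeasurableSet (properPoints q) :=
  (nextJump q).measurable_coe MeasurableSet.univ (measurableSet_singleton 1)

open Classical in
/-- The transition kernel of the sequence of pairs (jump time, new state).  It is `nextJump q`,
except that a process in an absorbing state stays there forever, which is encoded by fictitious
jumps from that state to itself, one per unit of time. -/
def jumpStep (q : ℝ → 𝒳 → 𝒳 → ℝ) : Kernel (ℝ × 𝒳) (ℝ × 𝒳) :=
  Kernel.piecewise (measurableSet_properPoints q) (nextJump q)
    (Kernel.deterministic (fun a : ℝ × 𝒳 => (a.1 + 1, a.2)) (by fun_prop))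

instance (q : ℝ → 𝒳 → 𝒳 → ℝ) : IsMarkovKernel (jumpStep q) := by
  classical
  refine ⟨fun a => ⟨?_⟩⟩
  rw [jumpStep, Kernel.piecewise_apply']
  split_ifs with h
  · exact h
  · simp

/-- The law of the sequence `(0, x₀), (τ₁, x₁), (τ₂, x₂), …` of pairs (jump time, new state) of the
Markov jump process with jump rates `q` and initial distribution `ν`. -/
def jumpLaw (q : ℝ → 𝒳 → 𝒳 → ℝ) (ν : Measure 𝒳) : Measure (ℕ → ℝ × 𝒳) :=
  Kernel.trajMeasure (X := fun _ => ℝ × 𝒳) (ν.map fun x => ((0 : ℝ), x))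
    fun n => (jumpStep q).comap (fun h => h ⟨n, Finset.mem_Iic.2 le_rfl⟩) (by fun_prop)

/-- The path `t ↦ X_t` of the process: `X_t = x_n` for `τ_n ≤ t < τ_{n+1}`. (After a possible
explosion, an event of probability zero for bounded rates, the value is irrelevant.) -/
def path (ω : ℕ → ℝ × 𝒳) (t : ℝ) : 𝒳 := (ω (sInf {n : ℕ | t < (ω (n + 1)).1})).2

/-- The expectation `𝔼_ν[F(X)]` of a functional of the path of the Markov jump process with jump
rates `q` and initial distribution `ν`. -/
def expect (q : ℝ → 𝒳 → 𝒳 → ℝ) (ν : Measure 𝒳) (F : (ℝ → 𝒳) → ℝ) : ℝ :=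
  ∫ ω, F (path ω) ∂jumpLaw q ν

/-- The functional `F` of the path has finite expectation under the law of the Markov jump process
with jump rates `q` and initial distribution `ν`. -/
def HasExpect (q : ℝ → 𝒳 → 𝒳 → ℝ) (ν : Measure 𝒳) (F : (ℝ → 𝒳) → ℝ) : Prop :=
  Integrable (fun ω => F (path ω)) (jumpLaw q ν)

/-- The transition probability `P_t(x,y) = ℙ_x(X_t = y)`, the process starting at time `0`. -/
def transProb (q : ℝ → 𝒳 → 𝒳 → ℝ) (t : ℝ) (x y : 𝒳) : ℝ :=
  (jumpLaw q (Measure.dirac x)).real {ω | path ω t = y}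

/-- `μ` is a probability measure which is invariant for the transition matrix `P`. -/
def IsInvariantProb (P : 𝒳 → 𝒳 → ℝ) (μ : Measure 𝒳) : Prop :=
  IsProbabilityMeasure μ ∧ ∀ y, ∑ x, μ.real {x} * P x y = μ.real {y}

/-- `π` is an invariant distribution of the Markov jump process with time-independent
rates `r`. -/
def IsInvariantDistribution (r : 𝒳 → 𝒳 → ℝ) (π : Measure 𝒳) : Prop :=
  ∀ t : ℝ, 0 ≤ t → IsInvariantProb (transProb (fun _ => r) t) π

/-- The perturbed jump rates `r^λ(s,x,y) = e^{λ g(s,x,y)} r(x,y)`. -/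
def perturbedRate (r : 𝒳 → 𝒳 → ℝ) (g : ℝ → 𝒳 → 𝒳 → ℝ) (lam : ℝ) : ℝ → 𝒳 → 𝒳 → ℝ :=
  fun s x y => Real.exp (lam * g s x y) * r x y

/-- `μ` is the initial distribution of an oscillatory steady state of the `λ`-perturbed process: an
invariant distribution of the discrete-time Markov chain `(X^λ_{nT})_{n ≥ 0}`, whose transition
matrix is `ℙ_x(X^λ_T = y)`. -/
def IsOSS (r : 𝒳 → 𝒳 → ℝ) (g : ℝ → 𝒳 → 𝒳 → ℝ) (T lam : ℝ) (μ : Measure 𝒳) : Prop :=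
  IsInvariantProb (transProb (perturbedRate r g lam) T) μ

end Construction

/-! ### Jumps of a path -/

section Jumps

variable {𝒳 : Type*}

/-- The pairs `(s, a)` such that `0 < s ≤ t`, the path `ξ` has left limit `ξ_{s-} = a` at time `s`
(in the discrete topology), and `ξ_{s-} ≠ ξ_s`. -/
def jumps (ξ : ℝ → 𝒳) (t : ℝ) : Set (ℝ × 𝒳) :=
  {p | 0 < p.1 ∧ p.1 ≤ t ∧ (∀ᶠ u in 𝓝[<] p.1, ξ u = p.2) ∧ p.2 ≠ ξ p.1}

/-- The additive functional `∑_{s ∈ (0,t] : ξ_{s-} ≠ ξ_s} α(s, ξ_{s-}, ξ_s)`. -/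
def jumpSum (α : ℝ → 𝒳 → 𝒳 → ℝ) (t : ℝ) (ξ : ℝ → 𝒳) : ℝ :=
  ∑' p : jumps ξ t, α p.1.1 p.1.2 (ξ p.1.1)

/-- The sum `∑_{s ∈ (0,t] : ξ_{s-} ≠ ξ_s} |α(s, ξ_{s-}, ξ_s)|`, with values in `[0,∞]`. -/
def jumpSumAbs (α : ℝ → 𝒳 → 𝒳 → ℝ) (t : ℝ) (ξ : ℝ → 𝒳) : ℝ≥0∞ :=
  ∑' p : jumps ξ t, ENNReal.ofReal |α p.1.1 p.1.2 (ξ p.1.1)|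

end Jumps

/-! ### Objects attached to the unperturbed process -/

section Unperturbed

variable {𝒳 : Type*} [Fintype 𝒳]

/-- The contraction `α_r(s,x) = ∑_y α(s,x,y) r(x,y)`. -/
def contract (r : 𝒳 → 𝒳 → ℝ) (α : ℝ → 𝒳 → 𝒳 → ℝ) (s : ℝ) (x : 𝒳) : ℝ :=
  ∑ y, α s x y * r x y

/-- The Markov generator `𝓛 f(x) = ∑_y r(x,y) (f(y) - f(x))` of the unperturbed process. -/
def generator (r : 𝒳 → 𝒳 → ℝ) : (𝒳 → ℝ) →L[ℝ] (𝒳 → ℝ) :=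
  LinearMap.toContinuousLinearMap
    { toFun := fun f x => ∑ y, r x y * (f y - f x)
      map_add' := fun f h => by
        ext x
        simp only [Pi.add_apply, ← Finset.sum_add_distrib]
        exact Finset.sum_congr rfl fun y _ => by ring
      map_smul' := fun c f => by
        ext x
        simp only [Pi.smul_apply, smul_eq_mul, RingHom.id_apply, Finset.mul_sum]
        exact Finset.sum_congr rfl fun y _ => by ring }

/-- The semigroup `e^{s𝓛}`. -/
def semigroup (r : 𝒳 → 𝒳 → ℝ) (s : ℝ) : (𝒳 → ℝ) →L[ℝ] (𝒳 → ℝ) :=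
  NormedSpace.exp (s • generator r)

variable [MeasurableSpace 𝒳]

/-- The scalar product `⟨f,h⟩ = ∑_x π(x) f(x) h(x)` of `L²(π)`, on real functions. -/
def scalarProd (π : Measure 𝒳) (f h : 𝒳 → ℝ) : ℝ := ∑ x, π.real {x} * (f x * h x)

/-- The rates `r*(x,y) = π(y) r(y,x) / π(x)` of the stationary time-reversed process. -/
def reversedRate (r : 𝒳 → 𝒳 → ℝ) (π : Measure 𝒳) (x y : 𝒳) : ℝ :=
  π.real {y} * r y x / π.real {x}

/-- The function `ψ_t(x) = ∑_y (r*(x,y) g(t,y,x) - r(x,y) g(t,x,y))`. -/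
def psi (r : 𝒳 → 𝒳 → ℝ) (π : Measure 𝒳) (g : ℝ → 𝒳 → 𝒳 → ℝ) (t : ℝ) (x : 𝒳) : ℝ :=
  ∑ y, (reversedRate r π x y * g t y x - r x y * g t x y)

/-- `α` is `ℙ_π`-integrable on `[0,t]`: one of the two equivalent bounds
`𝔼_π[∑_{s ∈ (0,t]} |α(s, X_{s-}, X_s)|] < ∞` and `𝔼_π[∫_0^t |α|_r(s, X_s) ds] < ∞` holds. -/
def IsPathIntegrable (r : 𝒳 → 𝒳 → ℝ) (π : Measure 𝒳) (t : ℝ) (α : ℝ → 𝒳 → 𝒳 → ℝ) : Prop :=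
  (∫⁻ ω, jumpSumAbs α t (path ω) ∂jumpLaw (fun _ => r) π) < ∞ ∨
  (∫⁻ ω, (∫⁻ s in Set.Ioc (0 : ℝ) t,
    ENNReal.ofReal (contract r (fun s x y => |α s x y|) s (path ω s))) ∂jumpLaw (fun _ => r) π) < ∞

end Unperturbed

end MarkovJump

end

open MarkovJump

/-!
Irreducibility makes all transition probabilities of the unperturbed process at positive times
positive, so a Doeblin contraction shows that the oscillation of `e^{s𝓛} f` decays exponentially.
The jumps of the perturbed process have compensator `p_s(x) r^λ(s,x,y) ds`, where `p_s` is the law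
of `X^λ_s`; hence `p` solves the forward equation. Started from `π_λ`, `p` is `T`-periodic, so
Duhamel's formula can be pushed into the infinite past, which gives the exact identity
`∑ p_t f - ∑ π f = ∫_0^∞ ∑ p_{t-s} (𝓛^λ_{t-s} - 𝓛) e^{s𝓛} f ds`.
In the integrand, replacing `p_{t-s}` by `π` and `e^{λg} - 1` by `λ g` costs `O(λ²)`, uniformly in
`t` and linearly in the size of `f`, and by the definition of `r^*` the pairing of `π` with the
generator of rates `g r` is `⟨·, ψ⟩`. Because the error is uniform in time, the response of time
integrals and of jump sums follows by integrating the response at a fixed time.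
-/

namespace MarkovJump

/-! ### Jump sequences and their paths -/

section JumpSequence

variable {𝒳 : Type*}

/-- A sequence of pairs (jump time, new state) which describes a path with locally finitely many
jumps: the times increase strictly from `0` to `∞`, and every jump changes the state. -/
structure IsJumpSequence (ω : ℕ → ℝ × 𝒳) : Prop where
  zero : (ω 0).1 = 0
  lt_succ : ∀ n, (ω n).1 < (ω (n + 1)).1
  ne_succ : ∀ n, (ω n).2 ≠ (ω (n + 1)).2
  tendsto : Tendsto (fun n => (ω n).1) atTop atTop

/-- The jump number `n` (counted from `0`) of a path, as a triple (time, old state, new state). -/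
def nthJump (ω : ℕ → ℝ × 𝒳) (n : ℕ) : ℝ × 𝒳 × 𝒳 := ((ω (n + 1)).1, (ω n).2, (ω (n + 1)).2)

namespace IsJumpSequence

variable {ω : ℕ → ℝ × 𝒳} (h : IsJumpSequence ω)
include h

theorem strictMono : StrictMono fun n => (ω n).1 := strictMono_nat_of_lt_succ h.lt_succ

theorem jumpTime_succ_pos (n : ℕ) : 0 < (ω (n + 1)).1 :=
  h.zero ▸ h.strictMono n.succ_pos

theorem iUnion_Ico : ⋃ n, Set.Ico (ω n).1 (ω (n + 1)).1 = Set.Ici 0 := by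
  rw [← h.zero]
  exact iUnion_Ico_map_succ_eq_Ici (fun n => h.strictMono.monotone n.zero_le)
    (not_bddAbove_of_tendsto_atTop h.tendsto)

theorem exists_mem_Ico {t : ℝ} (ht : 0 ≤ t) : ∃ n, t ∈ Set.Ico (ω n).1 (ω (n + 1)).1 :=
  Set.mem_iUnion.1 (h.iUnion_Ico ▸ Set.mem_Ici.2 ht)

theorem path_eq {n : ℕ} {t : ℝ} (ht : t ∈ Set.Ico (ω n).1 (ω (n + 1)).1) :
    path ω t = (ω n).2 := by
  suffices sInf {m : ℕ | t < (ω (m + 1)).1} = n by rw [path, this]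
  refine le_antisymm (Nat.sInf_le ht.2) (le_csInf ⟨n, ht.2⟩ fun m hm => ?_)
  exact Nat.lt_succ_iff.1 (h.strictMono.lt_iff_lt.1 (ht.1.trans_lt hm))

theorem path_zero : path ω 0 = (ω 0).2 :=
  h.path_eq ⟨h.zero.le, h.jumpTime_succ_pos 0⟩

theorem path_jumpTime (n : ℕ) : path ω (ω (n + 1)).1 = (ω (n + 1)).2 :=
  h.path_eq ⟨le_rfl, h.lt_succ (n + 1)⟩

theorem eventually_path_eq_left {n : ℕ} {t : ℝ} (ht : t ∈ Set.Ioc (ω n).1 (ω (n + 1)).1) :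
    ∀ᶠ u in 𝓝[<] t, path ω u = (ω n).2 := by
  filter_upwards [Ioo_mem_nhdsLT ht.1] with u hu
  exact h.path_eq ⟨hu.1.le, hu.2.trans_le ht.2⟩

theorem mem_jumps_iff {t : ℝ} {p : ℝ × 𝒳} :
    p ∈ jumps (path ω) t ↔ ∃ n, (ω (n + 1)).1 ≤ t ∧ ((ω (n + 1)).1, (ω n).2) = p := by
  constructor
  · rintro ⟨hpos, hpt, hleft, hne⟩
    obtain ⟨n, hn⟩ := h.exists_mem_Ico hpos.le
    rcases hn.1.eq_or_lt with heq | hlt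
    · obtain ⟨m, rfl⟩ : ∃ m, n = m + 1 :=
        Nat.exists_eq_succ_of_ne_zero fun h0 => hpos.ne (by rw [← heq, h0, h.zero])
      obtain ⟨u, hu, hu'⟩ :=
        ((h.eventually_path_eq_left ⟨h.lt_succ m, le_rfl⟩).and (heq ▸ hleft)).exists
      exact ⟨m, heq ▸ hpt, Prod.ext heq (hu.symm.trans hu')⟩
    · obtain ⟨u, hu, hu'⟩ := ((h.eventually_path_eq_left ⟨hlt, hn.2.le⟩).and hleft).exists
      exact absurd (hu'.symm.trans (hu.trans (h.path_eq hn).symm)) hne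
  · rintro ⟨n, hn, rfl⟩
    exact ⟨h.jumpTime_succ_pos n, hn, h.eventually_path_eq_left ⟨h.lt_succ n, le_rfl⟩,
      h.path_jumpTime n ▸ h.ne_succ n⟩

theorem tsum_jumps {M : Type*} [AddCommMonoid M] [TopologicalSpace M] (F : ℝ × 𝒳 × 𝒳 → M)
    (t : ℝ) :
    ∑' p : jumps (path ω) t, F (p.1.1, p.1.2, path ω p.1.1)
      = ∑' n, (Set.Ioc 0 t ×ˢ Set.univ).indicator F (nthJump ω n) := by
  let e : {n | nthJump ω n ∈ Set.Ioc 0 t ×ˢ Set.univ} ≃ jumps (path ω) t := Equiv.ofBijective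
    (fun n => ⟨((ω (n.1 + 1)).1, (ω n.1).2), h.mem_jumps_iff.2 ⟨n, n.2.1.2, rfl⟩⟩)
    ⟨fun m n hmn => Subtype.ext (Nat.succ_injective
        (h.strictMono.injective (congrArg (fun p => p.1.1) hmn))),
      fun p => by
        obtain ⟨n, hn, hp⟩ := h.mem_jumps_iff.1 p.2
        exact ⟨⟨n, ⟨h.jumpTime_succ_pos n, hn⟩, trivial⟩, Subtype.ext hp⟩⟩
  calc ∑' p : jumps (path ω) t, F (p.1.1, p.1.2, path ω p.1.1)
      = ∑' n : {n | nthJump ω n ∈ Set.Ioc 0 t ×ˢ Set.univ}, F (nthJump ω n) := by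
        rw [← e.tsum_eq]
        refine tsum_congr fun n => ?_
        rw [nthJump, ← h.path_jumpTime n]
        rfl
    _ = _ := tsum_subtype _ fun n => F (nthJump ω n)

end IsJumpSequence

theorem jumps_eq_empty [Subsingleton 𝒳] (ξ : ℝ → 𝒳) (t : ℝ) : jumps ξ t = ∅ :=
  Set.eq_empty_of_forall_notMem fun _ hp => hp.2.2.2 (Subsingleton.elim _ _)

variable [MeasurableSpace 𝒳]

theorem measurable_path : Measurable fun p : (ℕ → ℝ × 𝒳) × ℝ => path p.1 p.2 := by
  classical
  let S : (ℕ → ℝ × 𝒳) × ℝ → Set ℕ := fun p => {n | p.2 < (p.1 (n + 1)).1}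
  have hS : ∀ n : ℕ, MeasurableSet {p : (ℕ → ℝ × 𝒳) × ℝ | p.2 < (p.1 (n + 1)).1} := fun n =>
    measurableSet_lt (by fun_prop) (by fun_prop)
  -- `sInf ∅ = 0`, so the infimum is the first `n` which is a member or witnesses emptiness.
  have hex : ∀ p, ∃ n, n ∈ S p ∨ ∀ m, m ∉ S p := fun p => by
    by_cases hp : ∃ n, n ∈ S p
    exacts [⟨hp.choose, Or.inl hp.choose_spec⟩, ⟨0, Or.inr (not_exists.1 hp)⟩]
  have hfind : ∀ p, sInf (S p) = Nat.find (hex p) := fun p => by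
    by_cases hp : ∃ n, n ∈ S p
    · rw [Nat.sInf_def hp]
      exact Nat.find_congr' fun {n} => (or_iff_left (not_forall_not.2 hp)).symm
    · exact (Nat.sInf_eq_zero.2 (Or.inr (Set.not_nonempty_iff_eq_empty.1 hp))).trans
        ((Nat.find_eq_zero _).2 (Or.inr (not_exists.1 hp))).symm
  have hindex : Measurable fun p => sInf (S p) := by
    simp only [hfind]
    refine measurable_find _ fun n => (hS n).union ?_
    exact measurableSet_setOfPred.2
      (Measurable.forall fun m => (measurableSet_setOfPred.1 (hS m)).not)
  have heval : Measurable fun z : ((ℕ → ℝ × 𝒳) × ℝ) × ℕ => (z.1.1 z.2).2 :=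
    measurable_from_prod_countable_left fun n => by dsimp only; fun_prop
  exact heval.comp (measurable_id.prodMk hindex)

theorem measurable_path_apply (t : ℝ) : Measurable fun ω : ℕ → ℝ × 𝒳 => path ω t :=
  measurable_path.comp measurable_prodMk_right

end JumpSequence

/-! ### The law of the jump sequence -/

section Rates

variable {𝒳 : Type*} [Fintype 𝒳]

/-- Measurable nonnegative jump rates whose total rates are bounded by `C`. -/
structure IsBoundedRate (q : ℝ → 𝒳 → 𝒳 → ℝ) (C : ℝ) : Prop where
  measurable : ∀ x y, Measurable fun s => q s x y
  nonneg : ∀ s x y, 0 ≤ q s x y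
  exitRate_le : ∀ s x, exitRate q s x ≤ C

/-- Bounded jump rates without jumps from a state to itself and without states in which the process
could stay forever: unless there is only one state, the total rates are bounded away from zero. -/
structure IsAdmissible (q : ℝ → 𝒳 → 𝒳 → ℝ) (C : ℝ) : Prop extends IsBoundedRate q C where
  diag : ∀ s x, q s x x = 0
  exists_le_exitRate : Nontrivial 𝒳 → ∃ c, 0 < c ∧ ∀ s x, c ≤ exitRate q s x

/-- The density in time of the compensator of the jumps, weighted with `F`: the weighted rate of
the jumps from `x` at time `u`. -/
noncomputable def jumpIntensity (q : ℝ → 𝒳 → 𝒳 → ℝ) (F : ℝ × 𝒳 × 𝒳 → ℝ≥0∞) (u : ℝ) (x : 𝒳) :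
    ℝ≥0∞ :=
  ∑ y, ENNReal.ofReal (q u x y) * F (u, x, y)

theorem generator_apply (r : 𝒳 → 𝒳 → ℝ) (f : 𝒳 → ℝ) (x : 𝒳) :
    generator r f x = ∑ y, r x y * (f y - f x) := rfl

theorem sum_nextJumpDensity_mul (q : ℝ → 𝒳 → 𝒳 → ℝ) (F : ℝ × 𝒳 × 𝒳 → ℝ≥0∞)
    (a : ℝ × 𝒳) (u : ℝ) :
    ∑ y, nextJumpDensity q a (u, y) * F (u, a.2, y)
      = (Set.Ioi a.1).indicator
        (fun u => ENNReal.ofReal (survival q a.1 u a.2) * jumpIntensity q F u a.2) u := by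
  by_cases hu : a.1 < u
  · have hS : 0 ≤ survival q a.1 u a.2 := (Real.exp_pos _).le
    simp only [nextJumpDensity, hu, if_true, Set.mem_Ioi, Set.indicator_of_mem, jumpIntensity,
      Finset.mul_sum, ENNReal.ofReal_mul hS, mul_assoc]
  · simp [nextJumpDensity, hu]

namespace IsBoundedRate

variable {q : ℝ → 𝒳 → 𝒳 → ℝ} {C : ℝ} (hq : IsBoundedRate q C)
include hq

theorem exitRate_nonneg (s : ℝ) (x : 𝒳) : 0 ≤ exitRate q s x :=
  Finset.sum_nonneg fun y _ => hq.nonneg s x y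

theorem abs_exitRate_le (s : ℝ) (x : 𝒳) : |exitRate q s x| ≤ C :=
  (abs_of_nonneg (hq.exitRate_nonneg s x)).trans_le (hq.exitRate_le s x)

theorem le_bound (s : ℝ) (x y : 𝒳) : q s x y ≤ C :=
  (Finset.single_le_sum (fun y _ => hq.nonneg s x y) (Finset.mem_univ y)).trans
    (hq.exitRate_le s x)

theorem survival_mul_survival (s t u : ℝ) (x : 𝒳) :
    survival q s t x * survival q t u x = survival q s u x := by
  have hI := intervalIntegrable_exitRate hq.measurable hq.abs_exitRate_le x
  rw [survival, survival, survival, ← Real.exp_add, ← neg_add,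
    intervalIntegral.integral_add_adjacent_intervals (hI s t) (hI t u)]

theorem integrableOn_const_mul (c : ℝ) (x y : 𝒳) (t : ℝ) :
    IntegrableOn (fun s => c * q s x y) (Set.Ioc 0 t) := by
  refine (Integrable.of_bound (C := C) (hq.measurable x y).aestronglyMeasurable ?_).const_mul c
  filter_upwards with s
  rw [Real.norm_of_nonneg (hq.nonneg s x y)]
  exact hq.le_bound s x y

theorem jumpIntensity_indicator_le (s : Set ℝ) (u : ℝ) (x : 𝒳) :
    jumpIntensity q ((s ×ˢ Set.univ).indicator 1) u x
      ≤ s.indicator (fun _ => ENNReal.ofReal C) u := by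
  by_cases hu : u ∈ s
  · simp only [jumpIntensity, Set.indicator, Set.mem_prod, hu, Set.mem_univ, and_true, if_true,
      Pi.one_apply, mul_one, ← ENNReal.ofReal_sum_of_nonneg fun y _ => hq.nonneg u x y]
    exact ENNReal.ofReal_le_ofReal (hq.exitRate_le u x)
  · simp [jumpIntensity, hu]

end IsBoundedRate

theorem IsAdmissible.eq_zero [Subsingleton 𝒳] {q : ℝ → 𝒳 → 𝒳 → ℝ} {C : ℝ}
    (hq : IsAdmissible q C) (s : ℝ) (x y : 𝒳) : q s x y = 0 := by
  rw [Subsingleton.elim y x, hq.diag]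

end Rates

section Law

variable {𝒳 : Type*} [Fintype 𝒳] [MeasurableSpace 𝒳]

instance isProbabilityMeasure_jumpLaw (q : ℝ → 𝒳 → 𝒳 → ℝ) (ν : Measure 𝒳)
    [IsProbabilityMeasure ν] : IsProbabilityMeasure (jumpLaw q ν) := by
  have : IsProbabilityMeasure (ν.map fun x => ((0 : ℝ), x)) :=
    Measure.isProbabilityMeasure_map (by fun_prop)
  unfold jumpLaw
  infer_instance

theorem map_zero_jumpLaw (q : ℝ → 𝒳 → 𝒳 → ℝ) (ν : Measure 𝒳) [IsProbabilityMeasure ν] :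
    (jumpLaw q ν).map (fun ω => ω 0) = ν.map fun x => (0, x) := by
  have : IsProbabilityMeasure (ν.map fun x => ((0 : ℝ), x)) :=
    Measure.isProbabilityMeasure_map (by fun_prop)
  have h : (jumpLaw q ν).map (Preorder.frestrictLe (π := fun _ => ℝ × 𝒳) 0)
      = (ν.map fun x => ((0 : ℝ), x)).map
        (MeasurableEquiv.piUnique fun _ : Finset.Iic 0 => ℝ × 𝒳).symm := by
    unfold jumpLaw Kernel.trajMeasure
    rw [Measure.map_comp _ _ (by fun_prop), Kernel.traj_map_frestrictLe,
      Kernel.partialTraj_self, Measure.id_comp]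
  have h' := congrArg (fun μ => μ.map fun h => h ⟨0, Finset.mem_Iic.2 le_rfl⟩) h
  rw [Measure.map_map (by fun_prop) (by fun_prop), Measure.map_map (by fun_prop) (by fun_prop),
    Measure.map_map (by fun_prop) (by fun_prop)] at h'
  exact h'

theorem lintegral_jumpLaw_succ (q : ℝ → 𝒳 → 𝒳 → ℝ) (ν : Measure 𝒳) [IsProbabilityMeasure ν]
    (n : ℕ) {F : ℝ × 𝒳 → ℝ × 𝒳 → ℝ≥0∞} (hF : Measurable (Function.uncurry F)) :
    ∫⁻ ω, F (ω n) (ω (n + 1)) ∂jumpLaw q ν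
      = ∫⁻ ω, ∫⁻ b, F (ω n) b ∂jumpStep q (ω n) ∂jumpLaw q ν := by
  have : IsProbabilityMeasure (ν.map fun x => ((0 : ℝ), x)) :=
    Measure.isProbabilityMeasure_map (by fun_prop)
  have h := Kernel.map_frestrictLe_trajMeasure_compProd_eq_map_trajMeasure
    (X := fun _ => ℝ × 𝒳) (μ₀ := ν.map fun x => ((0 : ℝ), x))
    (κ := fun n => (jumpStep q).comap (fun h => h ⟨n, Finset.mem_Iic.2 le_rfl⟩) (by fun_prop))
    (a := n)
  let G : ((i : Finset.Iic n) → ℝ × 𝒳) × (ℝ × 𝒳) → ℝ≥0∞ :=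
    fun p => F (p.1 ⟨n, Finset.mem_Iic.2 le_rfl⟩) p.2
  have hproj : Measurable fun p : ((i : Finset.Iic n) → ℝ × 𝒳) × (ℝ × 𝒳) =>
      (p.1 ⟨n, Finset.mem_Iic.2 le_rfl⟩, p.2) :=
    ((measurable_pi_apply _).comp measurable_fst).prodMk measurable_snd
  have hG : Measurable G := hF.comp hproj
  have h' := congrArg (fun μ => ∫⁻ p, G p ∂μ) h
  rw [Measure.lintegral_compProd hG, lintegral_map hG (by fun_prop),
    lintegral_map (hG.lintegral_kernel_prod_right') (by fun_prop)] at h'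
  exact h'.symm

variable [MeasurableSingletonClass 𝒳]

theorem jumpLaw_eq_sum (q : ℝ → 𝒳 → 𝒳 → ℝ) (ν : Measure 𝒳) :
    jumpLaw q ν = ∑ x, ν {x} • jumpLaw q (Measure.dirac x) := by
  let κ : (n : ℕ) → Kernel ((i : Finset.Iic n) → ℝ × 𝒳) (ℝ × 𝒳) :=
    fun n => (jumpStep q).comap (fun h => h ⟨n, Finset.mem_Iic.2 le_rfl⟩) (by fun_prop)
  have hmix : ∀ (μ : Measure 𝒳) (s : Set (ℕ → ℝ × 𝒳)), MeasurableSet s →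
      jumpLaw q μ s = ∫⁻ x, Kernel.traj (X := fun _ => ℝ × 𝒳) κ 0
        ((MeasurableEquiv.piUnique fun _ : Finset.Iic 0 => ℝ × 𝒳).symm (0, x)) s ∂μ := by
    intro μ s hs
    have hm : Measurable fun h => Kernel.traj (X := fun _ => ℝ × 𝒳) κ 0 h s :=
      Kernel.measurable_coe _ hs
    unfold jumpLaw Kernel.trajMeasure
    rw [Measure.bind_apply hs (Kernel.aemeasurable _), lintegral_map hm (by fun_prop)]
    exact lintegral_map (hm.comp (MeasurableEquiv.measurable _)) (by fun_prop)
  ext s hs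
  rw [hmix ν s hs, lintegral_fintype, Measure.finsetSum_apply]
  refine Finset.sum_congr rfl fun x _ => ?_
  rw [Measure.smul_apply, hmix _ s hs, lintegral_dirac, smul_eq_mul, mul_comm]

theorem lintegral_nextJump {q : ℝ → 𝒳 → 𝒳 → ℝ}
    (hmd : Measurable (Function.uncurry (nextJumpDensity q))) (a : ℝ × 𝒳)
    {F : ℝ × 𝒳 → ℝ≥0∞} (hF : Measurable F) :
    ∫⁻ b, F b ∂nextJump q a = ∫⁻ u, ∑ y, nextJumpDensity q a (u, y) * F (u, y) := by
  have hm : Measurable (nextJumpDensity q a) := hmd.comp measurable_prodMk_left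
  unfold nextJump
  rw [Kernel.lintegral_withDensity _ hmd _ hF, Kernel.const_apply,
    lintegral_prod (fun b => nextJumpDensity q a b * F b) (hm.mul hF).aemeasurable]
  simp only [lintegral_count, tsum_fintype]

namespace IsBoundedRate

variable {q : ℝ → 𝒳 → 𝒳 → ℝ} {C : ℝ} (hq : IsBoundedRate q C)
include hq

theorem measurable_density : Measurable (Function.uncurry (nextJumpDensity q)) :=
  measurable_nextJumpDensity hq.measurable hq.abs_exitRate_le

theorem measurable_jumpIntensity {F : ℝ × 𝒳 × 𝒳 → ℝ≥0∞} (hF : Measurable F) :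
    Measurable (Function.uncurry (jumpIntensity q F)) :=
  measurable_from_prod_countable_left fun x => Finset.measurable_sum _ fun y _ =>
    (hq.measurable x y).ennreal_ofReal.mul (hF.comp (by fun_prop))

theorem measurable_setLIntegral_jumpIntensity {F : ℝ × 𝒳 × 𝒳 → ℝ≥0∞} (hF : Measurable F) :
    Measurable (Function.uncurry fun a b : ℝ × 𝒳 =>
      ∫⁻ u in Set.Ico a.1 b.1, jumpIntensity q F u a.2) := by
  have hs : MeasurableSet ({p : ((ℝ × 𝒳) × (ℝ × 𝒳)) × ℝ | p.1.1.1 ≤ p.2}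
      ∩ {p | p.2 < p.1.2.1}) :=
    (measurableSet_le (by fun_prop) (by fun_prop)).inter
      (measurableSet_lt (by fun_prop) (by fun_prop))
  have hm := ((hq.measurable_jumpIntensity hF).comp
    (f := fun p : ((ℝ × 𝒳) × (ℝ × 𝒳)) × ℝ => (p.2, p.1.1.2)) (by fun_prop)).indicator hs
  convert Measurable.lintegral_prod_right' (ν := (volume : Measure ℝ)) hm using 1
  exact funext fun p => (lintegral_indicator measurableSet_Ico _).symm

theorem lintegral_nextJump_eq_setLIntegral_Ioi {F : ℝ × 𝒳 × 𝒳 → ℝ≥0∞} (hF : Measurable F)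
    (a : ℝ × 𝒳) :
    ∫⁻ b, F (b.1, a.2, b.2) ∂nextJump q a
      = ∫⁻ u in Set.Ioi a.1, ENNReal.ofReal (survival q a.1 u a.2) * jumpIntensity q F u a.2 := by
  rw [lintegral_nextJump hq.measurable_density a (F := fun b => F (b.1, a.2, b.2))
    (hF.comp (by fun_prop)), ← lintegral_indicator measurableSet_Ioi]
  exact lintegral_congr (sum_nextJumpDensity_mul q F a)

end IsBoundedRate

namespace IsAdmissible

variable {q : ℝ → 𝒳 → 𝒳 → ℝ} {C : ℝ} (hq : IsAdmissible q C) [Nontrivial 𝒳]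
include hq

theorem nextJump_univ (a : ℝ × 𝒳) : nextJump q a Set.univ = 1 := by
  obtain ⟨c, hc, h⟩ := hq.exists_le_exitRate inferInstance
  exact MarkovJump.nextJump_univ hc hq.measurable hq.nonneg hq.abs_exitRate_le a.2
    (fun s => h s a.2) a.1

theorem jumpStep_eq (a : ℝ × 𝒳) : jumpStep q a = nextJump q a := by
  classical
  rw [jumpStep, Kernel.piecewise_apply, if_pos]
  exact hq.nextJump_univ a

theorem nextJump_time_gt (a : ℝ × 𝒳) {u : ℝ} (hu : a.1 ≤ u) :
    nextJump q a {b | u < b.1} = ENNReal.ofReal (survival q a.1 u a.2) := by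
  have hs : MeasurableSet (Set.Ioi u ×ˢ Set.univ : Set (ℝ × 𝒳 × 𝒳)) :=
    measurableSet_Ioi.prod MeasurableSet.univ
  let g : ℝ → ℝ≥0∞ := fun w => jumpIntensity q 1 w a.2
  have hmass : ∫⁻ w in Set.Ioi u, ENNReal.ofReal (survival q u w a.2) * g w = 1 := by
    rw [← hq.lintegral_nextJump_eq_setLIntegral_Ioi measurable_one (u, a.2)]
    simpa using hq.nextJump_univ (u, a.2)
  calc nextJump q a {b | u < b.1}
      = ∫⁻ b, (Set.Ioi u ×ˢ Set.univ).indicator 1 (b.1, a.2, b.2) ∂nextJump q a := by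
        rw [← lintegral_indicator_one (measurableSet_lt (by fun_prop) (by fun_prop))]
        simp [Set.indicator]
    _ = ∫⁻ w in Set.Ioi a.1, (Set.Ioi u).indicator
          (fun w => ENNReal.ofReal (survival q a.1 w a.2) * g w) w := by
        rw [hq.lintegral_nextJump_eq_setLIntegral_Ioi (measurable_one.indicator hs) a]
        refine lintegral_congr fun w => ?_
        by_cases hw : u < w <;> simp [jumpIntensity, g, hw]
    _ = ∫⁻ w in Set.Ioi u, ENNReal.ofReal (survival q a.1 u a.2)
          * (ENNReal.ofReal (survival q u w a.2) * g w) := by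
        rw [setLIntegral_indicator measurableSet_Ioi,
          Set.inter_eq_left.2 (Set.Ioi_subset_Ioi hu)]
        refine lintegral_congr fun w => ?_
        rw [← hq.survival_mul_survival a.1 u w,
          ENNReal.ofReal_mul (show 0 ≤ survival q a.1 u a.2 from (Real.exp_pos _).le), mul_assoc]
    _ = ENNReal.ofReal (survival q a.1 u a.2) := by
        rw [lintegral_const_mul' _ _ ENNReal.ofReal_ne_top, hmass, mul_one]

theorem lintegral_nextJump_setLIntegral_Ico {g : ℝ → ℝ≥0∞} (hg : Measurable g) (a : ℝ × 𝒳) :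
    ∫⁻ b, (∫⁻ u in Set.Ico a.1 b.1, g u) ∂nextJump q a
      = ∫⁻ u in Set.Ioi a.1, ENNReal.ofReal (survival q a.1 u a.2) * g u := by
  have : IsFiniteMeasure (nextJump q a) := ⟨by rw [hq.nextJump_univ]; exact ENNReal.one_lt_top⟩
  have hm : Measurable fun p : (ℝ × 𝒳) × ℝ => {p | p.2 < p.1.1}.indicator (fun p => g p.2) p :=
    (hg.comp measurable_snd).indicator (measurableSet_lt (by fun_prop) (by fun_prop))
  calc ∫⁻ b, (∫⁻ u in Set.Ico a.1 b.1, g u) ∂nextJump q a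
      = ∫⁻ b, (∫⁻ u in Set.Ici a.1, {p | p.2 < p.1.1}.indicator (fun p => g p.2) (b, u))
          ∂nextJump q a := by
        refine lintegral_congr fun b => ?_
        rw [← Set.Iio_inter_Ici, ← setLIntegral_indicator measurableSet_Iio]
        rfl
    _ = ∫⁻ u in Set.Ici a.1, ∫⁻ b, {b | u < b.1}.indicator (fun _ => g u) b ∂nextJump q a :=
        lintegral_lintegral_swap hm.aemeasurable
    _ = ∫⁻ u in Set.Ici a.1, ENNReal.ofReal (survival q a.1 u a.2) * g u := by
        refine setLIntegral_congr_fun measurableSet_Ici fun u hu => ?_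
        simp only [lintegral_indicator_const (measurableSet_lt measurable_const measurable_fst),
          hq.nextJump_time_gt a hu, mul_comm]
    _ = ∫⁻ u in Set.Ioi a.1, ENNReal.ofReal (survival q a.1 u a.2) * g u :=
        setLIntegral_congr Ioi_ae_eq_Ici.symm

theorem lintegral_nthJump (ν : Measure 𝒳) [IsProbabilityMeasure ν] {F : ℝ × 𝒳 × 𝒳 → ℝ≥0∞}
    (hF : Measurable F) (n : ℕ) :
    ∫⁻ ω, F (nthJump ω n) ∂jumpLaw q ν
      = ∫⁻ ω, (∫⁻ u in Set.Ico (ω n).1 (ω (n + 1)).1, jumpIntensity q F u (ω n).2)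
          ∂jumpLaw q ν := by
  have hleft : Measurable (Function.uncurry fun a b : ℝ × 𝒳 => F (b.1, a.2, b.2)) :=
    hF.comp (by fun_prop)
  change ∫⁻ ω, (fun a b : ℝ × 𝒳 => F (b.1, a.2, b.2)) (ω n) (ω (n + 1)) ∂jumpLaw q ν = _
  rw [lintegral_jumpLaw_succ q ν n hleft,
    lintegral_jumpLaw_succ q ν n (hq.measurable_setLIntegral_jumpIntensity hF)]
  refine lintegral_congr fun ω => ?_
  have hg : Measurable fun u => jumpIntensity q F u (ω n).2 :=
    (hq.measurable_jumpIntensity hF).comp measurable_prodMk_right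
  rw [hq.jumpStep_eq, hq.lintegral_nextJump_eq_setLIntegral_Ioi hF,
    hq.lintegral_nextJump_setLIntegral_Ico hg]

end IsAdmissible

end Law

section JumpMeasure

variable {𝒳 : Type*} [MeasurableSpace 𝒳]

theorem measurable_nthJump : Measurable fun p : (ℕ → ℝ × 𝒳) × ℕ => nthJump p.1 p.2 := by
  refine measurable_from_prod_countable_left fun n => ?_
  change Measurable fun ω : ℕ → ℝ × 𝒳 => ((ω (n + 1)).1, (ω n).2, (ω (n + 1)).2)
  fun_prop

variable [Fintype 𝒳]

theorem ae_jumpLaw_zero (q : ℝ → 𝒳 → 𝒳 → ℝ) (ν : Measure 𝒳) [IsProbabilityMeasure ν] :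
    ∀ᵐ ω ∂jumpLaw q ν, (ω 0).1 = 0 := by
  have h : ∀ᵐ a ∂(jumpLaw q ν).map (fun ω => ω 0), a.1 = 0 := by
    rw [map_zero_jumpLaw, ae_map_iff (by fun_prop)
      (measurableSet_eq_fun measurable_fst measurable_const)]
    exact Eventually.of_forall fun _ => rfl
  exact ae_of_ae_map (measurable_pi_apply 0).aemeasurable h

/-- The intensity measure of the jumps: the expected number of the triples
(jump time, state before the jump, state after the jump) which lie in a given set. -/
noncomputable def jumpMeasure (q : ℝ → 𝒳 → 𝒳 → ℝ) (ν : Measure 𝒳) : Measure (ℝ × 𝒳 × 𝒳) :=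
  ((jumpLaw q ν).prod Measure.count).map fun p => nthJump p.1 p.2

theorem lintegral_jumpMeasure (q : ℝ → 𝒳 → 𝒳 → ℝ) (ν : Measure 𝒳)
    {F : ℝ × 𝒳 × 𝒳 → ℝ≥0∞} (hF : Measurable F) :
    ∫⁻ z, F z ∂jumpMeasure q ν = ∫⁻ ω, ∑' n, F (nthJump ω n) ∂jumpLaw q ν := by
  rw [jumpMeasure, lintegral_map hF measurable_nthJump,
    lintegral_prod (fun p : (ℕ → ℝ × 𝒳) × ℕ => F (nthJump p.1 p.2))
      (hF.comp measurable_nthJump).aemeasurable]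
  simp only [lintegral_count]

variable [MeasurableSingletonClass 𝒳]

namespace IsAdmissible

variable {q : ℝ → 𝒳 → 𝒳 → ℝ} {C : ℝ} (hq : IsAdmissible q C)
include hq

theorem ae_lt_ne_succ [Nontrivial 𝒳] (ν : Measure 𝒳) [IsProbabilityMeasure ν] :
    ∀ᵐ ω ∂jumpLaw q ν, ∀ n, (ω n).1 < (ω (n + 1)).1 ∧ (ω n).2 ≠ (ω (n + 1)).2 := by
  classical
  rw [ae_all_iff]
  intro n
  let F : ℝ × 𝒳 → ℝ × 𝒳 → ℝ≥0∞ := fun a b => if a.1 < b.1 ∧ a.2 ≠ b.2 then 0 else 1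
  have hF : Measurable (Function.uncurry F) := by
    have hlt : MeasurableSet {p : (ℝ × 𝒳) × (ℝ × 𝒳) | p.1.1 < p.2.1} :=
      measurableSet_lt (by fun_prop) (by fun_prop)
    have hne : MeasurableSet {p : (ℝ × 𝒳) × (ℝ × 𝒳) | p.1.2 ≠ p.2.2} :=
      (measurableSet_eq_fun (by fun_prop) (by fun_prop)).compl
    exact Measurable.ite (hlt.inter hne) measurable_const measurable_const
  have hstep : ∀ a, ∫⁻ b, F a b ∂jumpStep q a = 0 := by
    intro a
    rw [hq.jumpStep_eq, lintegral_nextJump (F := F a) hq.measurable_density a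
      (hF.comp measurable_prodMk_left)]
    refine (lintegral_congr fun u => Finset.sum_eq_zero fun y _ => ?_).trans lintegral_zero
    by_cases hau : a.1 < u
    · by_cases hay : a.2 = y
      · simp [nextJumpDensity, ← hay, hq.diag]
      · simp [F, hau, hay]
    · simp [nextJumpDensity, hau]
  have hzero : ∫⁻ ω, F (ω n) (ω (n + 1)) ∂jumpLaw q ν = 0 := by
    simp only [lintegral_jumpLaw_succ q ν n hF, hstep, lintegral_zero]
  have hm : Measurable fun ω : ℕ → ℝ × 𝒳 => F (ω n) (ω (n + 1)) :=
    hF.comp (f := fun ω : ℕ → ℝ × 𝒳 => (ω n, ω (n + 1))) (by fun_prop)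
  filter_upwards [(lintegral_eq_zero_iff hm).1 hzero] with ω hω
  by_contra hc
  simp [F, hc] at hω

theorem lintegral_jumpMeasure_eq_tsum [Nontrivial 𝒳] (ν : Measure 𝒳) [IsProbabilityMeasure ν]
    {F : ℝ × 𝒳 × 𝒳 → ℝ≥0∞} (hF : Measurable F) :
    ∫⁻ z, F z ∂jumpMeasure q ν = ∫⁻ ω, ∑' n, (∫⁻ u in Set.Ico (ω n).1 (ω (n + 1)).1,
      jumpIntensity q F u (ω n).2) ∂jumpLaw q ν := by
  have hm : ∀ n, Measurable fun ω : ℕ → ℝ × 𝒳 => F (nthJump ω n) := fun n =>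
    hF.comp (measurable_nthJump.comp measurable_prodMk_right)
  have hm' : ∀ n, Measurable fun ω : ℕ → ℝ × 𝒳 =>
      ∫⁻ u in Set.Ico (ω n).1 (ω (n + 1)).1, jumpIntensity q F u (ω n).2 := fun n =>
    (hq.toIsBoundedRate.measurable_setLIntegral_jumpIntensity hF).comp
      (f := fun ω : ℕ → ℝ × 𝒳 => (ω n, ω (n + 1))) (by fun_prop)
  rw [lintegral_jumpMeasure q ν hF, lintegral_tsum fun n => (hm n).aemeasurable,
    lintegral_tsum fun n => (hm' n).aemeasurable]
  exact tsum_congr fun n => hq.lintegral_nthJump ν hF n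

theorem jumpMeasure_Ioc_lt_top [Nontrivial 𝒳] (ν : Measure 𝒳) [IsProbabilityMeasure ν] (t : ℝ) :
    jumpMeasure q ν (Set.Ioc 0 t ×ˢ Set.univ) < ∞ := by
  have hs : MeasurableSet (Set.Ioc 0 t ×ˢ Set.univ : Set (ℝ × 𝒳 × 𝒳)) :=
    measurableSet_Ioc.prod MeasurableSet.univ
  rw [← lintegral_indicator_one hs,
    hq.lintegral_jumpMeasure_eq_tsum ν (measurable_one.indicator hs)]
  have hbound : ∀ᵐ ω ∂jumpLaw q ν, ∑' n, (∫⁻ u in Set.Ico (ω n).1 (ω (n + 1)).1,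
      jumpIntensity q ((Set.Ioc 0 t ×ˢ Set.univ).indicator 1) u (ω n).2)
        ≤ ENNReal.ofReal C * ENNReal.ofReal t := by
    filter_upwards [hq.ae_lt_ne_succ ν] with ω hω
    have hmono : Monotone fun n => (ω n).1 := monotone_nat_of_le_succ fun n => (hω n).1.le
    calc _ ≤ ∑' n, ∫⁻ u in Set.Ico (ω n).1 (ω (n + 1)).1,
          (Set.Ioc 0 t).indicator (fun _ => ENNReal.ofReal C) u :=
          ENNReal.tsum_le_tsum fun n => lintegral_mono fun u =>
            hq.jumpIntensity_indicator_le _ _ _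
      _ = ∫⁻ u in ⋃ n, Set.Ico (ω n).1 (ω (n + 1)).1,
          (Set.Ioc 0 t).indicator (fun _ => ENNReal.ofReal C) u :=
          (lintegral_iUnion (fun _ => measurableSet_Ico) hmono.pairwise_disjoint_on_Ico_succ _).symm
      _ ≤ ∫⁻ u, (Set.Ioc 0 t).indicator (fun _ => ENNReal.ofReal C) u :=
          setLIntegral_le_lintegral _ _
      _ = ENNReal.ofReal C * ENNReal.ofReal t := by
          simp [lintegral_indicator_const measurableSet_Ioc]
  refine (lintegral_mono_ae hbound).trans_lt ?_
  rw [lintegral_const, measure_univ, mul_one]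
  exact ENNReal.mul_lt_top ENNReal.ofReal_lt_top ENNReal.ofReal_lt_top

theorem ae_exists_jumpTime_gt [Nontrivial 𝒳] (ν : Measure 𝒳) [IsProbabilityMeasure ν] (t : ℝ) :
    ∀ᵐ ω ∂jumpLaw q ν, ∃ n, t < (ω (n + 1)).1 := by
  have hs : MeasurableSet (Set.Ioc 0 t ×ˢ Set.univ : Set (ℝ × 𝒳 × 𝒳)) :=
    measurableSet_Ioc.prod MeasurableSet.univ
  have hfin := hq.jumpMeasure_Ioc_lt_top ν t
  rw [← lintegral_indicator_one hs, lintegral_jumpMeasure q ν (measurable_one.indicator hs)] at hfin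
  have hm : Measurable fun ω : ℕ → ℝ × 𝒳 =>
      ∑' n, (Set.Ioc 0 t ×ˢ Set.univ).indicator (1 : ℝ × 𝒳 × 𝒳 → ℝ≥0∞) (nthJump ω n) :=
    Measurable.tsum fun n =>
      (measurable_one.indicator hs).comp (measurable_nthJump.comp measurable_prodMk_right)
  filter_upwards [ae_lt_top hm hfin.ne, ae_jumpLaw_zero q ν, hq.ae_lt_ne_succ ν]
    with ω hsum h0 hω
  by_contra! hle
  have hpos : ∀ n, 0 < (ω (n + 1)).1 := fun n =>
    h0 ▸ (strictMono_nat_of_lt_succ fun n => (hω n).1) (Nat.succ_pos n)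
  refine hsum.ne ?_
  simp [nthJump, Set.indicator, hpos, hle]

theorem ae_isJumpSequence [Nontrivial 𝒳] (ν : Measure 𝒳) [IsProbabilityMeasure ν] :
    ∀ᵐ ω ∂jumpLaw q ν, IsJumpSequence ω := by
  filter_upwards [ae_jumpLaw_zero q ν, hq.ae_lt_ne_succ ν,
    ae_all_iff.2 fun k : ℕ => hq.ae_exists_jumpTime_gt ν k] with ω h0 hω htop
  have hmono : Monotone fun n => (ω n).1 := monotone_nat_of_le_succ fun n => (hω n).1.le
  refine ⟨h0, fun n => (hω n).1, fun n => (hω n).2,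
    tendsto_atTop_atTop_of_monotone hmono fun b => ?_⟩
  obtain ⟨k, hk⟩ := exists_nat_ge b
  obtain ⟨n, hn⟩ := htop k
  exact ⟨n + 1, hk.trans hn.le⟩

theorem lintegral_jumpMeasure_eq_path [Nontrivial 𝒳] (ν : Measure 𝒳) [IsProbabilityMeasure ν]
    {F : ℝ × 𝒳 × 𝒳 → ℝ≥0∞} (hF : Measurable F) :
    ∫⁻ z, F z ∂jumpMeasure q ν
      = ∫⁻ ω, (∫⁻ u in Set.Ici 0, jumpIntensity q F u (path ω u)) ∂jumpLaw q ν := by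
  rw [hq.lintegral_jumpMeasure_eq_tsum ν hF]
  refine lintegral_congr_ae ?_
  filter_upwards [hq.ae_isJumpSequence ν] with ω hω
  have hdisj : Pairwise (Function.onFun Disjoint fun n => Set.Ico (ω n).1 (ω (n + 1)).1) :=
    hω.strictMono.monotone.pairwise_disjoint_on_Ico_succ
  rw [← hω.iUnion_Ico, lintegral_iUnion (fun _ => measurableSet_Ico) hdisj]
  refine tsum_congr fun n => setLIntegral_congr_fun measurableSet_Ico fun u hu => ?_
  simp only [hω.path_eq hu]

end IsAdmissible

end JumpMeasure

/-! ### One-dimensional marginals -/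

section Marginals

variable {𝒳 : Type*} [MeasurableSpace 𝒳]

theorem measurable_path_family [Countable 𝒳] [MeasurableSingletonClass 𝒳] {E : Type*}
    [MeasurableSpace E] {v : ℝ → 𝒳 → E} (hv : ∀ x, Measurable fun s => v s x) :
    Measurable fun p : (ℕ → ℝ × 𝒳) × ℝ => v p.2 (path p.1 p.2) :=
  (measurable_from_prod_countable_left hv : Measurable fun z : ℝ × 𝒳 => v z.1 z.2).comp
    (measurable_snd.prodMk measurable_path)

variable [Fintype 𝒳]

/-- The law of `X_t` for the process with rates `q` and initial distribution `ν`. -/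
noncomputable def marginal (q : ℝ → 𝒳 → 𝒳 → ℝ) (ν : Measure 𝒳) (t : ℝ) (x : 𝒳) : ℝ :=
  (jumpLaw q ν).real {ω | path ω t = x}

theorem marginal_nonneg (q : ℝ → 𝒳 → 𝒳 → ℝ) (ν : Measure 𝒳) (t : ℝ) (x : 𝒳) :
    0 ≤ marginal q ν t x := measureReal_nonneg

variable (q : ℝ → 𝒳 → 𝒳 → ℝ) (ν : Measure 𝒳)

theorem marginal_le_one [IsProbabilityMeasure ν] (t : ℝ) (x : 𝒳) : marginal q ν t x ≤ 1 :=
  measureReal_le_one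

variable [MeasurableSingletonClass 𝒳]

theorem map_path_real_singleton (t : ℝ) (x : 𝒳) :
    ((jumpLaw q ν).map fun ω => path ω t).real {x} = marginal q ν t x :=
  map_measureReal_apply (measurable_path_apply t) (measurableSet_singleton x)

variable [IsProbabilityMeasure ν]

theorem marginal_eq_sum (t : ℝ) (y : 𝒳) :
    marginal q ν t y = ∑ x, ν.real {x} * transProb q t x y := by
  unfold marginal transProb Measure.real
  rw [jumpLaw_eq_sum, Measure.finsetSum_apply, ENNReal.toReal_sum]
  · simp only [Measure.smul_apply, smul_eq_mul, ENNReal.toReal_mul]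
  · intro x _
    exact ENNReal.mul_ne_top (measure_ne_top _ _) (measure_ne_top _ _)

theorem measurable_marginal (x : 𝒳) : Measurable fun t => marginal q ν t x :=
  (measurable_measure_prodMk_right (measurable_path (measurableSet_singleton x))).ennreal_toReal

theorem integrable_path (t : ℝ) (w : 𝒳 → ℝ) :
    Integrable (fun ω => w (path ω t)) (jumpLaw q ν) :=
  (Integrable.of_finite (f := w)).comp_measurable (measurable_path_apply t)

theorem integral_path (t : ℝ) (w : 𝒳 → ℝ) :
    ∫ ω, w (path ω t) ∂jumpLaw q ν = ∑ x, marginal q ν t x * w x := by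
  have := Measure.isProbabilityMeasure_map (μ := jumpLaw q ν) (measurable_path_apply t).aemeasurable
  rw [← integral_map (f := w) (measurable_path_apply t).aemeasurable
    (Measurable.of_discrete).aestronglyMeasurable, integral_fintype Integrable.of_finite]
  simp only [map_path_real_singleton, smul_eq_mul]

theorem lintegral_path (t : ℝ) (w : 𝒳 → ℝ≥0∞) :
    ∫⁻ ω, w (path ω t) ∂jumpLaw q ν = ∑ x, ENNReal.ofReal (marginal q ν t x) * w x := by
  have := Measure.isProbabilityMeasure_map (μ := jumpLaw q ν) (measurable_path_apply t).aemeasurable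
  rw [← lintegral_map (f := w) .of_discrete (measurable_path_apply t), lintegral_fintype]
  refine Finset.sum_congr rfl fun x _ => ?_
  rw [← map_path_real_singleton, ofReal_measureReal, mul_comm]

theorem sum_marginal (t : ℝ) : ∑ x, marginal q ν t x = 1 := by
  simpa using (integral_path q ν t fun _ => 1).symm

variable {s : Set ℝ}

theorem integrable_path_prod {v : ℝ → 𝒳 → ℝ} (hv : ∀ x, Measurable fun u => v u x)
    (hi : ∀ x, IntegrableOn (fun u => v u x) s) :
    Integrable (fun p : (ℕ → ℝ × 𝒳) × ℝ => v p.2 (path p.1 p.2))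
      ((jumpLaw q ν).prod (volume.restrict s)) := by
  have hsum : Integrable (fun u => ∑ x, |v u x|) (volume.restrict s) :=
    integrable_finsetSum _ fun x _ => (hi x).abs
  refine (hsum.comp_snd (jumpLaw q ν)).mono' (measurable_path_family hv).aestronglyMeasurable ?_
  filter_upwards with p
  exact Finset.single_le_sum (f := fun x => |v p.2 x|) (fun x _ => abs_nonneg _)
    (Finset.mem_univ (path p.1 p.2))

theorem integral_path_setIntegral {v : ℝ → 𝒳 → ℝ} (hv : ∀ x, Measurable fun u => v u x)
    (hi : ∀ x, IntegrableOn (fun u => v u x) s) :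
    ∫ ω, (∫ u in s, v u (path ω u)) ∂jumpLaw q ν = ∫ u in s, ∑ x, marginal q ν u x * v u x := by
  rw [integral_integral_swap (integrable_path_prod q ν hv hi)]
  simp only [integral_path q ν _ (v _)]

theorem lintegral_path_setLIntegral {v : ℝ → 𝒳 → ℝ≥0∞} (hv : ∀ x, Measurable fun u => v u x) :
    ∫⁻ ω, (∫⁻ u in s, v u (path ω u)) ∂jumpLaw q ν
      = ∑ x, ∫⁻ u in s, ENNReal.ofReal (marginal q ν u x) * v u x := by
  rw [lintegral_lintegral_swap (measurable_path_family hv).aemeasurable]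
  simp only [lintegral_path q ν _ (v _)]
  exact lintegral_finsetSum _ fun x _ => (measurable_marginal q ν x).ennreal_ofReal.mul (hv x)

theorem integrableOn_marginal_mul {f : ℝ → ℝ} (hf : IntegrableOn f s) (x : 𝒳) :
    IntegrableOn (fun u => marginal q ν u x * f u) s := by
  refine hf.bdd_mul (c := 1) (measurable_marginal q ν x).aestronglyMeasurable ?_
  filter_upwards with u
  rw [Real.norm_of_nonneg (marginal_nonneg q ν u x)]
  exact marginal_le_one q ν u x

theorem integrable_two_time (t : ℝ) (v h : 𝒳 → ℝ) :
    Integrable (fun ω => v (path ω t) * h (path ω 0)) (jumpLaw q ν) :=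
  (Integrable.of_finite (f := fun p : 𝒳 × 𝒳 => v p.1 * h p.2)).comp_measurable
    ((measurable_path_apply t).prodMk (measurable_path_apply 0))

namespace IsAdmissible

variable {q} {C : ℝ} (hq : IsAdmissible q C)
include hq

theorem ae_path_zero : ∀ᵐ ω ∂jumpLaw q ν, path ω 0 = (ω 0).2 := by
  rcases subsingleton_or_nontrivial 𝒳 with h | h
  · exact Eventually.of_forall fun ω => Subsingleton.elim _ _
  · exact (hq.ae_isJumpSequence ν).mono fun ω hω => hω.path_zero

theorem marginal_zero (y : 𝒳) : marginal q ν 0 y = ν.real {y} := by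
  have hs : MeasurableSet {a : ℝ × 𝒳 | a.2 = y} := measurable_snd (measurableSet_singleton y)
  have hstart : {ω | path ω 0 = y} =ᵐ[jumpLaw q ν] {ω | (ω 0).2 = y} := by
    filter_upwards [hq.ae_path_zero ν] with ω hω
    exact congrArg (· = y) hω
  calc marginal q ν 0 y = (jumpLaw q ν).real {ω | (ω 0).2 = y} := measureReal_congr hstart
    _ = ((jumpLaw q ν).map fun ω => ω 0).real {a | a.2 = y} :=
        (map_measureReal_apply (f := fun ω : ℕ → ℝ × 𝒳 => ω 0) (measurable_pi_apply 0) hs).symm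
    _ = ν.real {y} := by
        rw [map_zero_jumpLaw, map_measureReal_apply (by fun_prop) hs]
        rfl

theorem ae_path_zero_eq (x : 𝒳) : ∀ᵐ ω ∂jumpLaw q (Measure.dirac x), path ω 0 = x := by
  have hstart : ∀ᵐ ω ∂jumpLaw q (Measure.dirac x), (ω 0).2 = x := by
    have hs : MeasurableSet {a : ℝ × 𝒳 | a.2 = x} := measurable_snd (measurableSet_singleton x)
    refine ae_of_ae_map (f := fun ω : ℕ → ℝ × 𝒳 => ω 0) (p := fun a => a.2 = x)
      (measurable_pi_apply 0).aemeasurable ?_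
    rw [map_zero_jumpLaw, ae_map_iff (by fun_prop) hs, ae_dirac_eq]
    rfl
  filter_upwards [hq.ae_path_zero (Measure.dirac x), hstart] with ω hpath hω
  exact hpath.trans hω

theorem integral_two_time (t : ℝ) (v h : 𝒳 → ℝ) :
    ∫ ω, v (path ω t) * h (path ω 0) ∂jumpLaw q ν
      = ∑ x, ν.real {x} * ((∑ y, transProb q t x y * v y) * h x) := by
  rw [jumpLaw_eq_sum, integral_finsetSum_measure fun x _ =>
    (integrable_two_time q (Measure.dirac x) t v h).smul_measure (measure_ne_top _ _)]
  refine Finset.sum_congr rfl fun x _ => ?_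
  have hstart : (fun ω => v (path ω t) * h (path ω 0)) =ᵐ[jumpLaw q (Measure.dirac x)]
      fun ω => v (path ω t) * h x :=
    (hq.ae_path_zero_eq x).mono fun ω hω => congrArg (v (path ω t) * h ·) hω
  rw [integral_smul_measure, integral_congr_ae hstart, integral_mul_const, integral_path]
  rfl

theorem lintegral_jumpMeasure_eq_sum [Nontrivial 𝒳] {F : ℝ × 𝒳 × 𝒳 → ℝ≥0∞} (hF : Measurable F) :
    ∫⁻ z, F z ∂jumpMeasure q ν = ∑ x, ∑ y, ∫⁻ u in Set.Ici 0,
      ENNReal.ofReal (marginal q ν u x * q u x y) * F (u, x, y) := by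
  have hterm : ∀ x y, Measurable fun u => ENNReal.ofReal (q u x y) * F (u, x, y) := fun x y =>
    (hq.measurable x y).ennreal_ofReal.mul (hF.comp (by fun_prop))
  rw [hq.lintegral_jumpMeasure_eq_path ν hF, lintegral_path_setLIntegral q ν
    (v := jumpIntensity q F) fun x => Finset.measurable_sum _ fun y _ => hterm x y]
  refine Finset.sum_congr rfl fun x _ => ?_
  have hdens : ∀ y, Measurable fun u =>
      ENNReal.ofReal (marginal q ν u x * q u x y) * F (u, x, y) := fun y =>
    ((measurable_marginal q ν x).mul (hq.measurable x y)).ennreal_ofReal.mul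
      (hF.comp (by fun_prop))
  rw [← lintegral_finsetSum _ fun y _ => hdens y]
  simp only [jumpIntensity, Finset.mul_sum, ENNReal.ofReal_mul (marginal_nonneg q ν _ x),
    mul_assoc]

theorem jumpMeasure_eq_sum [Nontrivial 𝒳] :
    jumpMeasure q ν = ∑ x, ∑ y, ((volume.restrict (Set.Ici 0)).withDensity fun u =>
      ENNReal.ofReal (marginal q ν u x * q u x y)).map fun u => (u, x, y) := by
  refine Measure.ext_of_lintegral _ fun F hF => ?_
  rw [hq.lintegral_jumpMeasure_eq_sum ν hF]
  simp only [lintegral_finsetSum_measure]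
  refine Finset.sum_congr rfl fun x _ => Finset.sum_congr rfl fun y _ => ?_
  have hFxy : Measurable fun u => F (u, x, y) := hF.comp (by fun_prop)
  have hdens : Measurable fun u => ENNReal.ofReal (marginal q ν u x * q u x y) :=
    ((measurable_marginal q ν x).mul (hq.measurable x y)).ennreal_ofReal
  rw [lintegral_map hF (by fun_prop), lintegral_withDensity_eq_lintegral_mul _ hdens hFxy]
  rfl

theorem integral_jumpMeasure [Nontrivial 𝒳] {G : ℝ × 𝒳 × 𝒳 → ℝ} (hG : Measurable G)
    (hi : ∀ x y, IntegrableOn (fun u => G (u, x, y) * q u x y) (Set.Ici 0)) :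
    Integrable G (jumpMeasure q ν) ∧ ∫ z, G z ∂jumpMeasure q ν
      = ∑ x, ∑ y, ∫ u in Set.Ici 0, marginal q ν u x * (G (u, x, y) * q u x y) := by
  have hnonneg : ∀ x y u, 0 ≤ marginal q ν u x * q u x y := fun x y u =>
    mul_nonneg (marginal_nonneg q ν u x) (hq.nonneg u x y)
  have hdens : ∀ x y, Measurable fun u => ENNReal.ofReal (marginal q ν u x * q u x y) :=
    fun x y => ((measurable_marginal q ν x).mul (hq.measurable x y)).ennreal_ofReal
  have hint : ∀ x y, Integrable G (((volume.restrict (Set.Ici 0)).withDensity fun u =>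
      ENNReal.ofReal (marginal q ν u x * q u x y)).map fun u => (u, x, y)) := by
    intro x y
    rw [integrable_map_measure hG.aestronglyMeasurable (by fun_prop),
      integrable_withDensity_iff_integrable_smul' (hdens x y)
        (Eventually.of_forall fun _ => ENNReal.ofReal_lt_top)]
    refine (integrableOn_marginal_mul q ν (hi x y) x).congr (Eventually.of_forall fun u => ?_)
    simp only [ENNReal.toReal_ofReal (hnonneg x y u), Function.comp_apply, smul_eq_mul]
    ring
  rw [hq.jumpMeasure_eq_sum ν]
  refine ⟨integrable_finsetSum_measure.2 fun x _ => integrable_finsetSum_measure.2 fun y _ =>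
    hint x y, ?_⟩
  rw [integral_finsetSum_measure fun x _ => integrable_finsetSum_measure.2 fun y _ => hint x y]
  refine Finset.sum_congr rfl fun x _ => ?_
  rw [integral_finsetSum_measure fun y _ => hint x y]
  refine Finset.sum_congr rfl fun y _ => ?_
  rw [integral_map (by fun_prop) hG.aestronglyMeasurable,
    integral_withDensity_eq_integral_toReal_smul (hdens x y)
      (Eventually.of_forall fun _ => ENNReal.ofReal_lt_top)]
  refine integral_congr_ae (Eventually.of_forall fun u => ?_)
  simp only [ENNReal.toReal_ofReal (hnonneg x y u), smul_eq_mul]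
  ring

theorem lintegral_tsum_jumps {F : ℝ × 𝒳 × 𝒳 → ℝ≥0∞} (hF : Measurable F) (t : ℝ) :
    ∫⁻ ω, ∑' p : jumps (path ω) t, F (p.1.1, p.1.2, path ω p.1.1) ∂jumpLaw q ν
      = ∑ x, ∑ y, ∫⁻ u in Set.Ioc 0 t,
          ENNReal.ofReal (marginal q ν u x * q u x y) * F (u, x, y) := by
  rcases subsingleton_or_nontrivial 𝒳 with h | h
  · simp [jumps_eq_empty, hq.eq_zero]
  have hs : MeasurableSet (Set.Ioc 0 t ×ˢ Set.univ : Set (ℝ × 𝒳 × 𝒳)) :=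
    measurableSet_Ioc.prod MeasurableSet.univ
  have hsum : ∀ᵐ ω ∂jumpLaw q ν, ∑' p : jumps (path ω) t, F (p.1.1, p.1.2, path ω p.1.1)
      = ∑' n, (Set.Ioc 0 t ×ˢ Set.univ).indicator F (nthJump ω n) :=
    (hq.ae_isJumpSequence ν).mono fun ω hω => hω.tsum_jumps F t
  rw [lintegral_congr_ae hsum, ← lintegral_jumpMeasure q ν (hF.indicator hs),
    hq.lintegral_jumpMeasure_eq_sum ν (hF.indicator hs)]
  refine Finset.sum_congr rfl fun x _ => Finset.sum_congr rfl fun y _ => ?_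
  have hIci : Set.Ioc 0 t ∩ Set.Ici 0 = Set.Ioc 0 t :=
    Set.inter_eq_left.2 (Set.Ioc_subset_Icc_self.trans Set.Icc_subset_Ici_self)
  have hind : (fun u => ENNReal.ofReal (marginal q ν u x * q u x y)
        * (Set.Ioc 0 t ×ˢ Set.univ).indicator F (u, x, y)) = (Set.Ioc 0 t).indicator fun u =>
          ENNReal.ofReal (marginal q ν u x * q u x y) * F (u, x, y) := by
    ext u
    by_cases hu : u ∈ Set.Ioc 0 t <;> simp [Set.indicator, hu]
  rw [hind, setLIntegral_indicator measurableSet_Ioc, hIci]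

theorem integral_jumpSum {α : ℝ → 𝒳 → 𝒳 → ℝ} (hα : ∀ x y, Measurable fun s => α s x y) {t : ℝ}
    (hi : ∀ x y, IntegrableOn (fun s => α s x y * q s x y) (Set.Ioc 0 t)) :
    Integrable (fun ω => jumpSum α t (path ω)) (jumpLaw q ν) ∧
    ∫ ω, jumpSum α t (path ω) ∂jumpLaw q ν
      = ∑ x, ∑ y, ∫ u in Set.Ioc (0 : ℝ) t, marginal q ν u x * (α u x y * q u x y) := by
  rcases subsingleton_or_nontrivial 𝒳 with h | h
  · simp [jumpSum, jumps_eq_empty, hq.eq_zero]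
  let G : ℝ × 𝒳 × 𝒳 → ℝ := (Set.Ioc 0 t ×ˢ Set.univ).indicator fun z => α z.1 z.2.1 z.2.2
  have hG : Measurable G :=
    Measurable.indicator (measurable_from_prod_countable_left fun z => hα z.1 z.2)
      (measurableSet_Ioc.prod MeasurableSet.univ)
  have hind : ∀ (x y : 𝒳) (c : ℝ → ℝ), (fun u => c u * (G (u, x, y) * q u x y))
      = (Set.Ioc 0 t).indicator fun u => c u * (α u x y * q u x y) := by
    intro x y c
    ext u
    by_cases hu : u ∈ Set.Ioc 0 t <;> simp [G, Set.indicator, hu]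
  have hIci : Set.Ici 0 ∩ Set.Ioc 0 t = Set.Ioc 0 t :=
    Set.inter_eq_right.2 (Set.Ioc_subset_Icc_self.trans Set.Icc_subset_Ici_self)
  obtain ⟨hGint, hGval⟩ := hq.integral_jumpMeasure ν hG fun x y => by
    have hone := hind x y fun _ => 1
    simp only [one_mul] at hone
    rw [hone]
    exact ((integrable_indicator_iff measurableSet_Ioc).2 (hi x y)).integrableOn
  have hprod : Integrable (fun p : (ℕ → ℝ × 𝒳) × ℕ => G (nthJump p.1 p.2))
      ((jumpLaw q ν).prod Measure.count) :=
    hGint.comp_measurable measurable_nthJump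
  have hsum : ∀ᵐ ω ∂jumpLaw q ν, ∫ n, G (nthJump ω n) ∂Measure.count = jumpSum α t (path ω) := by
    filter_upwards [hq.ae_isJumpSequence ν, hprod.prod_right_ae] with ω hω hcount
    rw [integral_countable hcount]
    simp only [measureReal_def, Measure.count_singleton, ENNReal.toReal_one, one_smul]
    exact (hω.tsum_jumps (fun z => α z.1 z.2.1 z.2.2) t).symm
  refine ⟨hprod.integral_prod_left.congr hsum, ?_⟩
  rw [← integral_congr_ae hsum, ← integral_prod _ hprod,
    ← integral_map (f := G) measurable_nthJump.aemeasurable hG.aestronglyMeasurable]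
  refine hGval.trans (Finset.sum_congr rfl fun x _ => Finset.sum_congr rfl fun y _ => ?_)
  rw [hind, setIntegral_indicator measurableSet_Ioc, hIci]

theorem jumpSum_sub_eq (f : 𝒳 → ℝ) {t : ℝ} (ht : 0 ≤ t) :
    ∀ᵐ ω ∂jumpLaw q ν, jumpSum (fun _ x y => f y - f x) t (path ω)
      = f (path ω t) - f (path ω 0) := by
  rcases subsingleton_or_nontrivial 𝒳 with h | h
  · refine Eventually.of_forall fun ω => ?_
    rw [Subsingleton.elim (path ω t) (path ω 0)]
    simp [jumpSum, jumps_eq_empty]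
  filter_upwards [hq.ae_isJumpSequence ν] with ω hω
  obtain ⟨N, hN⟩ := hω.exists_mem_Ico ht
  have hle : ∀ n, (ω (n + 1)).1 ≤ t ↔ n < N := fun n =>
    ⟨fun h => Nat.succ_lt_succ_iff.1 (hω.strictMono.lt_iff_lt.1 (h.trans_lt hN.2)),
      fun h => (hω.strictMono.monotone (Nat.succ_le_of_lt h)).trans hN.1⟩
  refine (hω.tsum_jumps (fun z => f z.2.2 - f z.2.1) t).trans ?_
  rw [hω.path_zero, hω.path_eq hN, ← Finset.sum_range_sub fun n => f (ω n).2,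
    tsum_eq_sum (s := Finset.range N) fun n hn => by simp [nthJump, hle, Finset.mem_range.not.1 hn]]
  refine Finset.sum_congr rfl fun n hn => ?_
  simp [nthJump, hω.jumpTime_succ_pos, hle, Finset.mem_range.1 hn]

theorem forward_equation (f : 𝒳 → ℝ) {t : ℝ} (ht : 0 ≤ t) :
    ∑ x, marginal q ν t x * f x = ∑ x, ν.real {x} * f x
      + ∫ u in (0 : ℝ)..t, ∑ x, marginal q ν u x * generator (q u) f x := by
  have hi : ∀ x y, IntegrableOn (fun s => (f y - f x) * q s x y) (Set.Ioc 0 t) := fun x y =>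
    hq.integrableOn_const_mul _ x y t
  have hjump := (hq.integral_jumpSum ν (α := fun _ x y => f y - f x)
    (fun _ _ => measurable_const) hi).2
  rw [integral_congr_ae (hq.jumpSum_sub_eq ν f ht),
    integral_sub (integrable_path q ν t f) (integrable_path q ν 0 f),
    integral_path, integral_path] at hjump
  simp only [hq.marginal_zero ν] at hjump
  rw [intervalIntegral.integral_of_le ht, sub_eq_iff_eq_add'.1 hjump, add_right_inj]
  have hI : ∀ x y, IntegrableOn (fun u => marginal q ν u x * ((f y - f x) * q u x y))
      (Set.Ioc 0 t) := fun x y => integrableOn_marginal_mul q ν (hi x y) x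
  simp only [generator_apply, Finset.mul_sum, mul_comm (q _ _ _)]
  rw [integral_finsetSum _ fun x _ => integrable_finsetSum _ fun y _ => hI x y]
  exact Finset.sum_congr rfl fun x _ => (integral_finsetSum _ fun y _ => hI x y).symm

end IsAdmissible

end Marginals

/-! ### The forward equation -/

theorem eq_zero_of_le_mul_integral {D : ℝ → ℝ} {K : ℝ} (hD : Continuous D)
    (hnonneg : ∀ s, 0 ≤ s → 0 ≤ D s) (hle : ∀ s, 0 ≤ s → D s ≤ K * ∫ u in (0 : ℝ)..s, D u)
    {t : ℝ} (ht : 0 ≤ t) : D t = 0 := by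
  have hderiv : ∀ s, HasDerivAt (fun s => ∫ u in (0 : ℝ)..s, D u) (D s) s := fun s =>
    intervalIntegral.integral_hasDerivAt_right (hD.intervalIntegrable _ _)
      hD.stronglyMeasurable.stronglyMeasurableAtFilter hD.continuousAt
  have hint : ∀ s, 0 ≤ s → 0 ≤ ∫ u in (0 : ℝ)..s, D u := fun s hs =>
    intervalIntegral.integral_nonneg hs fun u hu => hnonneg u hu.1
  have hgronwall := norm_le_gronwallBound_of_norm_deriv_right_le (δ := 0) (K := K) (ε := 0)
    (a := 0) (b := t) (fun s _ => (hderiv s).continuousAt.continuousWithinAt)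
    (fun s _ => (hderiv s).hasDerivWithinAt) (by simp) (fun s hs => by
      rw [Real.norm_of_nonneg (hnonneg s hs.1), Real.norm_of_nonneg (hint s hs.1), add_zero]
      exact hle s hs.1) t ⟨ht, le_rfl⟩
  simp only [gronwallBound_ε0, zero_mul] at hgronwall
  have hzero : ∫ u in (0 : ℝ)..t, D u = 0 := norm_le_zero_iff.1 hgronwall
  exact le_antisymm ((hle t ht).trans_eq (by rw [hzero, mul_zero])) (hnonneg t ht)

section ForwardEquation

variable {𝒳 : Type*} [Fintype 𝒳]

/-- The right-hand side of the forward (master) equation at `z`: the net flow of mass into `z`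
when mass distributed according to `p` moves with the jump rates `A`. -/
def netFlow (A : 𝒳 → 𝒳 → ℝ) (p : 𝒳 → ℝ) (z : 𝒳) : ℝ :=
  ∑ x, p x * A x z - p z * ∑ y, A z y

theorem netFlow_sub (A : 𝒳 → 𝒳 → ℝ) (p p' : 𝒳 → ℝ) (z : 𝒳) :
    netFlow A (p - p') z = netFlow A p z - netFlow A p' z := by
  simp only [netFlow, Pi.sub_apply, sub_mul, Finset.sum_sub_distrib]
  ring

theorem sum_netFlow_mul (A : 𝒳 → 𝒳 → ℝ) (p f : 𝒳 → ℝ) :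
    ∑ z, netFlow A p z * f z = ∑ x, p x * generator A f x := by
  simp only [netFlow, generator_apply, sub_mul, mul_sub, Finset.sum_sub_distrib, Finset.mul_sum,
    Finset.sum_mul, mul_assoc]
  rw [Finset.sum_comm]

theorem netFlow_eq_sum_single [DecidableEq 𝒳] (A : 𝒳 → 𝒳 → ℝ) (p : 𝒳 → ℝ) (z : 𝒳) :
    netFlow A p z = ∑ x, p x * generator A (Pi.single z 1) x := by
  rw [← sum_netFlow_mul]
  simp [Pi.single_apply]

theorem sum_abs_netFlow_le {A : 𝒳 → 𝒳 → ℝ} {C : ℝ} (hA : ∀ x y, 0 ≤ A x y)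
    (hC : ∀ x, ∑ y, A x y ≤ C) (p : 𝒳 → ℝ) :
    ∑ z, |netFlow A p z| ≤ 2 * C * ∑ x, |p x| := by
  have hz : ∀ z, |netFlow A p z| ≤ ∑ x, |p x| * A x z + |p z| * ∑ y, A z y := fun z => by
    refine (abs_sub _ _).trans (add_le_add ((Finset.abs_sum_le_sum_abs _ _).trans_eq ?_) ?_)
    · simp only [abs_mul, abs_of_nonneg (hA _ z)]
    · rw [abs_mul, abs_of_nonneg (Finset.sum_nonneg fun y _ => hA z y)]
  calc ∑ z, |netFlow A p z| ≤ ∑ z, (∑ x, |p x| * A x z + |p z| * ∑ y, A z y) :=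
        Finset.sum_le_sum fun z _ => hz z
    _ = 2 * ∑ x, |p x| * ∑ y, A x y := by
        rw [Finset.sum_add_distrib, Finset.sum_comm, two_mul]
        simp only [Finset.mul_sum]
    _ ≤ 2 * ∑ x, |p x| * C := by
        gcongr with x
        exact hC x
    _ = 2 * C * ∑ x, |p x| := by rw [← Finset.sum_mul]; ring

/-- A curve `p` of probability vectors solving the Kolmogorov forward equation with rates `q` on
`[0, ∞)`, in integrated form since the rates are only measurable in time. -/
structure IsForwardSolution (q : ℝ → 𝒳 → 𝒳 → ℝ) (p : ℝ → 𝒳 → ℝ) : Prop where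
  measurable : ∀ x, Measurable fun s => p s x
  mem_stdSimplex : ∀ s, p s ∈ stdSimplex ℝ 𝒳
  eq_add_integral : ∀ z t, 0 ≤ t →
    p t z = p 0 z + ∫ u in (0 : ℝ)..t, netFlow (q u) (p u) z

namespace IsForwardSolution

variable {q : ℝ → 𝒳 → 𝒳 → ℝ} {C : ℝ} {p p' : ℝ → 𝒳 → ℝ}

section SingleSolution

variable (hp : IsForwardSolution q p)
include hp

theorem nonneg (s : ℝ) (x : 𝒳) : 0 ≤ p s x := (hp.mem_stdSimplex s).1 x

theorem sum_eq_one (s : ℝ) : ∑ x, p s x = 1 := (hp.mem_stdSimplex s).2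

theorem norm_le_one (s : ℝ) (x : 𝒳) : ‖p s x‖ ≤ 1 := by
  rw [Real.norm_of_nonneg (hp.nonneg s x), ← hp.sum_eq_one s]
  exact Finset.single_le_sum (fun y _ => hp.nonneg s y) (Finset.mem_univ x)

theorem intervalIntegrable (s t : ℝ) (x : 𝒳) : IntervalIntegrable (fun u => p u x) volume s t :=
  (intervalIntegrable_const (c := (1 : ℝ))).mono_fun' (hp.measurable x).aestronglyMeasurable
    (Eventually.of_forall fun u => hp.norm_le_one u x)

variable (hq : IsBoundedRate q C)
include hq

theorem intervalIntegrable_netFlow (s t : ℝ) (z : 𝒳) :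
    IntervalIntegrable (fun u => netFlow (q u) (p u) z) volume s t := by
  have hmeas : Measurable fun u => netFlow (q u) (p u) z :=
    (Finset.measurable_sum _ fun x _ => (hp.measurable x).mul (hq.measurable x z)).sub
      ((hp.measurable z).mul (Finset.measurable_sum _ fun y _ => hq.measurable z y))
  refine (intervalIntegrable_const (c := 2 * C)).mono_fun' hmeas.aestronglyMeasurable
    (Eventually.of_forall fun u => ?_)
  calc ‖netFlow (q u) (p u) z‖ ≤ ∑ z, |netFlow (q u) (p u) z| :=
        Finset.single_le_sum (f := fun z => |netFlow (q u) (p u) z|) (fun _ _ => abs_nonneg _)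
          (Finset.mem_univ z)
    _ ≤ 2 * C * ∑ x, |p u x| := sum_abs_netFlow_le (hq.nonneg u) (hq.exitRate_le u) (p u)
    _ = 2 * C := by simp only [abs_of_nonneg (hp.nonneg u _), hp.sum_eq_one, mul_one]

theorem comp_add {T : ℝ} (hT : 0 ≤ T) :
    IsForwardSolution (fun s => q (T + s)) (fun s => p (T + s)) := by
  refine ⟨fun x => (hp.measurable x).comp (measurable_const_add T),
    fun s => hp.mem_stdSimplex (T + s), fun z t ht => ?_⟩
  have hshift := intervalIntegral.integral_comp_add_left (a := 0) (b := t)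
    (fun u => netFlow (q u) (p u) z) T
  rw [add_zero] at hshift ⊢
  rw [hshift, hp.eq_add_integral z (T + t) (by positivity), hp.eq_add_integral z T hT, add_assoc,
    intervalIntegral.integral_add_adjacent_intervals (hp.intervalIntegrable_netFlow hq 0 T z)
    (hp.intervalIntegrable_netFlow hq T (T + t) z)]

theorem continuousOn (z : 𝒳) : ContinuousOn (fun s => p s z) (Set.Ici 0) :=
  (continuousOn_const.add (intervalIntegral.continuous_primitive
    (fun a b => hp.intervalIntegrable_netFlow hq a b z) 0).continuousOn).congr
    fun s hs => hp.eq_add_integral z s hs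

theorem mul_eq_add_integral {φ φ' : ℝ → ℝ} (hφ : ∀ s, HasDerivAt φ (φ' s) s)
    (hφ' : Continuous φ') (z : 𝒳) {t : ℝ} (ht : 0 ≤ t) :
    p t z * φ t = p 0 z * φ 0
      + ∫ u in (0 : ℝ)..t, (netFlow (q u) (p u) z * φ u + p u z * φ' u) := by
  have hflow := hp.intervalIntegrable_netFlow hq 0 t z
  let P : ℝ → ℝ := fun s => p 0 z + ∫ u in (0 : ℝ)..s, netFlow (q u) (p u) z
  have hP : ∀ s, 0 ≤ s → P s = p s z := fun s hs => (hp.eq_add_integral z s hs).symm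
  have hPac : AbsolutelyContinuousOnInterval P 0 t :=
    (LipschitzOnWith.absolutelyContinuousOnInterval
      (LipschitzWith.const (p 0 z)).lipschitzOnWith).add
      (hflow.absolutelyContinuousOnInterval_intervalIntegral (by simp))
  have hφac : AbsolutelyContinuousOnInterval φ 0 t := by
    refine ContDiffOn.absolutelyContinuousOnInterval (ContDiff.contDiffOn ?_)
    refine contDiff_one_iff_deriv.2 ⟨fun s => (hφ s).differentiableAt, ?_⟩
    rwa [show deriv φ = φ' from funext fun s => (hφ s).deriv]
  have hparts := hPac.integral_deriv_mul_eq_sub hφac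
  rw [hP 0 le_rfl, hP t ht] at hparts
  rw [← sub_eq_iff_eq_add', ← hparts]
  refine intervalIntegral.integral_congr_ae ?_
  filter_upwards [hflow.ae_hasDerivAt_integral] with u hu hut
  have hPderiv : HasDerivAt P (netFlow (q u) (p u) z) u :=
    (hu (Set.uIoc_subset_uIcc hut) 0 (by simp)).const_add (p 0 z)
  rw [Set.uIoc_of_le ht] at hut
  rw [hPderiv.deriv, (hφ u).deriv, hP u hut.1.le]

theorem intervalIntegrable_netFlow_mul_add {φ φ' : ℝ → ℝ} (hφ : Continuous φ)
    (hφ' : Continuous φ') (z : 𝒳) (s t : ℝ) : IntervalIntegrable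
      (fun u => netFlow (q u) (p u) z * φ u + p u z * φ' u) volume s t :=
  ((hp.intervalIntegrable_netFlow hq s t z).mul_continuousOn hφ.continuousOn).add
    ((hp.intervalIntegrable s t z).mul_continuousOn hφ'.continuousOn)

theorem sum_mul_eq_add_integral {φ φ' : ℝ → 𝒳 → ℝ}
    (hφ : ∀ s x, HasDerivAt (fun s => φ s x) (φ' s x) s)
    (hφ' : ∀ x, Continuous fun s => φ' s x) {t : ℝ} (ht : 0 ≤ t) :
    ∑ x, p t x * φ t x = ∑ x, p 0 x * φ 0 x
      + ∫ u in (0 : ℝ)..t, ∑ x, p u x * (generator (q u) (φ u) x + φ' u x) := by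
  have hcont : ∀ x, Continuous fun s => φ s x := fun x =>
    continuous_iff_continuousAt.2 fun s => (hφ s x).continuousAt
  rw [Finset.sum_congr rfl fun x _ =>
      hp.mul_eq_add_integral hq (fun s => hφ s x) (hφ' x) x ht, Finset.sum_add_distrib,
    ← intervalIntegral.integral_finsetSum fun x _ =>
      hp.intervalIntegrable_netFlow_mul_add hq (hcont x) (hφ' x) x 0 t]
  simp only [mul_add, Finset.sum_add_distrib, sum_netFlow_mul]

end SingleSolution

theorem intervalIntegrable_netFlow_sub (hp : IsForwardSolution q p)
    (hp' : IsForwardSolution q p') (hq : IsBoundedRate q C) (s t : ℝ) (z : 𝒳) :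
    IntervalIntegrable (fun u => netFlow (q u) (p u - p' u) z) volume s t := by
  simp only [netFlow_sub]
  exact (hp.intervalIntegrable_netFlow hq s t z).sub (hp'.intervalIntegrable_netFlow hq s t z)

theorem sub_eq_integral_netFlow (hp : IsForwardSolution q p) (hp' : IsForwardSolution q p')
    (hq : IsBoundedRate q C) (h0 : p 0 = p' 0) {t : ℝ} (ht : 0 ≤ t) (z : 𝒳) :
    (p t - p' t) z = ∫ u in (0 : ℝ)..t, netFlow (q u) (p u - p' u) z := by
  simp only [netFlow_sub]
  rw [intervalIntegral.integral_sub (hp.intervalIntegrable_netFlow hq 0 t z)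
    (hp'.intervalIntegrable_netFlow hq 0 t z), Pi.sub_apply, hp.eq_add_integral z t ht,
    hp'.eq_add_integral z t ht, h0]
  ring

theorem sum_abs_sub_le_integral (hp : IsForwardSolution q p) (hp' : IsForwardSolution q p')
    (hq : IsBoundedRate q C) (h0 : p 0 = p' 0) {t : ℝ} (ht : 0 ≤ t) :
    ∑ z, |(p t - p' t) z| ≤ ∫ u in (0 : ℝ)..t, ∑ z, |netFlow (q u) (p u - p' u) z| := by
  rw [intervalIntegral.integral_finsetSum fun z _ =>
    (hp.intervalIntegrable_netFlow_sub hp' hq 0 t z).abs]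
  refine Finset.sum_le_sum fun z _ => ?_
  rw [hp.sub_eq_integral_netFlow hp' hq h0 ht]
  exact intervalIntegral.abs_integral_le_integral_abs ht

theorem eq_of_zero_eq (hp : IsForwardSolution q p) (hp' : IsForwardSolution q p')
    (hq : IsBoundedRate q C) (h0 : p 0 = p' 0) {t : ℝ} (ht : 0 ≤ t) : p t = p' t := by
  -- `max s 0` extends the distance continuously to all times
  let D : ℝ → ℝ := fun s => ∑ z, |p (max s 0) z - p' (max s 0) z|
  have hmax : Continuous fun s : ℝ => max s 0 := by fun_prop
  have hDcont : Continuous D := continuous_finsetSum _ fun z _ =>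
    (((hp.continuousOn hq z).comp_continuous hmax fun s => le_max_right s 0).sub
      ((hp'.continuousOn hq z).comp_continuous hmax fun s => le_max_right s 0)).abs
  have hD : ∀ s, 0 ≤ s → D s = ∑ z, |(p s - p' s) z| := fun s hs => by
    simp only [D, max_eq_left hs, Pi.sub_apply]
  have hflow : ∀ s, IntervalIntegrable
      (fun u => ∑ z, |netFlow (q u) (p u - p' u) z|) volume 0 s := fun s =>
    intervalIntegrable_iff.2 (integrable_finsetSum _ fun z _ =>
      intervalIntegrable_iff.1 (hp.intervalIntegrable_netFlow_sub hp' hq 0 s z).abs)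
  have hle : ∀ s, 0 ≤ s → D s ≤ 2 * C * ∫ u in (0 : ℝ)..s, D u := fun s hs => by
    rw [hD s hs, ← intervalIntegral.integral_const_mul]
    refine (hp.sum_abs_sub_le_integral hp' hq h0 hs).trans ?_
    refine intervalIntegral.integral_mono_on hs (hflow s)
      ((hDcont.const_mul _).intervalIntegrable _ _) fun u hu => ?_
    rw [hD u hu.1]
    exact sum_abs_netFlow_le (hq.nonneg u) (hq.exitRate_le u) _
  have hzero := eq_zero_of_le_mul_integral hDcont
    (fun s _ => Finset.sum_nonneg fun z _ => abs_nonneg _) hle ht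
  rw [hD t ht, Finset.sum_eq_zero_iff_of_nonneg fun z _ => abs_nonneg _] at hzero
  exact funext fun z => sub_eq_zero.1 (abs_eq_zero.1 (hzero z (Finset.mem_univ z)))

variable (hp : IsForwardSolution q p) (hq : IsBoundedRate q C)
include hp hq

theorem eq_add_nat_mul {T : ℝ} (hT : 0 ≤ T)
    (hper : ∀ x y, Function.Periodic (fun s => q s x y) T) (h0 : p T = p 0) (n : ℕ) {t : ℝ}
    (ht : 0 ≤ t) : p (t + n * T) = p t := by
  have hshift : (fun s => q (T + s)) = q := by
    funext s x y
    rw [add_comm]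
    exact hper x y s
  have hsol := hp.comp_add hq hT
  rw [hshift] at hsol
  have hone : ∀ s, 0 ≤ s → p (T + s) = p s := fun s hs =>
    hsol.eq_of_zero_eq hp hq (by simpa using h0) hs
  induction n with
  | zero => simp
  | succ n ih =>
    rw [← ih, ← hone (t + n * T) (by positivity)]
    congr 1
    push_cast
    ring

theorem exp_mul_eq_add_integral (y : 𝒳) {t : ℝ} (ht : 0 ≤ t) :
    p t y * Real.exp (C * t) = p 0 y + ∫ u in (0 : ℝ)..t, Real.exp (C * u) *
      (p u y * (C - exitRate q u y) + ∑ x, p u x * q u x y) := by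
  have hderiv : ∀ s, HasDerivAt (fun s => Real.exp (C * s)) (C * Real.exp (C * s)) s := fun s => by
    simpa [mul_comm] using ((hasDerivAt_id s).const_mul C).exp
  rw [hp.mul_eq_add_integral hq hderiv (by fun_prop) y ht, mul_zero, Real.exp_zero, mul_one]
  congr 2
  funext u
  rw [netFlow, exitRate]
  ring

theorem pos_of_pos_zero {y : 𝒳} (h0 : 0 < p 0 y) {t : ℝ} (ht : 0 ≤ t) : 0 < p t y := by
  refine pos_of_mul_pos_left ?_ (Real.exp_pos (C * t)).le
  rw [hp.exp_mul_eq_add_integral hq y ht]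
  refine add_pos_of_pos_of_nonneg h0 (intervalIntegral.integral_nonneg ht fun u _ => ?_)
  exact mul_nonneg (Real.exp_pos _).le
    (add_nonneg (mul_nonneg (hp.nonneg u y) (sub_nonneg.2 (hq.exitRate_le u y)))
      (Finset.sum_nonneg fun x _ => mul_nonneg (hp.nonneg u x) (hq.nonneg u x y)))

theorem pos_of_rate_pos {x y : 𝒳} (hxy : ∀ s, 0 < q s x y) (hx : ∀ t, 0 < t → 0 < p t x) {t : ℝ}
    (ht : 0 < t) : 0 < p t y := by
  have hint : IntervalIntegrable (fun u => Real.exp (C * u) *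
      (p u y * (C - exitRate q u y) + ∑ x, p u x * q u x y)) volume 0 t := by
    refine (hp.intervalIntegrable_netFlow_mul_add hq (φ := fun u => Real.exp (C * u))
      (φ' := fun u => C * Real.exp (C * u)) (by fun_prop) (by fun_prop) y 0 t).congr fun u _ => ?_
    simp only [netFlow, exitRate]
    ring
  refine pos_of_mul_pos_left ?_ (Real.exp_pos (C * t)).le
  rw [hp.exp_mul_eq_add_integral hq y ht.le]
  refine add_pos_of_nonneg_of_pos (hp.nonneg 0 y)
    (intervalIntegral.intervalIntegral_pos_of_pos_on hint (fun u hu => ?_) ht)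
  refine mul_pos (Real.exp_pos _) (add_pos_of_nonneg_of_pos
    (mul_nonneg (hp.nonneg u y) (sub_nonneg.2 (hq.exitRate_le u y))) ?_)
  exact Finset.sum_pos' (fun x _ => mul_nonneg (hp.nonneg u x) (hq.nonneg u x y))
    ⟨x, Finset.mem_univ x, mul_pos (hx u hu.1) (hxy u)⟩

theorem pos_of_reflTransGen {x y : 𝒳}
    (hxy : Relation.ReflTransGen (fun a b => ∀ s, 0 < q s a b) x y) (h0 : 0 < p 0 x) :
    ∀ t, 0 < t → 0 < p t y := by
  induction hxy with
  | refl => exact fun t ht => hp.pos_of_pos_zero hq h0 ht.le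
  | tail _ hbc ih => exact fun t ht => hp.pos_of_rate_pos hq hbc ih ht

end IsForwardSolution

theorem IsAdmissible.isForwardSolution [MeasurableSpace 𝒳] [MeasurableSingletonClass 𝒳]
    {q : ℝ → 𝒳 → 𝒳 → ℝ} {C : ℝ} (hq : IsAdmissible q C) (ν : Measure 𝒳)
    [IsProbabilityMeasure ν] : IsForwardSolution q (marginal q ν) := by
  classical
  refine ⟨measurable_marginal q ν, fun t => ⟨marginal_nonneg q ν t, sum_marginal q ν t⟩,
    fun z t ht => ?_⟩
  simpa [Pi.single_apply, hq.marginal_zero ν, netFlow_eq_sum_single] using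
    hq.forward_equation ν (Pi.single z 1) ht

end ForwardEquation

/-! ### Oscillation and stochastic matrices -/

section Stochastic

open scoped Matrix

/-- The oscillation `max f - min f` of a function on a finite set. -/
noncomputable def osc {𝒳 : Type*} (f : 𝒳 → ℝ) : ℝ := Metric.diam (Set.range f)

theorem osc_nonneg {𝒳 : Type*} (f : 𝒳 → ℝ) : 0 ≤ osc f := Metric.diam_nonneg

theorem osc_le {𝒳 : Type*} {f : 𝒳 → ℝ} {d : ℝ} (hd : 0 ≤ d) (hf : ∀ a b, |f a - f b| ≤ d) :
    osc f ≤ d := by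
  refine Metric.diam_le_of_forall_dist_le hd ?_
  rintro _ ⟨a, rfl⟩ _ ⟨b, rfl⟩
  exact hf a b

theorem abs_sub_le_osc {𝒳 : Type*} [Finite 𝒳] (f : 𝒳 → ℝ) (a b : 𝒳) : |f a - f b| ≤ osc f :=
  Metric.dist_le_diam_of_mem (Set.finite_range f).isBounded ⟨a, rfl⟩ ⟨b, rfl⟩

theorem osc_le_two_mul {𝒳 : Type*} {f : 𝒳 → ℝ} {d : ℝ} (hd : 0 ≤ d) (hf : ∀ x, |f x| ≤ d) :
    osc f ≤ 2 * d :=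
  osc_le (by positivity) fun a b => by linarith [abs_sub (f a) (f b), hf a, hf b]

theorem exists_pos_lt_one_forall_le {ι : Type*} [Finite ι] {F : ι → ℝ} (hF : ∀ i, 0 < F i) :
    ∃ ε, 0 < ε ∧ ε < 1 ∧ ∀ i, ε ≤ F i := by
  rcases isEmpty_or_nonempty ι with h | h
  · exact ⟨1 / 2, by norm_num, by norm_num, fun i => h.elim i⟩
  · obtain ⟨i, hi⟩ := Finite.exists_min F
    exact ⟨min (F i) (1 / 2), lt_min (hF i) (by norm_num),
      (min_le_right _ _).trans_lt (by norm_num), fun j => (min_le_left _ _).trans (hi j)⟩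

variable {𝒳 : Type*} [Fintype 𝒳]

theorem osc_le_two_mul_sum_abs (f : 𝒳 → ℝ) : osc f ≤ 2 * ∑ x, |f x| :=
  osc_le_two_mul (Finset.sum_nonneg fun _ _ => abs_nonneg _) fun x =>
    Finset.single_le_sum (f := fun x => |f x|) (fun _ _ => abs_nonneg _) (Finset.mem_univ x)

theorem sum_sub_sum_le_mul_osc {w w' : 𝒳 → ℝ} {c : ℝ} (hw : ∀ x, 0 ≤ w x) (hwc : ∑ x, w x = c)
    (hw' : ∀ x, 0 ≤ w' x) (hwc' : ∑ x, w' x = c) (f : 𝒳 → ℝ) :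
    ∑ x, w x * f x - ∑ x, w' x * f x ≤ c * osc f := by
  rcases isEmpty_or_nonempty 𝒳 with h | h
  · simp [← hwc]
  obtain ⟨m, hm⟩ := Finite.exists_min f
  have hshift : ∑ x, w x * f x - ∑ x, w' x * f x
      = ∑ x, w x * (f x - f m) - ∑ x, w' x * (f x - f m) := by
    simp only [mul_sub, Finset.sum_sub_distrib, ← Finset.sum_mul, hwc, hwc']
    ring
  calc ∑ x, w x * f x - ∑ x, w' x * f x ≤ ∑ x, w x * (f x - f m) := by
        rw [hshift]
        exact sub_le_self _ (Finset.sum_nonneg fun x _ => mul_nonneg (hw' x) (sub_nonneg.2 (hm x)))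
    _ ≤ ∑ x, w x * osc f := by
        gcongr with x
        · exact hw x
        · exact (le_abs_self _).trans (abs_sub_le_osc f x m)
    _ = c * osc f := by rw [← Finset.sum_mul, hwc]

theorem abs_sum_sub_sum_le_mul_osc {w w' : 𝒳 → ℝ} {c : ℝ} (hw : ∀ x, 0 ≤ w x)
    (hwc : ∑ x, w x = c) (hw' : ∀ x, 0 ≤ w' x) (hwc' : ∑ x, w' x = c) (f : 𝒳 → ℝ) :
    |∑ x, w x * f x - ∑ x, w' x * f x| ≤ c * osc f :=
  abs_sub_le_iff.2 ⟨sum_sub_sum_le_mul_osc hw hwc hw' hwc' f,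
    sum_sub_sum_le_mul_osc hw' hwc' hw hwc f⟩

theorem abs_sum_mul_le_of_mem_stdSimplex {w f : 𝒳 → ℝ} {d : ℝ} (hw : w ∈ stdSimplex ℝ 𝒳)
    (hf : ∀ x, |f x| ≤ d) : |∑ x, w x * f x| ≤ d := by
  calc |∑ x, w x * f x| ≤ ∑ x, w x * |f x| :=
        (Finset.abs_sum_le_sum_abs _ _).trans_eq
          (Finset.sum_congr rfl fun x _ => by rw [abs_mul, abs_of_nonneg (hw.1 x)])
    _ ≤ ∑ x, w x * d := Finset.sum_le_sum fun x _ => mul_le_mul_of_nonneg_left (hf x) (hw.1 x)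
    _ = d := by rw [← Finset.sum_mul, hw.2, one_mul]

section Matrix

variable [DecidableEq 𝒳] {P : Matrix 𝒳 𝒳 ℝ} (hP : P ∈ Matrix.rowStochastic ℝ 𝒳)
include hP

theorem osc_mulVec_le {ε : ℝ} (hε : ∀ x y, ε ≤ P x y) (f : 𝒳 → ℝ) :
    osc (P *ᵥ f) ≤ (1 - ε) * osc f := by
  rcases isEmpty_or_nonempty 𝒳 with h | ⟨⟨m⟩⟩
  · simp [osc, Set.range_eq_empty]
  -- remove the common mass `ε` at `m` from all rows
  have hnonneg : ∀ x y, 0 ≤ P x y - (Pi.single m ε : 𝒳 → ℝ) y := fun x y => by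
    rcases eq_or_ne y m with rfl | hy
    · simpa using hε x y
    · simpa [hy] using Matrix.nonneg_of_mem_rowStochastic hP
  have hsum : ∀ x, ∑ y, (P x y - (Pi.single m ε : 𝒳 → ℝ) y) = 1 - ε := fun x => by
    rw [Finset.sum_sub_distrib, Matrix.sum_row_of_mem_rowStochastic hP]
    simp
  have hε1 : 0 ≤ 1 - ε := hsum m ▸ Finset.sum_nonneg fun y _ => hnonneg m y
  refine osc_le (mul_nonneg hε1 (osc_nonneg f)) fun a b => ?_
  refine le_of_eq_of_le ?_ (abs_sum_sub_sum_le_mul_osc (hnonneg a) (hsum a) (hnonneg b) (hsum b) f)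
  simp only [Matrix.mulVec, dotProduct, sub_mul, Finset.sum_sub_distrib]
  rw [sub_sub_sub_cancel_right]

theorem exists_mem_stdSimplex_vecMul_eq [Nonempty 𝒳] :
    ∃ w ∈ stdSimplex ℝ 𝒳, w ᵥ* P = w := by
  have hdet : (P - 1).det = 0 := Matrix.exists_mulVec_eq_zero_iff.1
    ⟨1, one_ne_zero, by rw [Matrix.sub_mulVec, Matrix.one_vecMul_of_mem_rowStochastic hP,
      Matrix.one_mulVec, sub_self]⟩
  obtain ⟨v, hv, hvP⟩ := Matrix.exists_vecMul_eq_zero_iff.2 hdet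
  rw [Matrix.vecMul_sub, Matrix.vecMul_one, sub_eq_zero] at hvP
  have hle : ∀ y ∈ Finset.univ, |v y| ≤ ∑ x, |v x| * P x y := fun y _ => by
    nth_rw 1 [← hvP]
    refine (Finset.abs_sum_le_sum_abs _ _).trans_eq (Finset.sum_congr rfl fun x _ => ?_)
    rw [abs_mul, abs_of_nonneg (Matrix.nonneg_of_mem_rowStochastic hP)]
  -- summing the inequalities over `y` gives an equality, so each of them is one
  have hsum : ∑ y, |v y| = ∑ y, ∑ x, |v x| * P x y := by
    rw [Finset.sum_comm]
    simp only [← Finset.mul_sum, Matrix.sum_row_of_mem_rowStochastic hP, mul_one]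
  have heq := (Finset.sum_eq_sum_iff_of_le hle).1 hsum
  have hpos : 0 < ∑ x, |v x| := by
    obtain ⟨x, hx⟩ := Function.ne_iff.1 hv
    exact Finset.sum_pos' (fun x _ => abs_nonneg _) ⟨x, Finset.mem_univ x, abs_pos.2 hx⟩
  refine ⟨fun x => |v x| / ∑ x, |v x|, ⟨fun x => by positivity, ?_⟩, funext fun y => ?_⟩
  · rw [← Finset.sum_div, div_self hpos.ne']
  · simp only [Matrix.vecMul, dotProduct, div_mul_eq_mul_div]
    rw [← Finset.sum_div, ← heq y (Finset.mem_univ y)]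

theorem eq_zero_of_vecMul_eq_self (hpos : ∀ x y, 0 < P x y) {v : 𝒳 → ℝ} (hsum : ∑ x, v x = 0)
    (hv : v ᵥ* P = v) : v = 0 := by
  obtain ⟨ε, hε0, -, hε⟩ := exists_pos_lt_one_forall_le
    (F := fun z : 𝒳 × 𝒳 => P z.1 z.2) fun z => hpos z.1 z.2
  have hv' : ∀ y, v y = ∑ x, v x * (P x y - ε) := fun y => by
    simp only [mul_sub, Finset.sum_sub_distrib, ← Finset.sum_mul, hsum, zero_mul, sub_zero]
    exact (congrFun hv y).symm
  have hle : ∑ y, |v y| ≤ (1 - Fintype.card 𝒳 * ε) * ∑ x, |v x| := by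
    calc ∑ y, |v y| ≤ ∑ y, ∑ x, |v x| * (P x y - ε) := by
          refine Finset.sum_le_sum fun y _ => ?_
          nth_rw 1 [hv' y]
          refine (Finset.abs_sum_le_sum_abs _ _).trans_eq (Finset.sum_congr rfl fun x _ => ?_)
          rw [abs_mul, abs_of_nonneg (sub_nonneg.2 (hε (x, y)))]
      _ = (1 - Fintype.card 𝒳 * ε) * ∑ x, |v x| := by
          rw [Finset.sum_comm, Finset.mul_sum]
          refine Finset.sum_congr rfl fun x _ => ?_
          rw [← Finset.mul_sum, Finset.sum_sub_distrib, Matrix.sum_row_of_mem_rowStochastic hP,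
            Finset.sum_const, nsmul_eq_mul, Finset.card_univ, mul_comm]
  funext x
  have hcard : 0 < (Fintype.card 𝒳 : ℝ) * ε :=
    mul_pos (Nat.cast_pos.2 (Fintype.card_pos_iff.2 ⟨x⟩)) hε0
  have hx : |v x| ≤ ∑ x, |v x| :=
    Finset.single_le_sum (f := fun x => |v x|) (fun _ _ => abs_nonneg _) (Finset.mem_univ x)
  exact abs_nonpos_iff.1 (hx.trans (by nlinarith))

theorem eq_of_vecMul_eq_self (hpos : ∀ x y, 0 < P x y) {w w' : 𝒳 → ℝ}
    (hw : w ∈ stdSimplex ℝ 𝒳) (hw' : w' ∈ stdSimplex ℝ 𝒳) (hwP : w ᵥ* P = w)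
    (hwP' : w' ᵥ* P = w') : w = w' :=
  sub_eq_zero.1 <| eq_zero_of_vecMul_eq_self hP hpos
    (by simp only [Pi.sub_apply, Finset.sum_sub_distrib, hw.2, hw'.2, sub_self])
    (by rw [Matrix.sub_vecMul, hwP, hwP'])

end Matrix

variable [MeasurableSpace 𝒳] [MeasurableSingletonClass 𝒳]

theorem real_singleton_mem_stdSimplex (μ : Measure 𝒳) [IsProbabilityMeasure μ] :
    (fun x => μ.real {x}) ∈ stdSimplex ℝ 𝒳 :=
  ⟨fun _ => measureReal_nonneg, by rw [sum_measureReal_singleton]; simp⟩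

theorem exists_measure_real_singleton_eq {w : 𝒳 → ℝ} (hw : w ∈ stdSimplex ℝ 𝒳) :
    ∃ μ : Measure 𝒳, IsProbabilityMeasure μ ∧ ∀ x, μ.real {x} = w x := by
  have hsum : ∑ x, ENNReal.ofReal (w x) = 1 := by
    rw [← ENNReal.ofReal_sum_of_nonneg fun x _ => hw.1 x, hw.2, ENNReal.ofReal_one]
  refine ⟨(PMF.ofFintype _ hsum).toMeasure, inferInstance, fun x => ?_⟩
  rw [Measure.real, PMF.toMeasure_apply_singleton _ _ (measurableSet_singleton x),
    PMF.ofFintype_apply, ENNReal.toReal_ofReal (hw.1 x)]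

theorem existsUnique_isInvariantProb [DecidableEq 𝒳] [Nonempty 𝒳] {P : 𝒳 → 𝒳 → ℝ}
    (hP : Matrix.of P ∈ Matrix.rowStochastic ℝ 𝒳) (hpos : ∀ x y, 0 < P x y) :
    ∃! μ : Measure 𝒳, IsInvariantProb P μ := by
  obtain ⟨w, hw, hwP⟩ := exists_mem_stdSimplex_vecMul_eq hP
  obtain ⟨μ, hμ, hμw⟩ := exists_measure_real_singleton_eq hw
  refine ⟨μ, ⟨hμ, fun y => ?_⟩, fun μ' ⟨hμ', hinv⟩ => ?_⟩
  · simp only [hμw]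
    exact congrFun hwP y
  · refine Measure.ext_of_measureReal_singleton fun x => ?_
    rw [hμw]
    exact congrFun (eq_of_vecMul_eq_self hP hpos (real_singleton_mem_stdSimplex μ') hw
      (funext hinv) hwP) x

end Stochastic

/-! ### The unperturbed process -/

section Semigroup

variable {𝒳 : Type*} [Fintype 𝒳]

theorem hasDerivAt_semigroup (r : 𝒳 → 𝒳 → ℝ) (f : 𝒳 → ℝ) (s : ℝ) :
    HasDerivAt (fun s => semigroup r s f) (generator r (semigroup r s f)) s :=
  ((hasDerivAt_exp_smul_const' (𝕂 := ℝ) (generator r) s).clm_apply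
    (hasDerivAt_const s f)).congr_deriv (by simp [semigroup])

theorem continuous_semigroup (r : 𝒳 → 𝒳 → ℝ) :
    Continuous fun z : ℝ × (𝒳 → ℝ) => semigroup r z.1 z.2 := by
  let _ : NormedAlgebra ℚ ((𝒳 → ℝ) →L[ℝ] (𝒳 → ℝ)) := .restrictScalars ℚ ℝ _
  exact (NormedSpace.exp_continuous.comp (continuous_fst.smul continuous_const)).clm_apply
    continuous_snd

theorem semigroup_zero (r : 𝒳 → 𝒳 → ℝ) (f : 𝒳 → ℝ) : semigroup r 0 f = f := by
  simp [semigroup]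

theorem semigroup_add (r : 𝒳 → 𝒳 → ℝ) (s t : ℝ) (f : 𝒳 → ℝ) :
    semigroup r (s + t) f = semigroup r s (semigroup r t f) := by
  let _ : NormedAlgebra ℚ ((𝒳 → ℝ) →L[ℝ] (𝒳 → ℝ)) := .restrictScalars ℚ ℝ _
  unfold semigroup
  rw [add_smul, NormedSpace.exp_add_of_commute]
  · rfl
  · exact ((Commute.refl (generator r)).smul_left s).smul_right t

theorem generator_sub (A B : 𝒳 → 𝒳 → ℝ) (f : 𝒳 → ℝ) (x : 𝒳) :
    generator (A - B) f x = generator A f x - generator B f x := by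
  simp only [generator_apply, Pi.sub_apply, sub_mul, Finset.sum_sub_distrib]

theorem IsForwardSolution.sum_mul_eq_semigroup_add_integral {q : ℝ → 𝒳 → 𝒳 → ℝ} {C : ℝ}
    {p : ℝ → 𝒳 → ℝ} (hp : IsForwardSolution q p) (hq : IsBoundedRate q C) (r : 𝒳 → 𝒳 → ℝ)
    (f : 𝒳 → ℝ) {t : ℝ} (ht : 0 ≤ t) :
    ∑ x, p t x * f x = ∑ x, p 0 x * semigroup r t f x
      + ∫ u in (0 : ℝ)..t, ∑ x, p u x * generator (q u - r) (semigroup r (t - u) f) x := by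
  have hφ : ∀ s x, HasDerivAt (fun s => semigroup r (t - s) f x)
      (-generator r (semigroup r (t - s) f) x) s := fun s x =>
    (hasDerivAt_pi.1 (hasDerivAt_semigroup r f (t - s)) x).comp_const_sub t s
  have hφ' : ∀ x, Continuous fun s => -generator r (semigroup r (t - s) f) x := fun x =>
    ((continuous_apply x).comp ((generator r).continuous.comp
      ((continuous_semigroup r).comp ((continuous_sub_left t).prodMk continuous_const)))).neg
  have hduhamel := hp.sum_mul_eq_add_integral hq hφ hφ' ht
  simpa only [generator_sub, sub_self, semigroup_zero, sub_zero, ← sub_eq_add_neg] using hduhamel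

end Semigroup

section Rates

open scoped Matrix

theorem perturbedRate_zero {𝒳 : Type*} (r : 𝒳 → 𝒳 → ℝ) (g : ℝ → 𝒳 → 𝒳 → ℝ) :
    perturbedRate r g 0 = fun _ => r := by
  funext s x y
  simp [perturbedRate]

variable {𝒳 : Type*} [Fintype 𝒳]

theorem transProb_mem_rowStochastic [DecidableEq 𝒳] [MeasurableSpace 𝒳]
    [MeasurableSingletonClass 𝒳] (q : ℝ → 𝒳 → 𝒳 → ℝ) (t : ℝ) :
    Matrix.of (transProb q t) ∈ Matrix.rowStochastic ℝ 𝒳 :=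
  Matrix.mem_rowStochastic_iff_sum.2
    ⟨fun _ _ => measureReal_nonneg, fun x => sum_marginal q (Measure.dirac x) t⟩

/-- Irreducible time-independent jump rates. -/
structure IsIrreducibleRate (r : 𝒳 → 𝒳 → ℝ) : Prop where
  nonneg : ∀ x y, 0 ≤ r x y
  diag : ∀ x, r x x = 0
  irred : ∀ x y, Relation.ReflTransGen (fun a b => 0 < r a b) x y

/-- Oscillations decay exponentially, with rate `c`, under the semigroup with jump rates `r`. -/
structure HasOscDecay (r : 𝒳 → 𝒳 → ℝ) (K c : ℝ) : Prop where
  nonneg : 0 ≤ K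
  rate_pos : 0 < c
  osc_semigroup_le : ∀ (f : 𝒳 → ℝ) (t : ℝ), 0 ≤ t →
    osc (semigroup r t f) ≤ K * Real.exp (-(c * t)) * osc f

namespace IsIrreducibleRate

variable {r : 𝒳 → 𝒳 → ℝ} (hr : IsIrreducibleRate r)
include hr

theorem sum_pos [Nontrivial 𝒳] (x : 𝒳) : 0 < ∑ y, r x y := by
  obtain ⟨y, hy⟩ := exists_ne x
  rcases (hr.irred x y).cases_head with h | ⟨z, hz, -⟩
  · exact absurd h.symm hy
  · exact Finset.sum_pos' (fun z _ => hr.nonneg x z) ⟨z, Finset.mem_univ z, hz⟩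

theorem sum_sum_nonneg : 0 ≤ ∑ x, ∑ y, r x y :=
  Finset.sum_nonneg fun x _ => Finset.sum_nonneg fun y _ => hr.nonneg x y

theorem sum_le_sum_sum (x : 𝒳) : ∑ y, r x y ≤ ∑ x, ∑ y, r x y :=
  Finset.single_le_sum (f := fun x => ∑ y, r x y)
    (fun x _ => Finset.sum_nonneg fun y _ => hr.nonneg x y) (Finset.mem_univ x)

theorem isAdmissible_perturbedRate {g : ℝ → 𝒳 → 𝒳 → ℝ} {G : ℝ}
    (hg : ∀ x y, Measurable fun s => g s x y) (hG : ∀ s x y, |g s x y| ≤ G) (lam : ℝ) :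
    IsAdmissible (perturbedRate r g lam) (Real.exp (|lam| * G) * ∑ x, ∑ y, r x y) := by
  have hlam : ∀ s x y, |lam * g s x y| ≤ |lam| * G := fun s x y => by
    rw [abs_mul]
    exact mul_le_mul_of_nonneg_left (hG s x y) (abs_nonneg _)
  refine
    { measurable := fun x y =>
        (Real.measurable_exp.comp ((hg x y).const_mul lam)).mul_const (r x y)
      nonneg := fun s x y => mul_nonneg (Real.exp_pos _).le (hr.nonneg x y)
      exitRate_le := fun s x => ?_
      diag := fun s x => by simp [perturbedRate, hr.diag]
      exists_le_exitRate := fun _ => ?_ }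
  · calc exitRate (perturbedRate r g lam) s x ≤ ∑ y, Real.exp (|lam| * G) * r x y :=
          Finset.sum_le_sum fun y _ => mul_le_mul_of_nonneg_right
            (Real.exp_le_exp.2 ((le_abs_self _).trans (hlam s x y))) (hr.nonneg x y)
      _ ≤ Real.exp (|lam| * G) * ∑ x, ∑ y, r x y := by
          rw [← Finset.mul_sum]
          exact mul_le_mul_of_nonneg_left (hr.sum_le_sum_sum x) (Real.exp_pos _).le
  · obtain ⟨ε, hε0, -, hε⟩ := exists_pos_lt_one_forall_le hr.sum_pos
    refine ⟨Real.exp (-(|lam| * G)) * ε, by positivity, fun s x => ?_⟩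
    calc Real.exp (-(|lam| * G)) * ε ≤ ∑ y, Real.exp (-(|lam| * G)) * r x y := by
          rw [← Finset.mul_sum]
          exact mul_le_mul_of_nonneg_left (hε x) (Real.exp_pos _).le
      _ ≤ exitRate (perturbedRate r g lam) s x :=
          Finset.sum_le_sum fun y _ => mul_le_mul_of_nonneg_right
            (Real.exp_le_exp.2 (neg_le_of_abs_le (hlam s x y))) (hr.nonneg x y)

theorem exists_isAdmissible : ∃ C, IsAdmissible (fun _ => r) C := by
  have hq := hr.isAdmissible_perturbedRate (g := fun _ _ _ => 0) (G := 0)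
    (fun _ _ => measurable_const) (fun _ _ _ => abs_zero.le) 0
  rw [perturbedRate_zero] at hq
  exact ⟨_, hq⟩

variable [MeasurableSpace 𝒳] [MeasurableSingletonClass 𝒳]

theorem transProb_perturbedRate_pos {g : ℝ → 𝒳 → 𝒳 → ℝ} {G : ℝ}
    (hg : ∀ x y, Measurable fun s => g s x y) (hG : ∀ s x y, |g s x y| ≤ G) (lam : ℝ)
    {t : ℝ} (ht : 0 < t) (x y : 𝒳) : 0 < transProb (perturbedRate r g lam) t x y := by
  have hq := hr.isAdmissible_perturbedRate hg hG lam
  refine (hq.isForwardSolution (Measure.dirac x)).pos_of_reflTransGen hq.toIsBoundedRate (x := x)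
    ?_ ?_ t ht
  · exact Relation.ReflTransGen.mono (fun a b hab s => mul_pos (Real.exp_pos _) hab) x y
      (hr.irred x y)
  · rw [hq.marginal_zero (Measure.dirac x)]
    simp [Measure.real]

theorem transProb_pos {t : ℝ} (ht : 0 < t) (x y : 𝒳) : 0 < transProb (fun _ => r) t x y := by
  have hpos := hr.transProb_perturbedRate_pos (g := fun _ _ _ => 0) (G := 0)
    (fun _ _ => measurable_const) (fun _ _ _ => abs_zero.le) 0 ht x y
  rwa [perturbedRate_zero] at hpos

theorem sum_marginal_mul (ν : Measure 𝒳) [IsProbabilityMeasure ν] {t : ℝ} (ht : 0 ≤ t)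
    (f : 𝒳 → ℝ) :
    ∑ x, marginal (fun _ => r) ν t x * f x = ∑ x, ν.real {x} * semigroup r t f x := by
  obtain ⟨C, hq⟩ := hr.exists_isAdmissible
  rw [(hq.isForwardSolution ν).sum_mul_eq_semigroup_add_integral hq.toIsBoundedRate r f ht]
  simp [hq.marginal_zero ν, generator_apply]

theorem transProb_mulVec {t : ℝ} (ht : 0 ≤ t) (f : 𝒳 → ℝ) :
    Matrix.of (transProb (fun _ => r) t) *ᵥ f = semigroup r t f := by
  classical
  funext x
  refine (hr.sum_marginal_mul (Measure.dirac x) ht f).trans ?_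
  rw [Finset.sum_eq_single x]
  · simp [Measure.real]
  · intro y _ hyx
    simp [Measure.real, hyx.symm]
  · simp

theorem transProb_mul_comm {s t : ℝ} (hs : 0 ≤ s) (ht : 0 ≤ t) :
    Matrix.of (transProb (fun _ => r) s) * Matrix.of (transProb (fun _ => r) t)
      = Matrix.of (transProb (fun _ => r) t) * Matrix.of (transProb (fun _ => r) s) := by
  classical
  refine Matrix.ext_of_mulVec_single fun y => ?_
  simp only [← Matrix.mulVec_mulVec, hr.transProb_mulVec hs, hr.transProb_mulVec ht,
    ← semigroup_add, add_comm s]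

theorem osc_semigroup_le_mul {t ε : ℝ} (ht : 0 ≤ t)
    (hε : ∀ x y, ε ≤ transProb (fun _ => r) t x y) (f : 𝒳 → ℝ) :
    osc (semigroup r t f) ≤ (1 - ε) * osc f := by
  classical
  rw [← hr.transProb_mulVec ht]
  exact osc_mulVec_le (transProb_mem_rowStochastic _ t) hε f

theorem osc_semigroup_le {t : ℝ} (ht : 0 ≤ t) (f : 𝒳 → ℝ) : osc (semigroup r t f) ≤ osc f := by
  simpa using hr.osc_semigroup_le_mul ht (ε := 0) (fun _ _ => measureReal_nonneg) f

theorem osc_semigroup_natCast_le {ε : ℝ} (hε1 : ε ≤ 1)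
    (hε : ∀ x y, ε ≤ transProb (fun _ => r) 1 x y) (n : ℕ) (f : 𝒳 → ℝ) :
    osc (semigroup r n f) ≤ (1 - ε) ^ n * osc f := by
  induction n with
  | zero => simp [semigroup_zero]
  | succ n ih =>
    rw [Nat.cast_succ, add_comm, semigroup_add, pow_succ', mul_assoc]
    exact (hr.osc_semigroup_le_mul zero_le_one hε _).trans
      (mul_le_mul_of_nonneg_left ih (sub_nonneg.2 hε1))

theorem exists_hasOscDecay : ∃ K c, HasOscDecay r K c := by
  obtain ⟨ε, hε0, hε1, hε⟩ := exists_pos_lt_one_forall_le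
    (F := fun z : 𝒳 × 𝒳 => transProb (fun _ => r) 1 z.1 z.2)
    fun z => hr.transProb_pos one_pos z.1 z.2
  have hlog : Real.log (1 - ε) < 0 := Real.log_neg (by linarith) (by linarith)
  refine ⟨Real.exp (-Real.log (1 - ε)), -Real.log (1 - ε), (Real.exp_pos _).le, neg_pos.2 hlog,
    fun f t ht => ?_⟩
  calc osc (semigroup r t f)
      = osc (semigroup r (t - ⌊t⌋₊) (semigroup r ⌊t⌋₊ f)) := by rw [← semigroup_add, sub_add_cancel]
    _ ≤ osc (semigroup r ⌊t⌋₊ f) := hr.osc_semigroup_le (sub_nonneg.2 (Nat.floor_le ht)) _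
    _ ≤ (1 - ε) ^ ⌊t⌋₊ * osc f :=
        hr.osc_semigroup_natCast_le hε1.le (fun x y => hε (x, y)) _ f
    _ ≤ Real.exp (-Real.log (1 - ε)) * Real.exp (-(-Real.log (1 - ε) * t)) * osc f := by
        refine mul_le_mul_of_nonneg_right ?_ (osc_nonneg f)
        rw [← Real.exp_add, ← Real.exp_log (sub_pos.2 hε1), ← Real.exp_nat_mul, Real.exp_le_exp,
          Real.log_exp]
        nlinarith [Nat.lt_floor_add_one t]

theorem existsUnique_isInvariantDistribution [Nonempty 𝒳] :
    ∃! π : Measure 𝒳, IsInvariantDistribution r π := by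
  classical
  have hP : ∀ t, Matrix.of (transProb (fun _ => r) t) ∈ Matrix.rowStochastic ℝ 𝒳 :=
    transProb_mem_rowStochastic _
  have hpos : ∀ x y, 0 < transProb (fun _ => r) 1 x y := fun x y => hr.transProb_pos one_pos x y
  obtain ⟨π, ⟨hπ, hinv⟩, huniq⟩ := existsUnique_isInvariantProb (hP 1) hpos
  refine ⟨π, fun t ht => ⟨hπ, congrFun ?_⟩, fun μ hμ => huniq μ (hμ 1 zero_le_one)⟩
  have hπ1 : (fun x => π.real {x}) ᵥ* Matrix.of (transProb (fun _ => r) 1)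
      = fun x => π.real {x} := funext hinv
  change (fun x => π.real {x}) ᵥ* Matrix.of (transProb (fun _ => r) t) = _
  have hmarginal : marginal (fun _ => r) π t
      = (fun x => π.real {x}) ᵥ* Matrix.of (transProb (fun _ => r) t) :=
    funext (marginal_eq_sum _ π t)
  have hmem : (fun x => π.real {x}) ᵥ* Matrix.of (transProb (fun _ => r) t) ∈ stdSimplex ℝ 𝒳 :=
    hmarginal ▸ ⟨marginal_nonneg _ π t, sum_marginal _ π t⟩
  -- `π P_t` is invariant for `P_1`, since the two matrices commute
  refine eq_of_vecMul_eq_self (hP 1) hpos hmem (real_singleton_mem_stdSimplex π) ?_ hπ1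
  rw [Matrix.vecMul_vecMul, hr.transProb_mul_comm ht zero_le_one, ← Matrix.vecMul_vecMul, hπ1]

end IsIrreducibleRate

namespace IsInvariantDistribution

variable [MeasurableSpace 𝒳] {r : 𝒳 → 𝒳 → ℝ} {π : Measure 𝒳} (hπ : IsInvariantDistribution r π)
include hπ

theorem isProbabilityMeasure : IsProbabilityMeasure π := (hπ 0 le_rfl).1

variable [MeasurableSingletonClass 𝒳]

theorem marginal_eq {t : ℝ} (ht : 0 ≤ t) (x : 𝒳) : marginal (fun _ => r) π t x = π.real {x} := by
  have := hπ.isProbabilityMeasure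
  rw [marginal_eq_sum]
  exact (hπ t ht).2 x

variable (hr : IsIrreducibleRate r)
include hr

theorem sum_mul_semigroup {t : ℝ} (ht : 0 ≤ t) (f : 𝒳 → ℝ) :
    ∑ x, π.real {x} * semigroup r t f x = ∑ x, π.real {x} * f x := by
  have := hπ.isProbabilityMeasure
  rw [← hr.sum_marginal_mul π ht]
  simp only [hπ.marginal_eq ht]

theorem real_singleton_pos (x : 𝒳) : 0 < π.real {x} := by
  have := hπ.isProbabilityMeasure
  obtain ⟨z, -, hz⟩ := Finset.exists_ne_zero_of_sum_ne_zero
    ((real_singleton_mem_stdSimplex π).2.trans_ne one_ne_zero)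
  rw [← (hπ 1 zero_le_one).2 x]
  exact Finset.sum_pos' (fun z _ => mul_nonneg measureReal_nonneg measureReal_nonneg)
    ⟨z, Finset.mem_univ z, mul_pos (measureReal_nonneg.lt_of_ne' hz) (hr.transProb_pos one_pos z x)⟩

end IsInvariantDistribution

end Rates

/-! ### Periodic solutions -/

section Periodic

variable {𝒳 : Type*} [Fintype 𝒳]

theorem IsForwardSolution.exists_periodic_extension {q : ℝ → 𝒳 → 𝒳 → ℝ} {C T : ℝ}
    {p : ℝ → 𝒳 → ℝ} (hp : IsForwardSolution q p) (hq : IsBoundedRate q C) (hT : 0 < T)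
    (hper : ∀ x y, Function.Periodic (fun s => q s x y) T) (h0 : p T = p 0) :
    ∃ p', IsForwardSolution q p' ∧ Function.Periodic p' T ∧ ∀ t, 0 ≤ t → p' t = p t := by
  have heq : ∀ t, 0 ≤ t → p (toIcoMod hT 0 t) = p t := fun t ht => by
    have hfract : toIcoMod hT 0 t + ⌊t / T⌋₊ * T = t := by
      rw [toIcoMod_eq_fract_mul, ← add_mul, natCast_floor_eq_intCast_floor (by positivity),
        Int.fract_add_floor, div_mul_cancel₀ t hT.ne']
    rw [← hp.eq_add_nat_mul hq hT.le hper h0 ⌊t / T⌋₊ (left_le_toIcoMod hT 0 t), hfract]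
  refine ⟨fun s => p (toIcoMod hT 0 s), ⟨fun x => ?_, fun s => hp.mem_stdSimplex _,
    fun z t ht => ?_⟩, fun s => congrArg p (toIcoMod_periodic hT 0 s), heq⟩
  · simp only [toIcoMod_eq_fract_mul]
    exact (hp.measurable x).comp ((measurable_fract.comp (measurable_id.div_const T)).mul_const T)
  · rw [heq t ht, heq 0 le_rfl, hp.eq_add_integral z t ht]
    congr 1
    refine intervalIntegral.integral_congr fun u hu => ?_
    rw [Set.uIcc_of_le ht] at hu
    simp only [heq u hu.1]

theorem abs_generator_le (A : 𝒳 → 𝒳 → ℝ) {B : ℝ} (hA : ∀ x, ∑ y, |A x y| ≤ B) (h : 𝒳 → ℝ)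
    (x : 𝒳) : |generator A h x| ≤ B * osc h :=
  calc |generator A h x| ≤ ∑ y, |A x y| * |h y - h x| :=
        (Finset.abs_sum_le_sum_abs _ _).trans_eq (by simp only [abs_mul])
    _ ≤ ∑ y, |A x y| * osc h := Finset.sum_le_sum fun y _ =>
        mul_le_mul_of_nonneg_left (abs_sub_le_osc h y x) (abs_nonneg _)
    _ ≤ B * osc h := by
        rw [← Finset.sum_mul]
        exact mul_le_mul_of_nonneg_right (hA x) (osc_nonneg h)

theorem abs_setIntegral_Ioi_le_div {F : ℝ → ℝ} {c D : ℝ} (hc : 0 < c)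
    (hF : ∀ s, 0 < s → |F s| ≤ D * Real.exp (-c * s)) : |∫ s in Set.Ioi 0, F s| ≤ D / c := by
  have hint := (exp_neg_integrableOn_Ioi 0 hc).const_mul D
  refine (norm_integral_le_of_norm_le (f := F) hint ?_).trans_eq ?_
  · filter_upwards [ae_restrict_mem measurableSet_Ioi] with s hs using hF s hs
  · rw [integral_const_mul, integral_exp_mul_Ioi (neg_neg_of_pos hc)]
    simp [div_eq_mul_inv]

section Decay

variable {r : 𝒳 → 𝒳 → ℝ} {K c : ℝ} (hdec : HasOscDecay r K c)
include hdec

theorem HasOscDecay.abs_sum_mul_generator_semigroup_le {w : 𝒳 → ℝ} (hw : w ∈ stdSimplex ℝ 𝒳)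
    {A : 𝒳 → 𝒳 → ℝ} {B : ℝ} (hA : ∀ x, ∑ y, |A x y| ≤ B) (f : 𝒳 → ℝ) {s : ℝ} (hs : 0 ≤ s) :
    |∑ x, w x * generator A (semigroup r s f) x| ≤ B * K * osc f * Real.exp (-c * s) := by
  refine abs_sum_mul_le_of_mem_stdSimplex hw fun x => ?_
  have hB : 0 ≤ B := (Finset.sum_nonneg fun y _ => abs_nonneg _).trans (hA x)
  refine ((abs_generator_le A hA _ x).trans
    (mul_le_mul_of_nonneg_left (hdec.osc_semigroup_le f s hs) hB)).trans_eq ?_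
  ring_nf

theorem HasOscDecay.integrableOn_sum_mul_generator_semigroup {w : ℝ → 𝒳 → ℝ}
    (hwm : ∀ x, Measurable fun s => w s x) (hw : ∀ s, w s ∈ stdSimplex ℝ 𝒳)
    {A : ℝ → 𝒳 → 𝒳 → ℝ} (hAm : ∀ x y, Measurable fun s => A s x y) {B : ℝ}
    (hA : ∀ s x, ∑ y, |A s x y| ≤ B) (f : 𝒳 → ℝ) (t : ℝ) :
    IntegrableOn (fun s => ∑ x, w (t - s) x * generator (A (t - s)) (semigroup r s f) x)
      (Set.Ioi 0) := by
  refine Integrable.mono' ((exp_neg_integrableOn_Ioi 0 hdec.rate_pos).const_mul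
    (B * K * osc f)) (Measurable.aestronglyMeasurable ?_) ?_
  · have hsub : Measurable fun s => t - s := measurable_const.sub measurable_id
    have hsem : ∀ x, Measurable fun s => semigroup r s f x := fun x => ((continuous_apply x).comp
      ((continuous_semigroup r).comp (continuous_id.prodMk continuous_const))).measurable
    exact Finset.measurable_sum _ fun x _ => ((hwm x).comp hsub).mul <|
      Finset.measurable_sum _ fun y _ => ((hAm x y).comp hsub).mul ((hsem y).sub (hsem x))
  · filter_upwards [ae_restrict_mem measurableSet_Ioi] with s hs
    exact hdec.abs_sum_mul_generator_semigroup_le (hw _) (hA _) f (le_of_lt hs)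

variable [MeasurableSpace 𝒳] [MeasurableSingletonClass 𝒳] {π : Measure 𝒳}
  (hr : IsIrreducibleRate r) (hπ : IsInvariantDistribution r π)
include hr hπ

theorem HasOscDecay.tendsto_sum_mul_semigroup {w : 𝒳 → ℝ} (hw : w ∈ stdSimplex ℝ 𝒳)
    (f : 𝒳 → ℝ) :
    Tendsto (fun t => ∑ x, w x * semigroup r t f x) atTop (𝓝 (∑ x, π.real {x} * f x)) := by
  have := hπ.isProbabilityMeasure
  have hw' := real_singleton_mem_stdSimplex π
  have hexp : Tendsto (fun t => K * Real.exp (-(c * t)) * osc f) atTop (𝓝 0) := by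
    simpa using ((Real.tendsto_exp_neg_atTop_nhds_zero.comp
      (tendsto_id.const_mul_atTop hdec.rate_pos)).const_mul K).mul_const (osc f)
  refine tendsto_iff_norm_sub_tendsto_zero.2 (squeeze_zero' (.of_forall fun t => norm_nonneg _)
    ?_ hexp)
  filter_upwards [eventually_ge_atTop 0] with t ht
  rw [← hπ.sum_mul_semigroup hr ht]
  refine (abs_sum_sub_sum_le_mul_osc hw.1 hw.2 hw'.1 hw'.2 _).trans ?_
  rw [one_mul]
  exact hdec.osc_semigroup_le f t ht

variable {q : ℝ → 𝒳 → 𝒳 → ℝ} {C T B : ℝ} {p : ℝ → 𝒳 → ℝ} (hp : IsForwardSolution q p)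
  (hq : IsBoundedRate q C) (hT : 0 < T) (hqper : ∀ x y, Function.Periodic (fun s => q s x y) T)
  (hper : Function.Periodic p T) (hB : ∀ s x, ∑ y, |q s x y - r x y| ≤ B)
include hp hq hT hqper hper hB

theorem IsForwardSolution.sum_mul_eq_sum_mul_add_integral_Ioi (f : 𝒳 → ℝ) (t : ℝ) :
    ∑ x, p t x * f x = ∑ x, π.real {x} * f x
      + ∫ s in Set.Ioi 0, ∑ x, p (t - s) x * generator (q (t - s) - r) (semigroup r s f) x := by
  set Φ : ℝ → ℝ := fun s => ∑ x, p (t - s) x * generator (q (t - s) - r) (semigroup r s f) x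
  have hS : Tendsto (fun n : ℕ => t + n * T) atTop atTop :=
    tendsto_atTop_add_const_left _ t (tendsto_natCast_atTop_atTop.atTop_mul_const hT)
  have hΦ : IntegrableOn Φ (Set.Ioi 0) :=
    hdec.integrableOn_sum_mul_generator_semigroup hp.measurable hp.mem_stdSimplex
      (A := fun s => q s - r) (fun x y => (hq.measurable x y).sub_const _) hB f t
  refine tendsto_nhds_unique_of_eventuallyEq tendsto_const_nhds
    (((hdec.tendsto_sum_mul_semigroup hr hπ (hp.mem_stdSimplex 0) f).comp hS).add
      (intervalIntegral_tendsto_integral_Ioi 0 hΦ hS)) ?_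
  -- Duhamel's formula on `[0, t + nT]`, where the solution has returned to `p t`
  filter_upwards [hS.eventually_ge_atTop 0] with n hn
  have hqn : ∀ u, q (u - n * T) = q u := fun u => by
    funext x y
    exact (hqper x y).sub_nat_mul_eq n
  have hsubst := intervalIntegral.integral_comp_sub_left (a := 0) (b := t + n * T) Φ (t + n * T)
  rw [sub_self, sub_zero] at hsubst
  have hduhamel := hp.sum_mul_eq_semigroup_add_integral hq r f hn
  rw [hper.nat_mul n t] at hduhamel
  rw [hduhamel, Function.comp_apply, ← hsubst]
  simp only [Φ]
  congr 2
  funext u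
  rw [show t - (t + n * T - u) = u - n * T by ring, hper.sub_nat_mul_eq, hqn]

theorem IsForwardSolution.abs_sum_mul_sub_sum_mul_le (f : 𝒳 → ℝ) (t : ℝ) :
    |∑ x, p t x * f x - ∑ x, π.real {x} * f x| ≤ B * K / c * osc f := by
  rw [hp.sum_mul_eq_sum_mul_add_integral_Ioi hdec hr hπ hq hT hqper hper hB, add_sub_cancel_left,
    div_mul_eq_mul_div]
  exact abs_setIntegral_Ioi_le_div hdec.rate_pos fun s hs =>
    hdec.abs_sum_mul_generator_semigroup_le (hp.mem_stdSimplex _) (hB _) f hs.le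

variable {A : ℝ → 𝒳 → 𝒳 → ℝ} {B' : ℝ}
  (hA : ∀ s x, ∑ y, |q s x y - r x y - A s x y| ≤ B')
include hA

theorem IsForwardSolution.abs_sum_mul_generator_sub_le (h : 𝒳 → ℝ) (s : ℝ) :
    |∑ x, p s x * generator (q s - r) h x - ∑ x, π.real {x} * generator (A s) h x|
      ≤ (2 * B ^ 2 * K / c + B') * osc h := by
  have := hπ.isProbabilityMeasure
  obtain ⟨x₀⟩ := nonempty_of_isProbabilityMeasure π
  have hB0 : 0 ≤ B := (Finset.sum_nonneg fun y _ => abs_nonneg _).trans (hB s x₀)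
  have hosc : osc (generator (q s - r) h) ≤ 2 * (B * osc h) :=
    osc_le_two_mul (mul_nonneg hB0 (osc_nonneg h)) (abs_generator_le _ (hB s) h)
  have hrest : |∑ x, π.real {x} * generator (q s - r - A s) h x| ≤ B' * osc h :=
    abs_sum_mul_le_of_mem_stdSimplex (real_singleton_mem_stdSimplex π)
      (abs_generator_le _ (hA s) h)
  simp only [generator_sub _ (A s), mul_sub, Finset.sum_sub_distrib] at hrest
  calc _ ≤ B * K / c * osc (generator (q s - r) h) + B' * osc h :=
        (abs_sub_le _ _ _).trans (add_le_add
          (hp.abs_sum_mul_sub_sum_mul_le hdec hr hπ hq hT hqper hper hB _ s) hrest)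
    _ ≤ B * K / c * (2 * (B * osc h)) + B' * osc h := by
        have := hdec.nonneg
        have := hdec.rate_pos
        gcongr
    _ = (2 * B ^ 2 * K / c + B') * osc h := by ring

theorem IsForwardSolution.abs_sum_mul_sub_sum_mul_sub_integral_Ioi_le
    (hAm : ∀ x y, Measurable fun s => A s x y) {B₁ : ℝ} (hB₁ : ∀ s x, ∑ y, |A s x y| ≤ B₁)
    (f : 𝒳 → ℝ) (t : ℝ) :
    |∑ x, p t x * f x - ∑ x, π.real {x} * f x
        - ∫ s in Set.Ioi 0, ∑ x, π.real {x} * generator (A (t - s)) (semigroup r s f) x|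
      ≤ (2 * B ^ 2 * K / c + B') * K / c * osc f := by
  have := hπ.isProbabilityMeasure
  obtain ⟨x₀⟩ := nonempty_of_isProbabilityMeasure π
  have hB' : 0 ≤ B' := (Finset.sum_nonneg fun y _ => abs_nonneg _).trans (hA 0 x₀)
  have hK := hdec.nonneg
  have hc := hdec.rate_pos
  rw [hp.sum_mul_eq_sum_mul_add_integral_Ioi hdec hr hπ hq hT hqper hper hB, add_sub_cancel_left,
    ← integral_sub
      (hdec.integrableOn_sum_mul_generator_semigroup hp.measurable hp.mem_stdSimplex
        (A := fun s => q s - r) (fun x y => (hq.measurable x y).sub_const _) hB f t)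
      (hdec.integrableOn_sum_mul_generator_semigroup (w := fun _ x => π.real {x})
        (fun _ => measurable_const) (fun _ => real_singleton_mem_stdSimplex π) hAm hB₁ f t),
    div_mul_eq_mul_div]
  refine abs_setIntegral_Ioi_le_div hc fun s hs => ?_
  refine (hp.abs_sum_mul_generator_sub_le hdec hr hπ hq hT hqper hper hB hA _ _).trans ?_
  calc _ ≤ (2 * B ^ 2 * K / c + B') * (K * Real.exp (-(c * s)) * osc f) :=
        mul_le_mul_of_nonneg_left (hdec.osc_semigroup_le f s hs.le) (by positivity)
    _ = _ := by ring_nf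

end Decay

end Periodic

/-! ### Linear response of the oscillatory steady state -/

section Response

variable {𝒳 : Type*}

/-- Time-periodic, measurable and bounded perturbations of the jump rates. -/
structure IsPeriodicPerturbation (g : ℝ → 𝒳 → 𝒳 → ℝ) (T G : ℝ) : Prop where
  measurable : ∀ x y, Measurable fun s => g s x y
  abs_le : ∀ s x y, |g s x y| ≤ G
  periodic : ∀ x y, Function.Periodic (fun s => g s x y) T

section Pointwise

variable {g : ℝ → 𝒳 → 𝒳 → ℝ} {T G : ℝ} (hg : IsPeriodicPerturbation g T G)
include hg

theorem IsPeriodicPerturbation.periodic_perturbedRate (r : 𝒳 → 𝒳 → ℝ) (lam : ℝ) (x y : 𝒳) :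
    Function.Periodic (fun s => perturbedRate r g lam s x y) T := fun s => by
  have hgs : g (s + T) x y = g s x y := hg.periodic x y s
  simp only [perturbedRate, hgs]

theorem IsPeriodicPerturbation.abs_mul_le (lam s : ℝ) (x y : 𝒳) :
    |lam * g s x y| ≤ |lam| * G := by
  rw [abs_mul]
  exact mul_le_mul_of_nonneg_left (hg.abs_le s x y) (abs_nonneg _)

theorem IsPeriodicPerturbation.abs_exp_sub_one_le {lam : ℝ} (hlam : |lam| * G ≤ 1) (s : ℝ)
    (x y : 𝒳) : |Real.exp (lam * g s x y) - 1| ≤ 2 * (|lam| * G) :=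
  (Real.abs_exp_sub_one_le ((hg.abs_mul_le lam s x y).trans hlam)).trans
    (mul_le_mul_of_nonneg_left (hg.abs_mul_le lam s x y) zero_le_two)

theorem IsPeriodicPerturbation.abs_exp_sub_one_sub_le {lam : ℝ} (hlam : |lam| * G ≤ 1) (s : ℝ)
    (x y : 𝒳) : |Real.exp (lam * g s x y) - 1 - lam * g s x y| ≤ (|lam| * G) ^ 2 := by
  refine (Real.abs_exp_sub_one_sub_id_le ((hg.abs_mul_le lam s x y).trans hlam)).trans ?_
  rw [← sq_abs (lam * g s x y)]
  exact pow_le_pow_left₀ (abs_nonneg _) (hg.abs_mul_le lam s x y) 2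

end Pointwise

variable [Fintype 𝒳] {r : 𝒳 → 𝒳 → ℝ} {g : ℝ → 𝒳 → 𝒳 → ℝ} {T G : ℝ}

theorem IsIrreducibleRate.sum_abs_mul_le (hr : IsIrreducibleRate r) {e : 𝒳 → 𝒳 → ℝ} {E : ℝ}
    (he : ∀ x y, |e x y| ≤ E) (x : 𝒳) : ∑ y, |e x y * r x y| ≤ E * ∑ x, ∑ y, r x y := by
  calc ∑ y, |e x y * r x y| ≤ ∑ y, E * r x y := Finset.sum_le_sum fun y _ => by
        rw [abs_mul, abs_of_nonneg (hr.nonneg x y)]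
        exact mul_le_mul_of_nonneg_right (he x y) (hr.nonneg x y)
    _ ≤ E * ∑ x, ∑ y, r x y := by
        rw [← Finset.mul_sum]
        exact mul_le_mul_of_nonneg_left (hr.sum_le_sum_sum x) ((abs_nonneg _).trans (he x x))

variable [MeasurableSpace 𝒳]

/-- The linear response `∫_0^∞ ⟨e^{s𝓛}f, ψ_{t-s}⟩ ds` of the expectation of `f` at time `t`. -/
noncomputable def response (r : 𝒳 → 𝒳 → ℝ) (π : Measure 𝒳) (g : ℝ → 𝒳 → 𝒳 → ℝ) (t : ℝ)
    (f : 𝒳 → ℝ) : ℝ :=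
  ∫ s in Set.Ioi (0 : ℝ), scalarProd π (semigroup r s f) (psi r π g (t - s))

variable {π : Measure 𝒳}

theorem scalarProd_psi (hπ : ∀ x, 0 < π.real {x}) (h : 𝒳 → ℝ) (s : ℝ) :
    scalarProd π h (psi r π g s)
      = ∑ x, π.real {x} * generator (fun x y => g s x y * r x y) h x := by
  simp only [scalarProd, psi, reversedRate, generator_apply, mul_sub, Finset.sum_sub_distrib,
    Finset.mul_sum]
  congr 1
  · rw [Finset.sum_comm]
    refine Finset.sum_congr rfl fun x _ => Finset.sum_congr rfl fun y _ => ?_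
    have := (hπ y).ne'
    field_simp
  · refine Finset.sum_congr rfl fun x _ => Finset.sum_congr rfl fun y _ => ?_
    ring

theorem IsPeriodicPerturbation.measurable_response (hg : IsPeriodicPerturbation g T G)
    {v : ℝ → 𝒳 → ℝ} (hv : ∀ x, Measurable fun s => v s x) :
    Measurable fun t => response r π g t (v t) := by
  have hsem : Measurable fun z : ℝ × ℝ => semigroup r z.2 (v z.1) :=
    (continuous_semigroup r).measurable.comp
      (measurable_snd.prodMk ((measurable_pi_iff.2 hv).comp measurable_fst))
  have hpsi : ∀ x, Measurable fun s => psi r π g s x := fun x =>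
    Finset.measurable_sum _ fun y _ =>
      ((hg.measurable y x).const_mul _).sub ((hg.measurable x y).const_mul _)
  have hint : Measurable fun z : ℝ × ℝ =>
      scalarProd π (semigroup r z.2 (v z.1)) (psi r π g (z.1 - z.2)) :=
    Finset.measurable_sum _ fun x _ => (((measurable_pi_apply x).comp hsem).mul
      ((hpsi x).comp (measurable_fst.sub measurable_snd))).const_mul _
  exact (hint.stronglyMeasurable.integral_prod_right'
    (ν := volume.restrict (Set.Ioi 0))).measurable

variable [MeasurableSingletonClass 𝒳] (hr : IsIrreducibleRate r)
  (hπ : IsInvariantDistribution r π) (hg : IsPeriodicPerturbation g T G)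
include hr hg

theorem IsOSS.exists_isForwardSolution (hT : 0 < T) {lam : ℝ} {μ : Measure 𝒳}
    (hμ : IsOSS r g T lam μ) :
    ∃ p, IsForwardSolution (perturbedRate r g lam) p ∧ Function.Periodic p T ∧
      ∀ t, 0 ≤ t → p t = marginal (perturbedRate r g lam) μ t := by
  have := hμ.1
  have hq := hr.isAdmissible_perturbedRate hg.measurable hg.abs_le lam
  refine (hq.isForwardSolution μ).exists_periodic_extension hq.toIsBoundedRate hT
    (hg.periodic_perturbedRate r lam) ?_
  funext y
  rw [hq.marginal_zero μ, marginal_eq_sum]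
  exact hμ.2 y

theorem existsUnique_isOSS [Nonempty 𝒳] (hT : 0 < T) (lam : ℝ) :
    ∃! μ : Measure 𝒳, IsOSS r g T lam μ := by
  classical
  exact existsUnique_isInvariantProb (transProb_mem_rowStochastic _ T) fun x y =>
    hr.transProb_perturbedRate_pos hg.measurable hg.abs_le lam hT x y

include hπ

theorem integrableOn_response (t : ℝ) (f : 𝒳 → ℝ) :
    IntegrableOn (fun s => scalarProd π (semigroup r s f) (psi r π g (t - s))) (Set.Ioi 0) := by
  have := hπ.isProbabilityMeasure
  have := nonempty_of_isProbabilityMeasure π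
  obtain ⟨K, c, hdec⟩ := hr.exists_hasOscDecay
  simp only [scalarProd_psi (hπ.real_singleton_pos hr)]
  exact hdec.integrableOn_sum_mul_generator_semigroup (w := fun _ x => π.real {x})
    (A := fun s x y => g s x y * r x y) (fun _ => measurable_const)
    (fun _ => real_singleton_mem_stdSimplex π) (fun x y => (hg.measurable x y).mul_const _)
    (fun s => hr.sum_abs_mul_le (hg.abs_le s)) f t

theorem exists_abs_response_le :
    ∃ B, ∀ t f, |response r π g t f| ≤ B * ∑ x, |f x| := by
  have := hπ.isProbabilityMeasure
  obtain ⟨x₀⟩ := nonempty_of_isProbabilityMeasure π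
  obtain ⟨K, c, hdec⟩ := hr.exists_hasOscDecay
  have hG : 0 ≤ G := (abs_nonneg _).trans (hg.abs_le 0 x₀ x₀)
  have hR := hr.sum_sum_nonneg
  have hK := hdec.nonneg
  have hc := hdec.rate_pos
  refine ⟨G * (∑ x, ∑ y, r x y) * K / c * 2, fun t f => ?_⟩
  calc |response r π g t f| ≤ G * (∑ x, ∑ y, r x y) * K * osc f / c :=
        abs_setIntegral_Ioi_le_div hc fun s hs => by
          rw [scalarProd_psi (hπ.real_singleton_pos hr)]
          exact hdec.abs_sum_mul_generator_semigroup_le (real_singleton_mem_stdSimplex π)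
            (hr.sum_abs_mul_le (hg.abs_le _)) f hs.le
    _ = G * (∑ x, ∑ y, r x y) * K / c * osc f := by ring
    _ ≤ G * (∑ x, ∑ y, r x y) * K / c * (2 * ∑ x, |f x|) := by
        gcongr
        exact osc_le_two_mul_sum_abs f
    _ = _ := by ring

theorem integrableOn_response_of_integrableOn {v : ℝ → 𝒳 → ℝ}
    (hv : ∀ x, Measurable fun s => v s x) {s : Set ℝ}
    (hi : ∀ x, IntegrableOn (fun u => v u x) s) :
    IntegrableOn (fun u => response r π g u (v u)) s := by
  obtain ⟨B, hB⟩ := exists_abs_response_le hr hπ hg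
  exact Integrable.mono' ((integrable_finsetSum _ fun x _ => (hi x).abs).const_mul B)
    (hg.measurable_response hv).aestronglyMeasurable (.of_forall fun u => hB u (v u))

theorem IsOSS.exists_abs_sum_mul_sub_le (hT : 0 < T) :
    ∃ B, ∀ lam, |lam| * G ≤ 1 → ∀ μ : Measure 𝒳, IsOSS r g T lam μ → ∀ t, 0 ≤ t →
      ∀ f : 𝒳 → ℝ, |∑ x, marginal (perturbedRate r g lam) μ t x * f x - ∑ x, π.real {x} * f x|
        ≤ B * |lam| * ∑ x, |f x| := by
  have := hπ.isProbabilityMeasure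
  obtain ⟨x₀⟩ := nonempty_of_isProbabilityMeasure π
  obtain ⟨K, c, hdec⟩ := hr.exists_hasOscDecay
  have hG : 0 ≤ G := (abs_nonneg _).trans (hg.abs_le 0 x₀ x₀)
  have hR := hr.sum_sum_nonneg
  have hK := hdec.nonneg
  have hc := hdec.rate_pos
  refine ⟨4 * G * (∑ x, ∑ y, r x y) * K / c, fun lam hlam μ hμ t ht f => ?_⟩
  have hq := hr.isAdmissible_perturbedRate hg.measurable hg.abs_le lam
  obtain ⟨p, hp, hper, hpμ⟩ := IsOSS.exists_isForwardSolution hr hg hT hμ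
  rw [← hpμ t ht]
  calc _ ≤ 2 * (|lam| * G) * (∑ x, ∑ y, r x y) * K / c * osc f :=
        hp.abs_sum_mul_sub_sum_mul_le hdec hr hπ hq.toIsBoundedRate hT
          (hg.periodic_perturbedRate r lam) hper
          (fun s x => by simpa only [perturbedRate, sub_one_mul] using
            hr.sum_abs_mul_le (hg.abs_exp_sub_one_le hlam s) x) f t
    _ ≤ 2 * (|lam| * G) * (∑ x, ∑ y, r x y) * K / c * (2 * ∑ x, |f x|) := by
        gcongr
        exact osc_le_two_mul_sum_abs f
    _ = _ := by ring

theorem IsOSS.exists_abs_sum_mul_sub_sub_response_le (hT : 0 < T) :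
    ∃ B, ∀ lam, |lam| * G ≤ 1 → ∀ μ : Measure 𝒳, IsOSS r g T lam μ → ∀ t, 0 ≤ t →
      ∀ f : 𝒳 → ℝ, |∑ x, marginal (perturbedRate r g lam) μ t x * f x - ∑ x, π.real {x} * f x
        - lam * response r π g t f| ≤ B * lam ^ 2 * ∑ x, |f x| := by
  have := hπ.isProbabilityMeasure
  have := nonempty_of_isProbabilityMeasure π
  obtain ⟨K, c, hdec⟩ := hr.exists_hasOscDecay
  have hR := hr.sum_sum_nonneg
  have hK := hdec.nonneg
  have hc := hdec.rate_pos
  refine ⟨(8 * G ^ 2 * (∑ x, ∑ y, r x y) ^ 2 * K / c + G ^ 2 * ∑ x, ∑ y, r x y) * K / c * 2,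
    fun lam hlam μ hμ t ht f => ?_⟩
  have hq := hr.isAdmissible_perturbedRate hg.measurable hg.abs_le lam
  obtain ⟨p, hp, hper, hpμ⟩ := IsOSS.exists_isForwardSolution hr hg hT hμ
  have hfirst : ∀ s x, ∑ y, |perturbedRate r g lam s x y - r x y|
      ≤ 2 * (|lam| * G) * ∑ x, ∑ y, r x y := fun s x => by
    simpa only [perturbedRate, sub_one_mul] using
      hr.sum_abs_mul_le (hg.abs_exp_sub_one_le hlam s) x
  have hsecond : ∀ s x, ∑ y, |perturbedRate r g lam s x y - r x y - lam * g s x y * r x y|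
      ≤ (|lam| * G) ^ 2 * ∑ x, ∑ y, r x y := fun s x => by
    simpa only [perturbedRate, sub_mul, one_mul] using
      hr.sum_abs_mul_le (hg.abs_exp_sub_one_sub_le hlam s) x
  have hresponse : lam * response r π g t f = ∫ s in Set.Ioi (0 : ℝ), ∑ x, π.real {x}
      * generator (fun x y => lam * g (t - s) x y * r x y) (semigroup r s f) x := by
    simp only [response, scalarProd_psi (hπ.real_singleton_pos hr), ← integral_const_mul,
      generator_apply, Finset.mul_sum, mul_assoc, mul_left_comm lam]
  rw [← hpμ t ht, hresponse]
  refine (hp.abs_sum_mul_sub_sum_mul_sub_integral_Ioi_le hdec hr hπ hq.toIsBoundedRate hT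
    (hg.periodic_perturbedRate r lam) hper hfirst hsecond
    (fun x y => ((hg.measurable x y).const_mul lam).mul_const _)
    (fun s => hr.sum_abs_mul_le (hg.abs_mul_le lam s)) f t).trans ?_
  refine (mul_le_mul_of_nonneg_left (osc_le_two_mul_sum_abs f) (by positivity)).trans_eq ?_
  rw [← sq_abs lam]
  ring

end Response

section DerivativeAtZero

theorem hasDerivAt_zero_of_abs_sub_le {F : ℝ → ℝ} {A D K : ℝ}
    (h : ∀ᶠ lam in 𝓝 0, |F lam - A - lam * D| ≤ K * lam ^ 2) : HasDerivAt F D 0 := by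
  have hzero : F 0 = A := by
    have hbound := h.self_of_nhds
    rw [zero_mul, sub_zero, zero_pow two_ne_zero, mul_zero] at hbound
    exact sub_eq_zero.1 (abs_nonpos_iff.1 hbound)
  rw [hasDerivAt_iff_isLittleO, hzero]
  refine Asymptotics.IsBigO.trans_isLittleO (g := fun lam : ℝ => (lam - 0) ^ 2) ?_ ?_
  · refine Asymptotics.IsBigO.of_bound K (h.mono fun lam hlam => ?_)
    simpa only [sub_zero, smul_eq_mul, Real.norm_eq_abs, abs_of_nonneg (sq_nonneg lam)] using hlam
  · simpa only [sub_zero] using Asymptotics.isLittleO_pow_id (𝕜 := ℝ) one_lt_two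

theorem hasDerivAt_zero_setIntegral {s : Set ℝ} (hs : MeasurableSet s) {F : ℝ → ℝ → ℝ}
    {A D m : ℝ → ℝ} (hF : ∀ lam, IntegrableOn (F lam) s) (hA : IntegrableOn A s)
    (hD : IntegrableOn D s) (hm : IntegrableOn m s)
    (h : ∀ᶠ lam in 𝓝 0, ∀ u ∈ s, |F lam u - A u - lam * D u| ≤ m u * lam ^ 2) :
    HasDerivAt (fun lam => ∫ u in s, F lam u) (∫ u in s, D u) 0 := by
  refine hasDerivAt_zero_of_abs_sub_le (A := ∫ u in s, A u) (K := ∫ u in s, m u)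
    (h.mono fun lam hlam => ?_)
  have hFA : IntegrableOn (fun u => F lam u - A u) s := (hF lam).sub hA
  rw [← integral_sub (hF lam) hA, ← integral_const_mul, ← integral_sub hFA (hD.const_mul lam),
    ← integral_mul_const]
  exact norm_integral_le_of_norm_le (f := fun u => F lam u - A u - lam * D u) (hm.mul_const _)
    (ae_restrict_of_forall_mem hs hlam)

theorem eventually_abs_mul_le_one (G : ℝ) : ∀ᶠ lam in 𝓝 (0 : ℝ), |lam| * G ≤ 1 :=
  ((by fun_prop : Continuous fun lam : ℝ => |lam| * G).tendsto' 0 0 (by simp)).eventually_le_const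
    one_pos

end DerivativeAtZero

section Response

variable {𝒳 : Type*} {r : 𝒳 → 𝒳 → ℝ} {g : ℝ → 𝒳 → 𝒳 → ℝ} {T G : ℝ}

section Perturbation

variable (hg : IsPeriodicPerturbation g T G) {α : ℝ → 𝒳 → 𝒳 → ℝ} {s : Set ℝ}
  (hi : ∀ x y, IntegrableOn (fun u => α u x y * r x y) s)
include hg hi

theorem IsPeriodicPerturbation.integrableOn_mul (x y : 𝒳) :
    IntegrableOn (fun u => α u x y * g u x y * r x y) s := by
  simp only [mul_right_comm (α _ x y)]
  exact (hi x y).mul_bdd (hg.measurable x y).aestronglyMeasurable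
    (.of_forall fun u => hg.abs_le u x y)

theorem IsPeriodicPerturbation.integrableOn_mul_perturbedRate (lam : ℝ) (x y : 𝒳) :
    IntegrableOn (fun u => α u x y * perturbedRate r g lam u x y) s := by
  simp only [perturbedRate, mul_left_comm (α _ x y)]
  refine (hi x y).bdd_mul (c := Real.exp (|lam| * G))
    (Real.measurable_exp.comp ((hg.measurable x y).const_mul lam)).aestronglyMeasurable
    (.of_forall fun u => ?_)
  rw [Real.norm_eq_abs, Real.abs_exp]
  exact Real.exp_le_exp.2 ((le_abs_self _).trans (hg.abs_mul_le lam u x y))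

end Perturbation

variable [Fintype 𝒳]

theorem integrableOn_contract {α : ℝ → 𝒳 → 𝒳 → ℝ} {s : Set ℝ}
    (hi : ∀ x y, IntegrableOn (fun u => α u x y * r x y) s) (x : 𝒳) :
    IntegrableOn (fun u => contract r α u x) s :=
  integrable_finsetSum _ fun y _ => hi x y

theorem measurable_contract {α : ℝ → 𝒳 → 𝒳 → ℝ} (hα : ∀ x y, Measurable fun s => α s x y)
    (x : 𝒳) : Measurable fun s => contract r α s x :=
  Finset.measurable_sum _ fun y _ => (hα x y).mul_const _

theorem IsPeriodicPerturbation.abs_contract_perturbedRate_sub_sub_le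
    (hg : IsPeriodicPerturbation g T G) {lam : ℝ} (hlam : |lam| * G ≤ 1) (α : ℝ → 𝒳 → 𝒳 → ℝ)
    (t : ℝ) (x : 𝒳) :
    |contract (perturbedRate r g lam t) α t x - contract r α t x
        - lam * contract r (fun s x y => α s x y * g s x y) t x|
      ≤ (|lam| * G) ^ 2 * ∑ x, ∑ y, |α t x y * r x y| := by
  calc _ = |∑ y, (Real.exp (lam * g t x y) - 1 - lam * g t x y) * (α t x y * r x y)| := by
        simp only [contract, perturbedRate, Finset.mul_sum, ← Finset.sum_sub_distrib]
        exact congrArg abs (Finset.sum_congr rfl fun y _ => by ring)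
    _ ≤ ∑ y, (|lam| * G) ^ 2 * |α t x y * r x y| :=
        (Finset.abs_sum_le_sum_abs _ _).trans <| Finset.sum_le_sum fun y _ => by
          rw [abs_mul]
          exact mul_le_mul_of_nonneg_right (hg.abs_exp_sub_one_sub_le hlam t x y) (abs_nonneg _)
    _ ≤ (|lam| * G) ^ 2 * ∑ x, ∑ y, |α t x y * r x y| := by
        rw [← Finset.mul_sum]
        refine mul_le_mul_of_nonneg_left ?_ (sq_nonneg _)
        exact Finset.single_le_sum (f := fun x => ∑ y, |α t x y * r x y|)
          (fun x _ => Finset.sum_nonneg fun y _ => abs_nonneg _) (Finset.mem_univ x)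

variable [MeasurableSpace 𝒳] [MeasurableSingletonClass 𝒳] {q : ℝ → 𝒳 → 𝒳 → ℝ} {ν : Measure 𝒳}

section Expectation

variable [IsProbabilityMeasure ν]

theorem hasExpect_intervalIntegral {v : ℝ → 𝒳 → ℝ} (hv : ∀ x, Measurable fun s => v s x) {t : ℝ}
    (ht : 0 ≤ t) (hi : ∀ x, IntegrableOn (fun s => v s x) (Set.Ioc 0 t)) :
    HasExpect q ν fun ξ => ∫ s in (0 : ℝ)..t, v s (ξ s) := by
  simp only [HasExpect, intervalIntegral.integral_of_le ht]
  exact (integrable_path_prod q ν hv hi).integral_prod_left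

theorem expect_intervalIntegral {v : ℝ → 𝒳 → ℝ} (hv : ∀ x, Measurable fun s => v s x) {t : ℝ}
    (ht : 0 ≤ t) (hi : ∀ x, IntegrableOn (fun s => v s x) (Set.Ioc 0 t)) :
    expect q ν (fun ξ => ∫ s in (0 : ℝ)..t, v s (ξ s))
      = ∫ s in Set.Ioc 0 t, ∑ x, marginal q ν s x * v s x := by
  simp only [expect, intervalIntegral.integral_of_le ht]
  exact integral_path_setIntegral q ν hv hi

theorem IsAdmissible.expect_jumpSum {C : ℝ} (hq : IsAdmissible q C) {α : ℝ → 𝒳 → 𝒳 → ℝ}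
    (hα : ∀ x y, Measurable fun s => α s x y) {t : ℝ}
    (hi : ∀ x y, IntegrableOn (fun s => α s x y * q s x y) (Set.Ioc 0 t)) :
    expect q ν (jumpSum α t)
      = ∫ s in Set.Ioc 0 t, ∑ x, marginal q ν s x * contract (q s) α s x := by
  have hmarginal : ∀ x y, IntegrableOn (fun s => marginal q ν s x * (α s x y * q s x y))
      (Set.Ioc 0 t) := fun x y => integrableOn_marginal_mul q ν (hi x y) x
  simp only [contract, Finset.mul_sum]
  rw [integral_finsetSum _ fun x _ => integrable_finsetSum _ fun y _ => hmarginal x y]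
  refine (hq.integral_jumpSum ν hα hi).2.trans (Finset.sum_congr rfl fun x _ => ?_)
  exact (integral_finsetSum _ fun y _ => hmarginal x y).symm

end Expectation

section Stationary

variable {π : Measure 𝒳} (hπ : IsInvariantDistribution r π)
include hπ

theorem IsInvariantDistribution.expect_path {s : ℝ} (hs : 0 ≤ s) (f : 𝒳 → ℝ) :
    expect (fun _ => r) π (fun ξ => f (ξ s)) = ∑ x, π.real {x} * f x := by
  have := hπ.isProbabilityMeasure
  simp only [expect, integral_path, hπ.marginal_eq hs]

theorem IsInvariantDistribution.intervalIntegrable_expect_path {v : ℝ → 𝒳 → ℝ} {t : ℝ}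
    (ht : 0 ≤ t) (hi : ∀ x, IntegrableOn (fun s => v s x) (Set.Ioc 0 t)) :
    IntervalIntegrable (fun s => expect (fun _ => r) π fun ξ => v s (ξ s)) volume 0 t := by
  rw [intervalIntegrable_iff_integrableOn_Ioc_of_le ht]
  exact (integrable_finsetSum _ fun x _ => (hi x).const_mul (π.real {x})).congr
    (ae_restrict_of_forall_mem measurableSet_Ioc fun s hs => (hπ.expect_path hs.1.le (v s)).symm)

theorem IsInvariantDistribution.intervalIntegral_expect_path (v : ℝ → 𝒳 → ℝ) {t : ℝ}
    (ht : 0 ≤ t) :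
    ∫ s in (0 : ℝ)..t, expect (fun _ => r) π (fun ξ => v s (ξ s))
      = ∫ s in (0 : ℝ)..t, ∑ x, π.real {x} * v s x :=
  intervalIntegral.integral_congr fun s hs => hπ.expect_path
    ((Set.uIcc_of_le ht ▸ hs : s ∈ Set.Icc 0 t).1) (v s)

end Stationary

section PathIntegrable

variable (hr : IsIrreducibleRate r)
include hr

theorem IsPathIntegrable.lintegral_marginal_mul_lt_top [IsProbabilityMeasure ν]
    {α : ℝ → 𝒳 → 𝒳 → ℝ} (hα : ∀ x y, Measurable fun s => α s x y) {t : ℝ}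
    (h : IsPathIntegrable r ν t α) (x y : 𝒳) :
    ∫⁻ s in Set.Ioc 0 t, ENNReal.ofReal (marginal (fun _ => r) ν s x * |α s x y * r x y|) < ∞ := by
  obtain ⟨C, hq⟩ := hr.exists_isAdmissible
  have habs : ∀ x y, Measurable fun s => |α s x y| := fun x y => (hα x y).abs
  rcases h with hjumps | htime
  · have hF : Measurable fun z : ℝ × 𝒳 × 𝒳 => ENNReal.ofReal |α z.1 z.2.1 z.2.2| :=
      measurable_from_prod_countable_left fun z => (habs z.1 z.2).ennreal_ofReal
    simp only [jumpSumAbs] at hjumps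
    rw [hq.lintegral_tsum_jumps ν hF] at hjumps
    refine lt_of_eq_of_lt (lintegral_congr fun s => ?_) (ENNReal.sum_lt_top.1
      (ENNReal.sum_lt_top.1 hjumps x (Finset.mem_univ x)) y (Finset.mem_univ y))
    rw [← ENNReal.ofReal_mul (mul_nonneg (marginal_nonneg _ ν s x) (hr.nonneg x y)), abs_mul,
      abs_of_nonneg (hr.nonneg x y), mul_assoc, mul_comm (r x y)]
  · rw [lintegral_path_setLIntegral (fun _ => r) ν
      (v := fun s x => ENNReal.ofReal (contract r (fun s x y => |α s x y|) s x))
      fun x => (measurable_contract habs x).ennreal_ofReal] at htime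
    refine (lintegral_mono fun s => ?_).trans_lt (ENNReal.sum_lt_top.1 htime x (Finset.mem_univ x))
    rw [ENNReal.ofReal_mul (marginal_nonneg _ ν s x), abs_mul, abs_of_nonneg (hr.nonneg x y)]
    gcongr
    exact Finset.single_le_sum (f := fun y => |α s x y| * r x y)
      (fun y _ => mul_nonneg (abs_nonneg _) (hr.nonneg x y)) (Finset.mem_univ y)

theorem IsPathIntegrable.integrableOn_mul {π : Measure 𝒳} (hπ : IsInvariantDistribution r π)
    {α : ℝ → 𝒳 → 𝒳 → ℝ} (hα : ∀ x y, Measurable fun s => α s x y) {t : ℝ}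
    (h : IsPathIntegrable r π t α) (x y : 𝒳) :
    IntegrableOn (fun s => α s x y * r x y) (Set.Ioc 0 t) := by
  have := hπ.isProbabilityMeasure
  have hfinite := h.lintegral_marginal_mul_lt_top hr hα x y
  have hstationary : ∫⁻ s in Set.Ioc 0 t,
        ENNReal.ofReal (marginal (fun _ => r) π s x * |α s x y * r x y|)
      = ENNReal.ofReal (π.real {x}) * ∫⁻ s in Set.Ioc 0 t, ENNReal.ofReal |α s x y * r x y| := by
    rw [← lintegral_const_mul _ ((hα x y).mul_const _).abs.ennreal_ofReal]
    refine setLIntegral_congr_fun measurableSet_Ioc fun s hs => ?_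
    simp only [hπ.marginal_eq hs.1.le, ENNReal.ofReal_mul measureReal_nonneg]
  refine ⟨((hα x y).mul_const _).aestronglyMeasurable, ?_⟩
  rw [hstationary] at hfinite
  simp only [hasFiniteIntegral_iff_norm, Real.norm_eq_abs]
  exact ENNReal.lt_top_of_mul_ne_top_right hfinite.ne
    (ENNReal.ofReal_pos.2 (hπ.real_singleton_pos hr x)).ne'

end PathIntegrable

variable {π : Measure 𝒳} (hr : IsIrreducibleRate r) (hπ : IsInvariantDistribution r π)
include hr hπ

theorem expect_two_time (v h : 𝒳 → ℝ) {s : ℝ} (hs : 0 ≤ s) :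
    expect (fun _ => r) π (fun ξ => v (ξ s) * h (ξ 0)) = scalarProd π (semigroup r s v) h := by
  have := hπ.isProbabilityMeasure
  obtain ⟨C, hq⟩ := hr.exists_isAdmissible
  rw [expect, hq.integral_two_time π s v h, ← hr.transProb_mulVec hs v]
  rfl

theorem setIntegral_expect_two_time (v : 𝒳 → ℝ) (t : ℝ) :
    ∫ s in Set.Ioi (0 : ℝ), expect (fun _ => r) π (fun ξ => v (ξ s) * psi r π g (t - s) (ξ 0))
      = response r π g t v :=
  setIntegral_congr_fun measurableSet_Ioi fun _ hs => expect_two_time hr hπ v _ (le_of_lt hs)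

variable (hg : IsPeriodicPerturbation g T G)
include hg

theorem integrableOn_expect_two_time (v : 𝒳 → ℝ) (t : ℝ) :
    IntegrableOn (fun s => expect (fun _ => r) π
      (fun ξ => v (ξ s) * psi r π g (t - s) (ξ 0))) (Set.Ioi 0) :=
  (integrableOn_response hr hπ hg t v).congr_fun
    (fun _ hs => (expect_two_time hr hπ v _ (le_of_lt hs)).symm) measurableSet_Ioi

theorem intervalIntegrable_response {v : ℝ → 𝒳 → ℝ} (hv : ∀ x, Measurable fun s => v s x) {t : ℝ}
    (ht : 0 ≤ t) (hi : ∀ x, IntegrableOn (fun u => v u x) (Set.Ioc 0 t)) :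
    IntervalIntegrable (fun u => response r π g u (v u)) volume 0 t :=
  (intervalIntegrable_iff_integrableOn_Ioc_of_le ht).2
    (integrableOn_response_of_integrableOn hr hπ hg hv hi)

theorem IsOSS.exists_abs_sum_mul_contract_sub_le (hT : 0 < T) :
    ∃ B₁ B₂, ∀ lam, |lam| * G ≤ 1 → ∀ μ : Measure 𝒳, IsOSS r g T lam μ → ∀ t, 0 ≤ t →
      ∀ α : ℝ → 𝒳 → 𝒳 → ℝ, |∑ x, marginal (perturbedRate r g lam) μ t x
          * contract (perturbedRate r g lam t) α t x - ∑ x, π.real {x} * contract r α t x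
        - lam * (∑ x, π.real {x} * contract r (fun s x y => α s x y * g s x y) t x
          + response r π g t (contract r α t))|
        ≤ (B₂ * ∑ x, |contract r α t x|
            + B₁ * ∑ x, |contract r (fun s x y => α s x y * g s x y) t x|
            + G ^ 2 * ∑ x, ∑ y, |α t x y * r x y|) * lam ^ 2 := by
  obtain ⟨B₁, hB₁⟩ := IsOSS.exists_abs_sum_mul_sub_le hr hπ hg hT
  obtain ⟨B₂, hB₂⟩ := IsOSS.exists_abs_sum_mul_sub_sub_response_le hr hπ hg hT
  refine ⟨B₁, B₂, fun lam hlam μ hμ t ht α => ?_⟩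
  have := hμ.1
  set p := marginal (perturbedRate r g lam) μ t
  set αg : ℝ → 𝒳 → 𝒳 → ℝ := fun s x y => α s x y * g s x y
  have hfirst := mul_le_mul_of_nonneg_left (hB₁ lam hlam μ hμ t ht (contract r αg t))
    (abs_nonneg lam)
  rw [← abs_mul] at hfirst
  have hremainder := abs_sum_mul_le_of_mem_stdSimplex
    ⟨marginal_nonneg (perturbedRate r g lam) μ t, sum_marginal (perturbedRate r g lam) μ t⟩
    fun x => hg.abs_contract_perturbedRate_sub_sub_le (r := r) hlam α t x
  calc _ = |(∑ x, p x * contract r α t x - ∑ x, π.real {x} * contract r α t x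
            - lam * response r π g t (contract r α t))
          + lam * (∑ x, p x * contract r αg t x - ∑ x, π.real {x} * contract r αg t x)
          + ∑ x, p x * (contract (perturbedRate r g lam t) α t x - contract r α t x
            - lam * contract r αg t x)| := by
        simp only [mul_sub, Finset.sum_sub_distrib, mul_left_comm _ lam, ← Finset.mul_sum]
        ring_nf
    _ ≤ _ := (abs_add_three _ _ _).trans
        (add_le_add_three (hB₂ lam hlam μ hμ t ht _) hfirst hremainder)
    _ = _ := by
        simp only [← sq_abs lam]
        ring

variable {πl : ℝ → Measure 𝒳} (hT : 0 < T) (hπl : ∀ lam, IsOSS r g T lam (πl lam))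
include hT hπl

theorem hasDerivAt_expect_path (v : 𝒳 → ℝ) {t : ℝ} (ht : 0 ≤ t) :
    HasDerivAt (fun lam => expect (perturbedRate r g lam) (πl lam) (fun ξ => v (ξ t)))
      (response r π g t v) 0 := by
  obtain ⟨B, hB⟩ := IsOSS.exists_abs_sum_mul_sub_sub_response_le hr hπ hg hT
  refine hasDerivAt_zero_of_abs_sub_le (A := ∑ x, π.real {x} * v x) (K := B * ∑ x, |v x|)
    ((eventually_abs_mul_le_one G).mono fun lam hlam => ?_)
  have := (hπl lam).1
  rw [expect, integral_path, mul_right_comm]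
  exact hB lam hlam _ (hπl lam) t ht v

theorem hasDerivAt_expect_intervalIntegral {v : ℝ → 𝒳 → ℝ} (hv : ∀ x, Measurable fun s => v s x)
    {t : ℝ} (ht : 0 ≤ t) (hi : ∀ x, IntegrableOn (fun s => v s x) (Set.Ioc 0 t)) :
    HasDerivAt (fun lam => expect (perturbedRate r g lam) (πl lam)
      (fun ξ => ∫ s in (0 : ℝ)..t, v s (ξ s))) (∫ u in (0 : ℝ)..t, response r π g u (v u)) 0 := by
  have hprob := fun lam => (hπl lam).1
  obtain ⟨B, hB⟩ := IsOSS.exists_abs_sum_mul_sub_sub_response_le hr hπ hg hT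
  simp only [expect_intervalIntegral hv ht hi]
  rw [intervalIntegral.integral_of_le ht]
  refine hasDerivAt_zero_setIntegral measurableSet_Ioc (A := fun u => ∑ x, π.real {x} * v u x)
    (m := fun u => B * ∑ x, |v u x|)
    (fun lam => integrable_finsetSum _ fun x _ => integrableOn_marginal_mul _ _ (hi x) x)
    (integrable_finsetSum _ fun x _ => (hi x).const_mul _)
    (integrableOn_response_of_integrableOn hr hπ hg hv hi)
    ((integrable_finsetSum _ fun x _ => (hi x).abs).const_mul B)
    ((eventually_abs_mul_le_one G).mono fun lam hlam u hu => ?_)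
  rw [mul_right_comm]
  exact hB lam hlam _ (hπl lam) u hu.1.le (v u)

theorem hasDerivAt_expect_jumpSum {α : ℝ → 𝒳 → 𝒳 → ℝ} (hα : ∀ x y, Measurable fun s => α s x y)
    {t : ℝ} (ht : 0 ≤ t) (hi : ∀ x y, IntegrableOn (fun s => α s x y * r x y) (Set.Ioc 0 t)) :
    HasDerivAt (fun lam => expect (perturbedRate r g lam) (πl lam) (jumpSum α t))
      ((∫ s in (0 : ℝ)..t, ∑ x, π.real {x} * contract r (fun s x y => α s x y * g s x y) s x)
        + ∫ s in (0 : ℝ)..t, response r π g s (contract r α s)) 0 := by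
  have hprob := fun lam => (hπl lam).1
  have hiα := integrableOn_contract hi
  have hiαg := integrableOn_contract (hg.integrableOn_mul hi)
  have hiq := hg.integrableOn_mul_perturbedRate hi
  have hiπ : IntegrableOn (fun s => ∑ x, π.real {x}
      * contract r (fun s x y => α s x y * g s x y) s x) (Set.Ioc 0 t) :=
    integrable_finsetSum _ fun x _ => (hiαg x).const_mul _
  have hires := integrableOn_response_of_integrableOn hr hπ hg (measurable_contract hα) hiα
  obtain ⟨B₁, B₂, hB⟩ := IsOSS.exists_abs_sum_mul_contract_sub_le hr hπ hg hT
  simp only [fun lam => (hr.isAdmissible_perturbedRate hg.measurable hg.abs_le lam).expect_jumpSum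
    hα (hiq lam) (ν := πl lam), intervalIntegral.integral_of_le ht]
  rw [← integral_add hiπ hires]
  refine hasDerivAt_zero_setIntegral measurableSet_Ioc
    (fun lam => integrable_finsetSum _ fun x _ => integrableOn_marginal_mul _ _
      (integrable_finsetSum _ fun y _ => hiq lam x y) x)
    (integrable_finsetSum _ fun x _ => (hiα x).const_mul (π.real {x})) (hiπ.add hires) ?_
    ((eventually_abs_mul_le_one G).mono fun lam hlam u hu =>
      hB lam hlam _ (hπl lam) u hu.1.le α)
  exact (((integrable_finsetSum _ fun x _ => (hiα x).abs).const_mul B₂).add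
    ((integrable_finsetSum _ fun x _ => (hiαg x).abs).const_mul B₁)).add
    ((integrable_finsetSum _ fun x _ => integrable_finsetSum _ fun y _ => (hi x y).abs).const_mul _)

end Response

end MarkovJump

theorem mainTheorem5
    {𝒳 : Type*} [Fintype 𝒳] [Nonempty 𝒳] [MeasurableSpace 𝒳] [MeasurableSingletonClass 𝒳]
    (r : 𝒳 → 𝒳 → ℝ) (hr_nonneg : ∀ x y, 0 ≤ r x y) (hr_diag : ∀ x, r x x = 0)
    (hr_irred : ∀ x y, Relation.ReflTransGen (fun a b => 0 < r a b) x y)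
    (T : ℝ) (hT : 0 < T)
    (g : ℝ → 𝒳 → 𝒳 → ℝ)
    (hg_per : ∀ x y, Function.Periodic (fun s => g s x y) T)
    (hg_meas : ∀ x y, Measurable fun s => g s x y)
    (hg_bdd : ∃ C : ℝ, ∀ s x y, |g s x y| ≤ C) :
    -- the invariant distribution and the oscillatory steady states exist and are unique
    (∃! π : Measure 𝒳, IsInvariantDistribution r π) ∧
    (∀ lam : ℝ, ∃! μ : Measure 𝒳, IsOSS r g T lam μ) ∧
    ∀ (π : Measure 𝒳) (πl : ℝ → Measure 𝒳), IsInvariantDistribution r π →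
      (∀ lam, IsOSS r g T lam (πl lam)) →
      ∀ t : ℝ, 0 ≤ t →
      -- (1) observables
      (∀ v : 𝒳 → ℝ,
        (∀ lam, HasExpect (perturbedRate r g lam) (πl lam)
          (fun ξ => v (ξ t))) ∧
        IntegrableOn (fun s => scalarProd π
          (semigroup r s v) (psi r π g (t - s))) (Set.Ioi 0) ∧
        (∀ s, 0 ≤ s → HasExpect (fun _ => r) π
          (fun ξ => v (ξ s) * psi r π g (t - s) (ξ 0))) ∧
        IntegrableOn (fun s => expect (fun _ => r) π
          (fun ξ => v (ξ s) * psi r π g (t - s) (ξ 0))) (Set.Ioi 0) ∧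
        HasDerivAt (fun lam => expect (perturbedRate r g lam) (πl lam)
            (fun ξ => v (ξ t)))
          (∫ s in Set.Ioi (0 : ℝ), scalarProd π
            (semigroup r s v) (psi r π g (t - s))) 0 ∧
        (∫ s in Set.Ioi (0 : ℝ), scalarProd π
            (semigroup r s v) (psi r π g (t - s)))
          = ∫ s in Set.Ioi (0 : ℝ), expect (fun _ => r) π
              (fun ξ => v (ξ s) * psi r π g (t - s) (ξ 0))) ∧
      -- (2) time-integrated observables
      (∀ v : ℝ → 𝒳 → ℝ, (∀ x, Measurable fun s => v s x) →
        (∀ x, IntegrableOn (fun s => v s x) (Set.Icc 0 t)) →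
        (∀ lam, HasExpect (perturbedRate r g lam) (πl lam)
          (fun ξ => ∫ s in (0 : ℝ)..t, v s (ξ s))) ∧
        (∀ u, IntegrableOn (fun s => scalarProd π
          (semigroup r s (v u)) (psi r π g (u - s))) (Set.Ioi 0)) ∧
        IntervalIntegrable (fun u => ∫ s in Set.Ioi (0 : ℝ), scalarProd π
          (semigroup r s (v u)) (psi r π g (u - s)))
          volume 0 t ∧
        (∀ u s, 0 ≤ s → HasExpect (fun _ => r) π
          (fun ξ => v u (ξ s) * psi r π g (u - s) (ξ 0))) ∧
        (∀ u, IntegrableOn (fun s => expect (fun _ => r) π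
          (fun ξ => v u (ξ s) * psi r π g (u - s) (ξ 0))) (Set.Ioi 0)) ∧
        IntervalIntegrable (fun u => ∫ s in Set.Ioi (0 : ℝ), expect (fun _ => r) π
          (fun ξ => v u (ξ s) * psi r π g (u - s) (ξ 0)))
          volume 0 t ∧
        HasDerivAt (fun lam => expect (perturbedRate r g lam) (πl lam)
            (fun ξ => ∫ s in (0 : ℝ)..t, v s (ξ s)))
          (∫ u in (0 : ℝ)..t, ∫ s in Set.Ioi (0 : ℝ), scalarProd π
            (semigroup r s (v u)) (psi r π g (u - s))) 0 ∧
        (∫ u in (0 : ℝ)..t, ∫ s in Set.Ioi (0 : ℝ), scalarProd π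
            (semigroup r s (v u)) (psi r π g (u - s)))
          = ∫ u in (0 : ℝ)..t, ∫ s in Set.Ioi (0 : ℝ), expect (fun _ => r) π
              (fun ξ => v u (ξ s) * psi r π g (u - s) (ξ 0))) ∧
      -- (3) additive functionals of the jumps
      (∀ α : ℝ → 𝒳 → 𝒳 → ℝ, (∀ x y, Measurable fun s => α s x y) →
        IsPathIntegrable r π t α →
        (∀ lam, HasExpect (perturbedRate r g lam) (πl lam)
          (jumpSum α t)) ∧
        (∀ s, 0 ≤ s → HasExpect (fun _ => r) π
          (fun ξ => contract r (fun s x y => α s x y * g s x y) s (ξ s))) ∧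
        IntervalIntegrable (fun s => expect (fun _ => r) π
          (fun ξ => contract r (fun s x y => α s x y * g s x y) s (ξ s)))
          volume 0 t ∧
        (∀ s u, 0 ≤ u → HasExpect (fun _ => r) π
          (fun ξ => contract r α s (ξ u) * psi r π g (s - u) (ξ 0))) ∧
        (∀ s, IntegrableOn (fun u => expect (fun _ => r) π
          (fun ξ => contract r α s (ξ u) * psi r π g (s - u) (ξ 0)))
          (Set.Ioi 0)) ∧
        IntervalIntegrable (fun s => ∫ u in Set.Ioi (0 : ℝ), expect (fun _ => r) π
          (fun ξ => contract r α s (ξ u) * psi r π g (s - u) (ξ 0)))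
          volume 0 t ∧
        HasDerivAt (fun lam => expect (perturbedRate r g lam) (πl lam)
            (jumpSum α t))
          ((∫ s in (0 : ℝ)..t, expect (fun _ => r) π
              (fun ξ => contract r (fun s x y => α s x y * g s x y) s (ξ s)))
            + ∫ s in (0 : ℝ)..t, ∫ u in Set.Ioi (0 : ℝ), expect (fun _ => r) π
              (fun ξ => contract r α s (ξ u)
                * psi r π g (s - u) (ξ 0))) 0) := by
  have hr : IsIrreducibleRate r := ⟨hr_nonneg, hr_diag, hr_irred⟩
  obtain ⟨G, hG⟩ := hg_bdd
  have hg : IsPeriodicPerturbation g T G := ⟨hg_meas, hG, hg_per⟩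
  refine ⟨hr.existsUnique_isInvariantDistribution, existsUnique_isOSS hr hg hT,
    fun π πl hπ hπl t ht => ?_⟩
  have := hπ.isProbabilityMeasure
  have hprob := fun lam => (hπl lam).1
  simp only [setIntegral_expect_two_time hr hπ]
  refine ⟨fun v => ?_, fun v hv hvi => ?_, fun α hα hαi => ?_⟩
  · exact ⟨fun lam => integrable_path _ _ t v, integrableOn_response hr hπ hg t v,
      fun s _ => integrable_two_time _ _ s v _, integrableOn_expect_two_time hr hπ hg v t,
      hasDerivAt_expect_path hr hπ hg hT hπl v ht, rfl⟩
  · have hi := fun x => (hvi x).mono_set Set.Ioc_subset_Icc_self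
    have hresponse := intervalIntegrable_response hr hπ hg hv ht hi
    exact ⟨fun lam => hasExpect_intervalIntegral hv ht hi,
      fun u => integrableOn_response hr hπ hg u (v u), hresponse,
      fun u s _ => integrable_two_time _ _ s (v u) _,
      fun u => integrableOn_expect_two_time hr hπ hg (v u) u, hresponse,
      hasDerivAt_expect_intervalIntegral hr hπ hg hT hπl hv ht hi, rfl⟩
  · have hi := hαi.integrableOn_mul hr hπ hα
    rw [hπ.intervalIntegral_expect_path _ ht]
    exact ⟨fun lam => ((hr.isAdmissible_perturbedRate hg_meas hG lam).integral_jumpSum (πl lam) hα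
        (hg.integrableOn_mul_perturbedRate hi lam)).1, fun s _ => integrable_path _ _ s _,
      hπ.intervalIntegrable_expect_path ht (integrableOn_contract (hg.integrableOn_mul hi)),
      fun s u _ => integrable_two_time _ _ u _ _,
      fun s => integrableOn_expect_two_time hr hπ hg (contract r α s) s,
      intervalIntegrable_response hr hπ hg (measurable_contract hα) ht (integrableOn_contract hi),
      hasDerivAt_expect_jumpSum hr hπ hg hT hπl hα ht hi⟩
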